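/- Let $\Bbbk$ be a field with an involutive automorphism $a\mapsto\bar a$ (possibly trivial). Let $H$ be a ribbon Hopf superalgebra over $\Bbbk$: a Hopf superalgebra (all structure maps even) with an even invertible universal $R$-matrix $R\in H\otimes H$, i.e. $R\,\Delta(x)=\tau(\Delta x)\,R$, $(\Delta\otimes 1)R=R_{13}R_{23}$, $(1\otimes\Delta)R=R_{13}R_{12}$ in the graded tensor powers of $H$, and an even central invertible element $\theta$ with $\tau(R)R\,\Delta(\theta)=\theta\otimes\theta$, $\epsilon(\theta)=1$, $S(\theta)=\theta$; its pivot is $g=u\theta^{-1}$, where $u=\sum(-1)^{|a||b|}S(b)a$ for $R=\sum a\otimes b$. Here $\tau(x\otimes y)=(-1)^{|x||y|}y\otimes x$. Let $\dagger:H\to H$ be an antilinear parity-preserving bijection such that $$(xy)^\dagger=(-1)^{|x||y|}y^\dagger x^\dagger,\quad \Delta(x^\dagger)=(\dagger\otimes\dagger)(\tau(\Delta x)),\quad (\dagger\otimes\dagger)R=\tau(R^{-1}),\quad g^\dagger=g^{-1}.$$ The category $H$-mod of finite-dimensional $H$-modules (super vector spaces with graded action) and even $H$-linear maps has braiding $c_{V,W}(v\otimes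 w)=\tau(R(v\otimes w))$ and twist $\theta_V$ given by the action of $\theta^{-1}$; the dual module is $V^*$ with $(x\phi)(v)=(-1)^{|x||\phi|}\phi(S(x)v)$. Let $\sqrt\theta$ be a half twist: a natural automorphism of the identity functor of $H$-mod with $(\sqrt\theta_V)^2=\theta_V$, $\sqrt\theta_{V^*}=(\sqrt\theta_V)^*$ and $\sqrt\theta_{\mathbb I}=\mathrm{Id}$, and put $${\mathsf X}_{V,W}=(\sqrt\theta_{W\otimes V})^{-1}\,c_{V,W}\,(\sqrt\theta_V\otimes\sqrt\theta_W):V\otimes W\to W\otimes V.$$ Let $H^\dagger$-mod be the category whose objects are the finite-dimensional $H$-modules $V$ with a non-degenerate sesquilinear form $(\cdot|\cdot)_V$, antilinear in the first variable, zero on pairs of vectors of opposite parity, and satisfying $(xv|v')_V=(-1)^{|x||v|}(v|x^\dagger v')_V$, and whose morphisms are all even $H$-linear maps. The unit object $\Bbbk$ has the form $(a|b)=\bar a b$. The tensor product $V\otimes W$ has the form $$(z|z')_{V\otimes W}=(z\,|\,\tau({\mathsf X}_{V,W}z'))_p,\qquad (v\otimes w|v'\otimes w')_p=(-1)^{|v'||w|}(v|v')_V(w|w')_W,$$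 and the dual $V^*$ has the form $(\varphi|\psi)_{V^*}=\sum_i\overline{\varphi(e_i)}\psi(e_i')$, where $\{e_i\}$ is a basis of $V$ and $(e_i|e_j')_V=\delta_{ij}$. Then $H^\dagger$-mod is a tensor $\Bbbk$-category, and it is a sesquilinear pivotal $\Bbbk$-category in the following sense. (1) It is pivotal, with duals $V^*$ as above and duality morphisms $$\overrightarrow{\mathrm{coev}}_V:1\mapsto\sum_i v_i\otimes v_i^*,\qquad \overrightarrow{\mathrm{ev}}_V:f\otimes v\mapsto f(v),$$ $$\overleftarrow{\mathrm{coev}}_V:1\mapsto\sum_i(-1)^{|v_i|}v_i^*\otimes g^{-1}v_i,\qquad \overleftarrow{\mathrm{ev}}_V:v\otimes f\mapsto(-1)^{|f||v|}f(gv)$$ ($\{v_i\}$ a homogeneous basis of $V$): the two dualities satisfy the zigzag identities and induce the same transposes of morphisms and the same isomorphisms $W^*\otimes V^*\cong(V\otimes W)^*$. (2) Each morphism $f:V\to W$ has a unique adjoint $f^\dagger:W\to V$ in $H^\dagger$-mod with $(f(v)|w)_W=(v|f^\dagger(w))_V$ for all $v\in V$, $w\in W$. The map $f\mapsto f^\dagger$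 is a (not necessarily involutive) conjugation: it is an antilinear bijection $\mathrm{Hom}(V,W)\to\mathrm{Hom}(W,V)$ with $(f\circ g)^\dagger=g^\dagger\circ f^\dagger$ and $(f\otimes g)^\dagger=f^\dagger\otimes g^\dagger$, and the associativity and unit isomorphisms are unitary. (3) For every $V$: $\overrightarrow{\mathrm{coev}}_V^{\,\dagger}=\overleftarrow{\mathrm{ev}}_V$, $\overrightarrow{\mathrm{ev}}_V^{\,\dagger}=\overleftarrow{\mathrm{coev}}_V$, $\overleftarrow{\mathrm{coev}}_V^{\,\dagger}=\overrightarrow{\mathrm{ev}}_V$, $\overleftarrow{\mathrm{ev}}_V^{\,\dagger}=\overrightarrow{\mathrm{coev}}_V$. Furthermore, the maps $c_{V,W}$ form a braiding on $H^\dagger$-mod and $c_{V,W}^\dagger=c_{V,W}^{-1}$ for all $V,W$. -/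

import Mathlib

open TensorProduct CategoryTheory MonoidalCategory

universe u w

set_option linter.unusedSectionVars false
set_option linter.unusedVariables false

noncomputable section

namespace SuperHopf

/-! ### Super vector spaces -/

/-- The Koszul sign `(-1) ^ (i * j)` of two parities. -/
def koszulSign (k : Type*) [Ring k] (i j : ZMod 2) : k := (-1) ^ (i.val * j.val)

/-- A super vector space: a vector space with a `ℤ/2`-grading `V = V₀ ⊕ V₁`. -/
class SuperSpace (k V : Type*) [Field k] [AddCommGroup V] [Module k V] where
  /-- The subspace of homogeneous vectors of parity `i`. -/
  gr : ZMod 2 → Submodule k V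
  isCompl : IsCompl (gr 0) (gr 1)

section SuperLinear

variable {k : Type*} [Field k]
variable {A B C D E F V W : Type*}
  [AddCommGroup A] [Module k A] [AddCommGroup B] [Module k B]
  [AddCommGroup C] [Module k C] [AddCommGroup D] [Module k D]
  [AddCommGroup E] [Module k E] [AddCommGroup F] [Module k F]
  [AddCommGroup V] [Module k V] [AddCommGroup W] [Module k W]

/-- The homogeneous vectors of parity `i`. -/
abbrev gr (k : Type*) {V : Type*} [Field k] [AddCommGroup V] [Module k V] [SuperSpace k V]
    (i : ZMod 2) : Submodule k V := SuperSpace.gr i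

/-- The projection onto the odd part along the even part. -/
def oddPart (k V : Type*) [Field k] [AddCommGroup V] [Module k V] [SuperSpace k V] :
    V →ₗ[k] V := (gr k (V := V) 1).projection (gr k 0) SuperSpace.isCompl.symm

theorem zmod2_cases (i : ZMod 2) : i = 0 ∨ i = 1 := by
  fin_cases i
  · exact Or.inl rfl
  · exact Or.inr rfl

theorem oddPart_of_mem [SuperSpace k V] {i : ZMod 2} {v : V} (hv : v ∈ gr k i) :
    oddPart k V v = (i.val : k) • v := by
  rcases zmod2_cases i with rfl | rfl
  · simpa [oddPart, Submodule.projection_apply_eq_zero_iff] using hv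
  · rw [oddPart, Submodule.projection_apply_of_mem_left _ hv]
    simp [ZMod.val_one]

/-- To prove an additive property of all vectors it suffices to treat homogeneous ones. -/
@[elab_as_elim]
theorem homog_induction (k : Type*) [Field k] {V : Type*} [AddCommGroup V] [Module k V]
    [SuperSpace k V] {p : V → Prop}
    (hadd : ∀ a b, p a → p b → p (a + b)) (hom : ∀ i, ∀ v ∈ gr k i, p v) (v : V) : p v := by
  obtain ⟨a, b, ha, hb, rfl⟩ := Submodule.codisjoint_iff_exists_add_eq.1
    (SuperSpace.isCompl (k := k) (V := V)).codisjoint v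
  exact hadd _ _ (hom 0 a ha) (hom 1 b hb)

@[elab_as_elim]
theorem homog_tensor_induction [SuperSpace k V] [SuperSpace k W] {p : V ⊗[k] W → Prop}
    (hzero : p 0) (hadd : ∀ a b, p a → p b → p (a + b))
    (hom : ∀ i j, ∀ v ∈ gr k i, ∀ w ∈ gr k j, p (v ⊗ₜ w)) (x : V ⊗[k] W) : p x := by
  induction x with
  | zero => exact hzero
  | add a b ha hb => exact hadd _ _ ha hb
  | tmul v w =>
    refine homog_induction k (p := fun v => p (v ⊗ₜ w)) ?_ ?_ v
    · intro a b ha hb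
      rw [add_tmul]; exact hadd _ _ ha hb
    · intro i v hv
      refine homog_induction k (p := fun w => p (v ⊗ₜ w)) ?_ ?_ w
      · intro a b ha hb
        rw [tmul_add]; exact hadd _ _ ha hb
      · intro j w hw
        exact hom i j v hv w hw

/-- The grading of a tensor product: `(V ⊗ W)ₙ = ∑ᵢ Vᵢ ⊗ Wₙ₋ᵢ`. -/
def tensorGr (k V W : Type*) [Field k] [AddCommGroup V] [Module k V] [AddCommGroup W]
    [Module k W] [SuperSpace k V] [SuperSpace k W] (n : ZMod 2) : Submodule k (V ⊗[k] W) :=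
  ⨆ i : ZMod 2, Submodule.map₂ (TensorProduct.mk k V W) (gr k i) (gr k (n - i))

theorem tmul_mem_tensorGr [SuperSpace k V] [SuperSpace k W] {i j n : ZMod 2} {v : V} {w : W}
    (hv : v ∈ gr k i) (hw : w ∈ gr k j) (h : i + j = n) : v ⊗ₜ[k] w ∈ tensorGr k V W n := by
  subst h
  refine Submodule.mem_iSup_of_mem i ?_
  have : i + j - i = j := by ring
  rw [this]
  exact Submodule.apply_mem_map₂ _ hv hw

theorem tensorGr_le [SuperSpace k V] [SuperSpace k W] {n : ZMod 2} {S : Submodule k (V ⊗[k] W)}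
    (h : ∀ i j, i + j = n → ∀ v ∈ gr k i, ∀ w ∈ gr k j, v ⊗ₜ[k] w ∈ S) :
    tensorGr k V W n ≤ S := by
  refine iSup_le fun i => Submodule.map₂_le.2 fun v hv w hw => ?_
  exact h i (n - i) (by ring) v hv w hw

theorem tensorGr_isCompl (k V W : Type*) [Field k] [AddCommGroup V] [Module k V]
    [AddCommGroup W] [Module k W] [SuperSpace k V] [SuperSpace k W] :
    IsCompl (tensorGr k V W 0) (tensorGr k V W 1) := by
  let p : V ⊗[k] W →ₗ[k] V ⊗[k] W :=
    map (oddPart k V) LinearMap.id + map LinearMap.id (oddPart k W)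
      - (2 : k) • map (oddPart k V) (oddPart k W)
  have hp : ∀ n : ZMod 2, ∀ x ∈ tensorGr k V W n, p x = (n.val : k) • x := by
    intro n x hx
    have : tensorGr k V W n ≤ LinearMap.ker (p - (n.val : k) • LinearMap.id) := by
      refine tensorGr_le fun i j hij v hv w hw => ?_
      subst hij
      have e1 := oddPart_of_mem hv
      have e2 := oddPart_of_mem hw
      rcases zmod2_cases i with rfl | rfl <;> rcases zmod2_cases j with rfl | rfl <;>
        simp [p, e1, e2, ZMod.val_one, two_smul,
          show (1 : ZMod 2) + 1 = 0 from rfl]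
    simpa [sub_eq_zero] using this hx
  constructor
  · rw [Submodule.disjoint_def]
    intro x h0 h1
    have e0 := hp 0 x h0
    have e1 := hp 1 x h1
    rw [e0] at e1
    simpa [ZMod.val_one] using e1.symm
  · rw [codisjoint_iff, eq_top_iff]
    intro x _
    refine homog_tensor_induction (p := fun x => x ∈ tensorGr k V W 0 ⊔ tensorGr k V W 1)
      (Submodule.zero_mem _) (fun a b => Submodule.add_mem _) ?_ x
    intro i j v hv w hw
    rcases zmod2_cases (i + j) with h | h
    · exact Submodule.mem_sup_left (tmul_mem_tensorGr hv hw h)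
    · exact Submodule.mem_sup_right (tmul_mem_tensorGr hv hw h)

instance instSuperSpaceTensor [SuperSpace k V] [SuperSpace k W] : SuperSpace k (V ⊗[k] W) where
  gr := tensorGr k V W
  isCompl := tensorGr_isCompl k V W

/-- The ground field is purely even. -/
instance instSuperSpaceField : SuperSpace k k where
  gr i := if i = 0 then ⊤ else ⊥
  isCompl := by simpa using isCompl_top_bot

/-- The dual of a super vector space: a functional of parity `i` vanishes on vectors of the
other parity. -/
instance instSuperSpaceDual [SuperSpace k V] : SuperSpace k (Module.Dual k V) where
  gr i := (gr k (V := V) (i + 1)).dualAnnihilator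
  isCompl := Subspace.isCompl_dualAnnihilator SuperSpace.isCompl.symm

/-- The super flip `v ⊗ w ↦ (-1) ^ (|v| |w|) w ⊗ v`. -/
def superFlip (k V W : Type*) [Field k] [AddCommGroup V] [Module k V] [AddCommGroup W]
    [Module k W] [SuperSpace k V] [SuperSpace k W] : V ⊗[k] W →ₗ[k] W ⊗[k] V :=
  (TensorProduct.comm k V W).toLinearMap ∘ₗ
    (LinearMap.id - (2 : k) • map (oddPart k V) (oddPart k W))

theorem superFlip_tmul [SuperSpace k V] [SuperSpace k W] {i j : ZMod 2} {v : V} {w : W}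
    (hv : v ∈ gr k i) (hw : w ∈ gr k j) :
    superFlip k V W (v ⊗ₜ w) = koszulSign k i j • (w ⊗ₜ v) := by
  have e1 := oddPart_of_mem hv
  have e2 := oddPart_of_mem hw
  rcases zmod2_cases i with rfl | rfl <;> rcases zmod2_cases j with rfl | rfl <;>
    simp [superFlip, e1, e2, koszulSign, ZMod.val_one, two_smul]

/-- The unsigned version of `superTensor`: `(a ⊗ b) (c ⊗ d) = f a c ⊗ g b d`. -/
def plainTensor {σ : k →+* k} (f : A →ₛₗ[σ] C →ₗ[k] E) (g : B →ₛₗ[σ] D →ₗ[k] F) :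
    A ⊗[k] B →ₛₗ[σ] (C ⊗[k] D →ₗ[k] E ⊗[k] F) :=
  (lift (mapBilinear (.id k) C D E F)) ∘ₛₗ map f g

@[simp]
theorem plainTensor_tmul {σ : k →+* k} (f : A →ₛₗ[σ] C →ₗ[k] E) (g : B →ₛₗ[σ] D →ₗ[k] F)
    (a : A) (b : B) (c : C) (d : D) :
    plainTensor f g (a ⊗ₜ b) (c ⊗ₜ d) = f a c ⊗ₜ g b d := rfl

/-- The tensor product of two pairings (bilinear, or semilinear in the first variable),
following the Koszul sign rule: `(a ⊗ b) (c ⊗ d) = (-1) ^ (|b| |c|) f a c ⊗ g b d`. -/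
def superTensor {σ : k →+* k} [SuperSpace k B] [SuperSpace k C]
    (f : A →ₛₗ[σ] C →ₗ[k] E) (g : B →ₛₗ[σ] D →ₗ[k] F) :
    A ⊗[k] B →ₛₗ[σ] (C ⊗[k] D →ₗ[k] E ⊗[k] F) :=
  plainTensor f g - (2 : k) •
    (plainTensor (f.compl₂ (oddPart k C)) (g ∘ₛₗ oddPart k B))

theorem superTensor_tmul {σ : k →+* k} [SuperSpace k B] [SuperSpace k C]
    (f : A →ₛₗ[σ] C →ₗ[k] E) (g : B →ₛₗ[σ] D →ₗ[k] F) {i j : ZMod 2} (a : A) {b : B} {c : C}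
    (d : D) (hb : b ∈ gr k i) (hc : c ∈ gr k j) :
    superTensor f g (a ⊗ₜ b) (c ⊗ₜ d) = koszulSign k i j • (f a c ⊗ₜ g b d) := by
  have e1 := oddPart_of_mem hb
  have e2 := oddPart_of_mem hc
  rcases zmod2_cases i with rfl | rfl <;> rcases zmod2_cases j with rfl | rfl <;>
    simp [superTensor, e1, e2, koszulSign, ZMod.val_one, two_smul]

end SuperLinear

/-! ### Signs -/

section Signs

variable {k : Type*} [Field k]

theorem koszulSign_add_left (i j l : ZMod 2) :
    koszulSign k (i + j) l = koszulSign k i l * koszulSign k j l := by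
  rcases zmod2_cases i with rfl | rfl <;> rcases zmod2_cases j with rfl | rfl <;>
    rcases zmod2_cases l with rfl | rfl <;>
    simp [koszulSign, ZMod.val_one, show (1 : ZMod 2) + 1 = 0 from rfl]

theorem koszulSign_comm (i j : ZMod 2) : koszulSign k i j = koszulSign k j i := by
  simp [koszulSign, mul_comm]

theorem koszulSign_add_right (i j l : ZMod 2) :
    koszulSign k i (j + l) = koszulSign k i j * koszulSign k i l := by
  rw [koszulSign_comm, koszulSign_add_left, koszulSign_comm j, koszulSign_comm l]

theorem koszulSign_mul_self (i j : ZMod 2) : koszulSign k i j * koszulSign k i j = 1 := by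
  rcases zmod2_cases i with rfl | rfl <;> rcases zmod2_cases j with rfl | rfl <;>
    simp [koszulSign, ZMod.val_one]

@[simp]
theorem koszulSign_zero_left (i : ZMod 2) : koszulSign k 0 i = 1 := by simp [koszulSign]

@[simp]
theorem koszulSign_zero_right (i : ZMod 2) : koszulSign k i 0 = 1 := by simp [koszulSign]

theorem star_koszulSign [StarRing k] (i j : ZMod 2) :
    star (koszulSign k i j) = koszulSign k i j := by
  simp [koszulSign]

end Signs

/-! ### Hopf superalgebras -/

/-- The product of the graded tensor square `H ⊗ H` of a superalgebra:
`(a ⊗ b) (c ⊗ d) = (-1) ^ (|b| |c|) a c ⊗ b d`. -/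
def mul₂ (k H : Type*) [Field k] [Ring H] [Algebra k H] [SuperSpace k H] :
    H ⊗[k] H →ₗ[k] H ⊗[k] H →ₗ[k] H ⊗[k] H :=
  superTensor (LinearMap.mul k H) (LinearMap.mul k H)

/-- The product of the graded tensor cube `(H ⊗ H) ⊗ H` of a superalgebra. -/
def mul₃ (k H : Type*) [Field k] [Ring H] [Algebra k H] [SuperSpace k H] :
    (H ⊗[k] H) ⊗[k] H →ₗ[k] (H ⊗[k] H) ⊗[k] H →ₗ[k] (H ⊗[k] H) ⊗[k] H :=
  superTensor (mul₂ k H) (LinearMap.mul k H)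

/-- A Hopf superalgebra over `k`: a superalgebra and a coalgebra such that all structure maps are
even and the coproduct is multiplicative for the graded tensor product, with an antipode. -/
class HopfSuperalgebra (k H : Type*) [Field k] [Ring H] [Algebra k H] [Coalgebra k H]
    [SuperSpace k H] extends SetLike.GradedMonoid (SuperSpace.gr (k := k) (V := H)) where
  comul_mem : ∀ i, ∀ x ∈ gr k (V := H) i,
    Coalgebra.comul (R := k) x ∈ gr k (V := H ⊗[k] H) i
  counit_odd : ∀ x ∈ gr k (V := H) 1, Coalgebra.counit (R := k) x = 0
  comul_one : Coalgebra.comul (R := k) (1 : H) = 1 ⊗ₜ 1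
  comul_mul : ∀ x y : H, Coalgebra.comul (R := k) (x * y) =
    mul₂ k H (Coalgebra.comul x) (Coalgebra.comul y)
  counit_one : Coalgebra.counit (R := k) (1 : H) = 1
  counit_mul : ∀ x y : H, Coalgebra.counit (R := k) (x * y) =
    Coalgebra.counit (R := k) x * Coalgebra.counit (R := k) y
  /-- The antipode. -/
  antipode : H →ₗ[k] H
  antipode_mem : ∀ i, ∀ x ∈ gr k (V := H) i, antipode x ∈ gr k (V := H) i
  mul_antipode_rTensor_comul :
    LinearMap.mul' k H ∘ₗ antipode.rTensor H ∘ₗ Coalgebra.comul =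
      Algebra.linearMap k H ∘ₗ Coalgebra.counit
  mul_antipode_lTensor_comul :
    LinearMap.mul' k H ∘ₗ antipode.lTensor H ∘ₗ Coalgebra.comul =
      Algebra.linearMap k H ∘ₗ Coalgebra.counit

section Hopf

variable {k : Type*} {H : Type*} [Field k] [Ring H] [Algebra k H] [Coalgebra k H]
  [SuperSpace k H] [HopfSuperalgebra k H]

variable (k H) in
/-- The antipode of a Hopf superalgebra. -/
abbrev antipode : H →ₗ[k] H := HopfSuperalgebra.antipode

variable (k H) in
/-- The coproduct of a Hopf superalgebra. -/
abbrev comul : H →ₗ[k] H ⊗[k] H := Coalgebra.comul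

variable (k H) in
/-- The counit of a Hopf superalgebra. -/
abbrev counit : H →ₗ[k] k := Coalgebra.counit

theorem one_mem_gr : (1 : H) ∈ gr k (V := H) 0 :=
  SetLike.GradedOne.one_mem

theorem mul_mem_gr {i j : ZMod 2} {x y : H} (hx : x ∈ gr k i) (hy : y ∈ gr k j) :
    x * y ∈ gr k (i + j) :=
  SetLike.GradedMul.mul_mem hx hy

theorem mul₂_tmul {i j : ZMod 2} (a : H) {b c : H} (d : H) (hb : b ∈ gr k i) (hc : c ∈ gr k j) :
    mul₂ k H (a ⊗ₜ b) (c ⊗ₜ d) = koszulSign k i j • ((a * c) ⊗ₜ (b * d)) :=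
  superTensor_tmul (LinearMap.mul k H) (LinearMap.mul k H) a d hb hc

/-! ### Tensor products of representations -/

variable {V W : Type*} [AddCommGroup V] [Module k V] [AddCommGroup W] [Module k W]
  [SuperSpace k V] [SuperSpace k W]

/-- A representation is graded if `|x v| = |x| + |v|`. -/
def IsGradedAct (ρ : H →ₐ[k] Module.End k V) : Prop :=
  ∀ i j, ∀ x ∈ gr k (V := H) i, ∀ v ∈ gr k (V := V) j, ρ x v ∈ gr k (V := V) (i + j)

/-- The action of `H ⊗ H` on `V ⊗ W`: `(a ⊗ b) (v ⊗ w) = (-1) ^ (|b| |v|) a v ⊗ b w`. -/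
def act₂ (ρ : H →ₐ[k] Module.End k V) (ρ' : H →ₐ[k] Module.End k W) :
    H ⊗[k] H →ₗ[k] Module.End k (V ⊗[k] W) :=
  superTensor ρ.toLinearMap ρ'.toLinearMap

theorem act₂_tmul (ρ : H →ₐ[k] Module.End k V) (ρ' : H →ₐ[k] Module.End k W)
    {i j : ZMod 2} (a : H) {b : H} {v : V} (w : W) (hb : b ∈ gr k i) (hv : v ∈ gr k j) :
    act₂ ρ ρ' (a ⊗ₜ b) (v ⊗ₜ w) = koszulSign k i j • (ρ a v ⊗ₜ ρ' b w) :=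
  superTensor_tmul ρ.toLinearMap ρ'.toLinearMap a w hb hv

theorem act₂_mem {ρ : H →ₐ[k] Module.End k V} {ρ' : H →ₐ[k] Module.End k W}
    (hρ : IsGradedAct ρ) (hρ' : IsGradedAct ρ') {i j : ZMod 2} {x : H ⊗[k] H} {y : V ⊗[k] W}
    (hx : x ∈ gr k i) (hy : y ∈ gr k j) : act₂ ρ ρ' x y ∈ gr k (V := V ⊗[k] W) (i + j) := by
  let S : Submodule k (H ⊗[k] H) :=
    Submodule.comap (act₂ ρ ρ') (Submodule.compatibleMaps (gr k j) (gr k (i + j)))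
  have : tensorGr k H H i ≤ S := by
    refine tensorGr_le fun p q hpq a ha b hb => ?_
    change ∀ y ∈ gr k j, act₂ ρ ρ' (a ⊗ₜ b) y ∈ gr k (V := V ⊗[k] W) (i + j)
    intro y hy
    have : tensorGr k V W j ≤ Submodule.comap (act₂ ρ ρ' (a ⊗ₜ b)) (gr k (i + j)) := by
      refine tensorGr_le fun r s hrs v hv w hw => ?_
      rw [Submodule.mem_comap, act₂_tmul ρ ρ' a w hb hv]
      refine Submodule.smul_mem _ _ (tmul_mem_tensorGr (hρ _ _ a ha v hv) (hρ' _ _ b hb w hw) ?_)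
      rw [← hpq, ← hrs]; ring
    exact this hy
  exact this hx hy

theorem act₂_mul {ρ : H →ₐ[k] Module.End k V} {ρ' : H →ₐ[k] Module.End k W}
    (hρ : IsGradedAct ρ) (x y : H ⊗[k] H) :
    act₂ ρ ρ' (mul₂ k H x y) = act₂ ρ ρ' x * act₂ ρ ρ' y := by
  refine homog_tensor_induction (by simp) (fun a b ha hb => by simp [ha, hb, add_mul]) ?_ x
  intro i i' a ha b hb
  refine homog_tensor_induction (by simp) (fun a b ha hb => by simp [ha, hb, mul_add]) ?_ y
  intro j j' c hc d hd
  refine LinearMap.ext fun z => ?_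
  refine homog_tensor_induction (by simp) (fun a b ha hb => by rw [map_add, map_add, ha, hb]) ?_ z
  intro p q v hv w hw
  rw [mul₂_tmul a d hb hc, map_smul, Module.End.mul_apply, LinearMap.smul_apply,
    act₂_tmul _ _ _ _ (mul_mem_gr hb hd) hv, act₂_tmul _ _ _ _ hd hv, map_smul,
    act₂_tmul _ _ _ _ hb (hρ _ _ c hc v hv), smul_smul, smul_smul, koszulSign_add_left,
    koszulSign_add_right, map_mul, map_mul, Module.End.mul_apply, Module.End.mul_apply]
  congr 1
  ring

theorem act₂_one (ρ : H →ₐ[k] Module.End k V) (ρ' : H →ₐ[k] Module.End k W) :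
    act₂ ρ ρ' (1 ⊗ₜ 1) = 1 := by
  refine LinearMap.ext fun z => ?_
  refine homog_tensor_induction (by simp) (fun a b ha hb => by rw [map_add, map_add, ha, hb]) ?_ z
  intro p q v hv w hw
  rw [act₂_tmul _ _ _ _ one_mem_gr hv]
  simp

theorem superFlip_act₂ {ρ : H →ₐ[k] Module.End k V} {ρ' : H →ₐ[k] Module.End k W}
    (hρ : IsGradedAct ρ) (hρ' : IsGradedAct ρ') (x : H ⊗[k] H) (z : V ⊗[k] W) :
    superFlip k V W (act₂ ρ ρ' x z) = act₂ ρ' ρ (superFlip k H H x) (superFlip k V W z) := by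
  revert z
  refine homog_tensor_induction (by simp)
    (fun a b ha hb z => by simp only [map_add, LinearMap.add_apply, ha, hb]) ?_ x
  intro i i' a ha b hb z
  refine homog_tensor_induction (by simp)
    (fun a b ha hb => by simp only [map_add, ha, hb]) ?_ z
  intro p q v hv w hw
  rw [act₂_tmul _ _ _ _ hb hv, map_smul, superFlip_tmul (hρ _ _ a ha v hv) (hρ' _ _ b hb w hw),
    superFlip_tmul ha hb, superFlip_tmul hv hw, map_smul, map_smul, LinearMap.smul_apply,
    act₂_tmul _ _ _ _ ha hw, smul_smul, smul_smul, smul_smul]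
  congr 1
  rw [koszulSign_add_left, koszulSign_add_right, koszulSign_add_right, koszulSign_comm p i']
  linear_combination (koszulSign k i i' * koszulSign k i q * koszulSign k p q) *
    koszulSign_mul_self (k := k) i' p

theorem superFlip_superFlip (z : V ⊗[k] W) : superFlip k W V (superFlip k V W z) = z := by
  refine homog_tensor_induction (by simp) (fun a b ha hb => by simp only [map_add, ha, hb]) ?_ z
  intro p q v hv w hw
  rw [superFlip_tmul hv hw, map_smul, superFlip_tmul hw hv, smul_smul, koszulSign_comm q p,
    koszulSign_mul_self, one_smul]

theorem superFlip_mem {i : ZMod 2} {z : V ⊗[k] W} (hz : z ∈ gr k i) :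
    superFlip k V W z ∈ gr k (V := W ⊗[k] V) i := by
  have : tensorGr k V W i ≤ Submodule.comap (superFlip k V W) (gr k i) := by
    refine tensorGr_le fun p q hpq v hv w hw => ?_
    rw [Submodule.mem_comap, superFlip_tmul hv hw]
    exact Submodule.smul_mem _ _ (tmul_mem_tensorGr hw hv (by rw [add_comm, hpq]))
  exact this hz

/-- The diagonal action of `H` on `V ⊗ W`. -/
def tensorAct (ρ : H →ₐ[k] Module.End k V) (ρ' : H →ₐ[k] Module.End k W)
    (hρ : IsGradedAct ρ) : H →ₐ[k] Module.End k (V ⊗[k] W) :=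
  AlgHom.ofLinearMap (act₂ ρ ρ' ∘ₗ comul k H)
    (by simp only [LinearMap.comp_apply, HopfSuperalgebra.comul_one, act₂_one])
    (fun x y => by
      simp only [LinearMap.comp_apply, HopfSuperalgebra.comul_mul, act₂_mul hρ])

theorem tensorAct_graded {ρ : H →ₐ[k] Module.End k V} {ρ' : H →ₐ[k] Module.End k W}
    (hρ : IsGradedAct ρ) (hρ' : IsGradedAct ρ') : IsGradedAct (tensorAct ρ ρ' hρ) :=
  fun i j x hx _ hv => act₂_mem (i := i) (j := j) hρ hρ' (HopfSuperalgebra.comul_mem i x hx) hv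

/-! ### The antipode and dual representations -/

/-- The linear map `x ↦ (-1) ^ (j |x|) x`. -/
def signMap (k V : Type*) [Field k] [AddCommGroup V] [Module k V] [SuperSpace k V] (j : ZMod 2) :
    V →ₗ[k] V := LinearMap.id - (2 * (j.val : k)) • oddPart k V

theorem signMap_of_mem {i j : ZMod 2} {v : V} (hv : v ∈ gr k i) :
    signMap k V j v = koszulSign k i j • v := by
  have e := oddPart_of_mem hv
  rcases zmod2_cases i with rfl | rfl <;> rcases zmod2_cases j with rfl | rfl <;>
    simp [signMap, e, koszulSign, ZMod.val_one, two_smul]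

theorem isGradedAct_lmul : IsGradedAct (Algebra.lmul k H) :=
  fun _ _ _ hx _ hy => mul_mem_gr hx hy

theorem mul₂_assoc (x y z : H ⊗[k] H) :
    mul₂ k H (mul₂ k H x y) z = mul₂ k H x (mul₂ k H y z) :=
  LinearMap.congr_fun (act₂_mul (ρ' := Algebra.lmul k H) isGradedAct_lmul x y) z

theorem mul₂_one_tmul (x : H ⊗[k] H) (t : H) :
    mul₂ k H x (1 ⊗ₜ t) = (LinearMap.mulRight k t).lTensor H x := by
  refine homog_tensor_induction (by simp)
    (fun a b ha hb => by rw [map_add, LinearMap.add_apply, ha, hb, map_add]) ?_ x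
  intro i j a _ b hb
  rw [mul₂_tmul a t hb one_mem_gr]
  simp

theorem tmul_one_eq_sum {T : H →ₗ[k] H}
    (hT : LinearMap.mul' k H ∘ₗ T.lTensor H ∘ₗ comul k H = Algebra.linearMap k H ∘ₗ counit k H)
    (x : H) (r : Coalgebra.Repr k x (H × H)) :
    x ⊗ₜ[k] (1 : H) = ∑ i ∈ r.index, mul₂ k H (comul k H (r.left i)) (1 ⊗ₜ T (r.right i)) := by
  have key : ∀ y : H ⊗[k] H, (LinearMap.mul' k H ∘ₗ T.lTensor H).lTensor H
      (TensorProduct.assoc k H H H ((comul k H).rTensor H y)) =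
      lift ((mul₂ k H).compl₁₂ (comul k H) ((TensorProduct.mk k H H 1) ∘ₗ T)) y := by
    intro y
    induction y with
    | zero => simp
    | add a b ha hb => simp only [map_add, ha, hb]
    | tmul a b =>
      simp only [LinearMap.rTensor_tmul, lift.tmul, LinearMap.compl₁₂_apply,
        LinearMap.comp_apply, TensorProduct.mk_apply, mul₂_one_tmul]
      generalize comul k H a = c
      induction c with
      | zero => simp
      | add a b ha hb => simp only [map_add, ha, hb, add_tmul]
      | tmul c d => simp
  have h1 := key (comul k H x)
  rw [Coalgebra.coassoc_apply, ← LinearMap.comp_apply, ← LinearMap.lTensor_comp,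
    LinearMap.comp_assoc, hT, LinearMap.lTensor_comp, LinearMap.comp_apply,
    Coalgebra.lTensor_counit_comul] at h1
  rw [← r.eq, map_sum] at h1
  simpa using h1

theorem mul_antipode_mul₂ (z w : H) :
    LinearMap.mul' k H ((antipode k H).rTensor H (mul₂ k H (comul k H z) (1 ⊗ₜ w))) =
      counit k H z • w := by
  rw [mul₂_one_tmul]
  have : ∀ y : H ⊗[k] H, LinearMap.mul' k H ((antipode k H).rTensor H
      ((LinearMap.mulRight k w).lTensor H y)) =
      LinearMap.mul' k H ((antipode k H).rTensor H y) * w := by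
    intro y
    induction y with
    | zero => simp
    | add a b ha hb => simp only [map_add, ha, hb, add_mul]
    | tmul a b => simp [mul_assoc]
  rw [this]
  have h := LinearMap.congr_fun (HopfSuperalgebra.mul_antipode_rTensor_comul (k := k) (H := H)) z
  simp only [LinearMap.comp_apply] at h
  rw [h, Algebra.linearMap_apply, Algebra.smul_def]

/-- The antipode is the only convolution inverse of the identity. -/
theorem antipode_unique {T : H →ₗ[k] H}
    (hT : LinearMap.mul' k H ∘ₗ T.lTensor H ∘ₗ comul k H = Algebra.linearMap k H ∘ₗ counit k H) :
    antipode k H = T := by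
  refine LinearMap.ext fun x => ?_
  have r := Coalgebra.Repr.arbitrary k x
  have h := congrArg (fun y => LinearMap.mul' k H ((antipode k H).rTensor H y))
    (tmul_one_eq_sum hT x r)
  simp only [map_sum, mul_antipode_mul₂] at h
  simp only [← map_smul, ← map_sum, Coalgebra.sum_counit_smul r] at h
  simpa using h

theorem antipode_one : antipode k H 1 = 1 := by
  have h := LinearMap.congr_fun (HopfSuperalgebra.mul_antipode_rTensor_comul (k := k) (H := H)) 1
  simpa [HopfSuperalgebra.comul_one, HopfSuperalgebra.counit_one] using h

/-- The antipode is an anti-superalgebra map. -/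
theorem antipode_mul {i j : ZMod 2} {x y : H} (hx : x ∈ gr k i) (hy : y ∈ gr k j) :
    antipode k H (x * y) = koszulSign k i j • (antipode k H y * antipode k H x) := by
  have hS := HopfSuperalgebra.mul_antipode_lTensor_comul (k := k) (H := H)
  have r := Coalgebra.Repr.arbitrary k x
  have r' := Coalgebra.Repr.arbitrary k y
  have swap : ∀ s : H, mul₂ k H (1 ⊗ₜ s) (y ⊗ₜ 1) =
      mul₂ k H (y ⊗ₜ 1) (1 ⊗ₜ signMap k H j s) := by
    intro s
    refine homog_induction k (fun a b ha hb => by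
      simp only [tmul_add, map_add, LinearMap.add_apply, ha, hb]) ?_ s
    intro p s hs
    rw [signMap_of_mem hs, mul₂_tmul _ _ hs hy, mul₂_one_tmul]
    simp
  have e : (x * y) ⊗ₜ[k] (1 : H) = ∑ a ∈ r.index, ∑ b ∈ r'.index,
      mul₂ k H (comul k H (r.left a * r'.left b))
        (1 ⊗ₜ (antipode k H (r'.right b) * signMap k H j (antipode k H (r.right a)))) := by
    have e0 : (x * y) ⊗ₜ[k] (1 : H) = mul₂ k H (x ⊗ₜ 1) (y ⊗ₜ 1) := by
      rw [mul₂_tmul _ _ one_mem_gr hy]; simp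
    rw [e0, tmul_one_eq_sum hS x r, map_sum, LinearMap.sum_apply]
    refine Finset.sum_congr rfl fun a _ => ?_
    rw [mul₂_assoc, swap, tmul_one_eq_sum hS y r', map_sum, LinearMap.sum_apply, map_sum]
    refine Finset.sum_congr rfl fun b _ => ?_
    rw [HopfSuperalgebra.comul_mul, mul₂_assoc, mul₂_assoc]
    congr 2
    rw [mul₂_one_tmul]
    simp
  have h := congrArg (fun y => LinearMap.mul' k H ((antipode k H).rTensor H y)) e
  simp only [map_sum, mul_antipode_mul₂, HopfSuperalgebra.counit_mul] at h
  have hx' : signMap k H j (antipode k H x) = koszulSign k i j • antipode k H x :=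
    signMap_of_mem (HopfSuperalgebra.antipode_mem i x hx)
  have h2 : antipode k H (x * y) = antipode k H y * signMap k H j (antipode k H x) := by
    rw [LinearMap.rTensor_tmul, LinearMap.mul'_apply, mul_one] at h
    rw [h]
    conv_rhs => rw [← Coalgebra.sum_counit_smul r, ← Coalgebra.sum_counit_smul r']
    simp only [map_sum, map_smul, Finset.sum_mul, Finset.mul_sum]
    refine Finset.sum_congr rfl fun a _ => Finset.sum_congr rfl fun b _ => ?_
    rw [smul_mul_smul_comm, mul_comm]
  rw [h2, hx', mul_smul_comm]

/-- The action on the dual, `(x φ) v = (-1) ^ (|x| |φ|) φ (S x v)`, as a linear map. -/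
def dualActLin (ρ : H →ₐ[k] Module.End k V) : H →ₗ[k] Module.End k (Module.Dual k V) :=
  let T : H →ₗ[k] Module.Dual k V →ₗ[k] Module.Dual k V :=
    (LinearMap.llcomp k V V k).flip ∘ₗ ρ.toLinearMap ∘ₗ antipode k H
  T + (-2 : k) • ((T ∘ₗ oddPart k H).compl₂ (oddPart k (Module.Dual k V)))

theorem dualActLin_apply (ρ : H →ₐ[k] Module.End k V) {i j : ZMod 2} {x : H}
    {φ : Module.Dual k V} (hx : x ∈ gr k i) (hφ : φ ∈ gr k j) (v : V) :
    dualActLin ρ x φ v = koszulSign k i j * φ (ρ (antipode k H x) v) := by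
  have e1 := oddPart_of_mem hx
  have e2 := oddPart_of_mem hφ
  rcases zmod2_cases i with rfl | rfl <;> rcases zmod2_cases j with rfl | rfl <;>
    simp [dualActLin, e1, e2, koszulSign, ZMod.val_one, two_mul]

theorem mem_gr_dual {i : ZMod 2} {φ : Module.Dual k V} :
    φ ∈ gr k i ↔ ∀ v ∈ gr k (V := V) (i + 1), φ v = 0 :=
  Submodule.mem_dualAnnihilator φ

theorem dualActLin_mem {ρ : H →ₐ[k] Module.End k V} (hρ : IsGradedAct ρ) {i j : ZMod 2} {x : H}
    {φ : Module.Dual k V} (hx : x ∈ gr k i) (hφ : φ ∈ gr k j) :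
    dualActLin ρ x φ ∈ gr k (i + j) := by
  rw [mem_gr_dual]
  intro v hv
  rw [dualActLin_apply ρ hx hφ]
  have : i + (i + j + 1) = j + 1 := by
    have : i + i = 0 := CharTwo.add_self_eq_zero i
    rw [← add_assoc, ← add_assoc, this, zero_add]
  have h := hρ _ _ _ (HopfSuperalgebra.antipode_mem i x hx) v hv
  rw [this] at h
  rw [mem_gr_dual.1 hφ _ h, mul_zero]

/-- The dual representation. -/
def dualAct (ρ : H →ₐ[k] Module.End k V) (hρ : IsGradedAct ρ) :
    H →ₐ[k] Module.End k (Module.Dual k V) :=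
  AlgHom.ofLinearMap (dualActLin ρ)
    (by
      refine LinearMap.ext fun φ => ?_
      refine homog_induction k (fun a b ha hb => by rw [map_add, map_add, ha, hb]) ?_ φ
      intro j φ hφ
      refine LinearMap.ext fun v => ?_
      rw [dualActLin_apply ρ one_mem_gr hφ, antipode_one]
      simp)
    (fun x y => by
      refine homog_induction k (fun a b ha hb => by
        rw [add_mul, map_add, map_add, ha, hb, add_mul]) ?_ x
      intro i x hx
      refine homog_induction k (fun a b ha hb => by
        rw [mul_add, map_add, map_add, ha, hb, mul_add]) ?_ y
      intro i' y hy
      refine LinearMap.ext fun φ => ?_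
      refine homog_induction k (fun a b ha hb => by rw [map_add, map_add, ha, hb]) ?_ φ
      intro j φ hφ
      refine LinearMap.ext fun v => ?_
      rw [dualActLin_apply ρ (mul_mem_gr hx hy) hφ, antipode_mul hx hy, Module.End.mul_apply,
        dualActLin_apply ρ hx (dualActLin_mem hρ hy hφ), dualActLin_apply ρ hy hφ,
        koszulSign_add_left, koszulSign_add_right]
      simp only [map_smul, map_mul, LinearMap.smul_apply, Module.End.mul_apply, smul_eq_mul]
      ring)

theorem dualAct_graded {ρ : H →ₐ[k] Module.End k V} (hρ : IsGradedAct ρ) :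
    IsGradedAct (dualAct ρ hρ) :=
  fun _ _ _ hx _ hφ => dualActLin_mem hρ hx hφ

variable (k H) in
/-- The trivial representation on the ground field. -/
def trivAct : H →ₐ[k] Module.End k k :=
  AlgHom.ofLinearMap ((LinearMap.lsmul k k) ∘ₗ counit k H)
    (by ext; simp [HopfSuperalgebra.counit_one])
    (fun x y => by ext; simp [HopfSuperalgebra.counit_mul])

theorem trivAct_graded : IsGradedAct (trivAct k H) := by
  intro i j x hx v hv
  change counit k H x * v ∈ _
  rcases zmod2_cases i with rfl | rfl
  · rw [zero_add]
    exact Submodule.smul_mem _ _ hv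
  · rw [HopfSuperalgebra.counit_odd x hx, zero_mul]
    exact Submodule.zero_mem _

end Hopf

section HopfModules

variable {k : Type*} {H : Type*} [Field k] [Ring H] [Algebra k H] [Coalgebra k H]
  [SuperSpace k H] [HopfSuperalgebra k H]
variable {V W U V' W' : Type*} [AddCommGroup V] [Module k V] [AddCommGroup W] [Module k W]
  [AddCommGroup U] [Module k U] [AddCommGroup V'] [Module k V'] [AddCommGroup W'] [Module k W']
  [SuperSpace k V] [SuperSpace k W] [SuperSpace k U] [SuperSpace k V'] [SuperSpace k W']

theorem mem_gr_iff {i : ZMod 2} {v : V} : v ∈ gr k i ↔ oddPart k V v = (i.val : k) • v := by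
  refine ⟨oddPart_of_mem, fun h => ?_⟩
  rcases zmod2_cases i with rfl | rfl
  · rw [ZMod.val_zero, Nat.cast_zero, zero_smul, oddPart,
      Submodule.projection_apply_eq_zero_iff] at h
    exact h
  · rw [ZMod.val_one, Nat.cast_one, one_smul] at h
    rw [← h]
    exact Submodule.projection_apply_mem _ v

/-- A linear map is even if it preserves parity. -/
def IsEven (f : V →ₗ[k] W) : Prop := ∀ i, ∀ v ∈ gr k (V := V) i, f v ∈ gr k (V := W) i

theorem isEven_iff {f : V →ₗ[k] W} :
    IsEven f ↔ ∀ v, f (oddPart k V v) = oddPart k W (f v) := by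
  constructor
  · intro hf v
    refine homog_induction k (fun a b ha hb => by simp only [map_add, ha, hb]) ?_ v
    intro i v hv
    rw [oddPart_of_mem hv, oddPart_of_mem (hf i v hv), map_smul]
  · intro hf i v hv
    rw [mem_gr_iff, ← hf, oddPart_of_mem hv, map_smul]

theorem isEven_symm {e : V ≃ₗ[k] W} (he : IsEven e.toLinearMap) :
    IsEven e.symm.toLinearMap := by
  rw [isEven_iff] at he ⊢
  intro w
  have h := he (e.symm w)
  simp only [LinearEquiv.coe_coe, LinearEquiv.apply_symm_apply] at h ⊢
  rw [← h, LinearEquiv.symm_apply_apply]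

theorem isEven_map {f : V →ₗ[k] V'} {g : W →ₗ[k] W'} (hf : IsEven f) (hg : IsEven g) :
    IsEven (TensorProduct.map f g) := by
  intro n x hx
  have : tensorGr k V W n ≤ Submodule.comap (TensorProduct.map f g) (gr k n) :=
    tensorGr_le fun i j hij v hv w hw => tmul_mem_tensorGr (hf i v hv) (hg j w hw) hij
  exact this hx

theorem map_act₂ {ρ : H →ₐ[k] Module.End k V} {ρ' : H →ₐ[k] Module.End k W}
    {σ : H →ₐ[k] Module.End k V'} {σ' : H →ₐ[k] Module.End k W'}
    {f : V →ₗ[k] V'} {g : W →ₗ[k] W'} (hf : IsEven f) (hfl : ∀ x v, f (ρ x v) = σ x (f v))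
    (hgl : ∀ x w, g (ρ' x w) = σ' x (g w)) (x : H ⊗[k] H) (z : V ⊗[k] W) :
    TensorProduct.map f g (act₂ ρ ρ' x z) = act₂ σ σ' x (TensorProduct.map f g z) := by
  revert z
  refine homog_tensor_induction (by simp)
    (fun a b ha hb z => by simp only [map_add, LinearMap.add_apply, ha, hb]) ?_ x
  intro i i' a ha b hb z
  refine homog_tensor_induction (by simp) (fun a b ha hb => by simp only [map_add, ha, hb]) ?_ z
  intro p q v hv w hw
  rw [act₂_tmul _ _ _ _ hb hv, map_smul, map_tmul, map_tmul, act₂_tmul _ _ _ _ hb (hf p v hv),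
    hfl, hgl]

theorem superFlip_map {f : V →ₗ[k] V'} {g : W →ₗ[k] W'} (hf : IsEven f) (hg : IsEven g)
    (z : V ⊗[k] W) : superFlip k V' W' (TensorProduct.map f g z) =
      TensorProduct.map g f (superFlip k V W z) := by
  refine homog_tensor_induction (by simp) (fun a b ha hb => by simp only [map_add, ha, hb]) ?_ z
  intro p q v hv w hw
  rw [map_tmul, superFlip_tmul (hf p v hv) (hg q w hw), superFlip_tmul hv hw, map_smul, map_tmul]

theorem assoc_superTensor (ρ : H →ₐ[k] Module.End k V) (ρ' : H →ₐ[k] Module.End k W)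
    (ρ'' : H →ₐ[k] Module.End k U)
    (X : (H ⊗[k] H) ⊗[k] H) (t : (V ⊗[k] W) ⊗[k] U) :
    TensorProduct.assoc k V W U (superTensor (act₂ ρ ρ') ρ''.toLinearMap X t) =
      superTensor ρ.toLinearMap (act₂ ρ' ρ'') (TensorProduct.assoc k H H H X)
        (TensorProduct.assoc k V W U t) := by
  revert t
  induction X with
  | zero => simp
  | add a b ha hb => intro t; simp only [map_add, LinearMap.add_apply, ha, hb]
  | tmul y c =>
  refine homog_induction k (fun a b ha hb t => by
    simp only [tmul_add, map_add, LinearMap.add_apply, ha, hb]) ?_ c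
  intro l c hc
  refine homog_tensor_induction (by simp) (fun a b ha hb t => by
    simp only [add_tmul, map_add, LinearMap.add_apply, ha, hb]) ?_ y
  intro i j a ha b hb t
  induction t with
  | zero => simp
  | add a b ha hb => simp only [map_add, ha, hb]
  | tmul z u =>
  refine homog_tensor_induction (by simp) (fun a b ha hb => by
    simp only [add_tmul, map_add, ha, hb]) ?_ z
  intro p q v hv w hw
  rw [superTensor_tmul _ _ _ _ hc (tmul_mem_tensorGr hv hw rfl), act₂_tmul _ _ _ _ hb hv,
    assoc_tmul, assoc_tmul, superTensor_tmul _ _ _ _ (tmul_mem_tensorGr hb hc rfl) hv,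
    act₂_tmul _ _ _ _ hc hw, ← smul_tmul', smul_smul, map_smul, assoc_tmul, tmul_smul,
    smul_smul, koszulSign_add_left, koszulSign_add_right]
  congr 1
  ring

theorem assoc_tensorAct {ρ : H →ₐ[k] Module.End k V} {ρ' : H →ₐ[k] Module.End k W}
    (ρ'' : H →ₐ[k] Module.End k U) (hρ : IsGradedAct ρ) (hρ' : IsGradedAct ρ')
    (x : H) (t : (V ⊗[k] W) ⊗[k] U) :
    TensorProduct.assoc k V W U
      (tensorAct (tensorAct ρ ρ' hρ) ρ'' (tensorAct_graded hρ hρ') x t) =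
      tensorAct ρ (tensorAct ρ' ρ'' hρ') hρ x (TensorProduct.assoc k V W U t) := by
  have h1 : ∀ y : H ⊗[k] H, act₂ (tensorAct ρ ρ' hρ) ρ'' y =
      superTensor (act₂ ρ ρ') ρ''.toLinearMap ((comul k H).rTensor H y) := by
    intro y
    refine homog_tensor_induction (by simp) (fun a b ha hb => by simp only [map_add, ha, hb]) ?_ y
    intro i j a _ b hb
    refine LinearMap.ext fun z => ?_
    refine homog_tensor_induction (by simp)
      (fun a b ha hb => by simp only [map_add, ha, hb]) ?_ z
    intro p q v hv w _
    rw [act₂_tmul _ _ _ _ hb hv, LinearMap.rTensor_tmul, superTensor_tmul _ _ _ _ hb hv]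
    rfl
  have h2 : ∀ y : H ⊗[k] H, act₂ ρ (tensorAct ρ' ρ'' hρ') y =
      superTensor ρ.toLinearMap (act₂ ρ' ρ'') ((comul k H).lTensor H y) := by
    intro y
    refine homog_tensor_induction (by simp) (fun a b ha hb => by simp only [map_add, ha, hb]) ?_ y
    intro i j a _ b hb
    refine LinearMap.ext fun z => ?_
    refine homog_tensor_induction (by simp)
      (fun a b ha hb => by simp only [map_add, ha, hb]) ?_ z
    intro p q v hv w _
    rw [act₂_tmul _ _ _ _ hb hv, LinearMap.lTensor_tmul,
      superTensor_tmul _ _ _ _ (HopfSuperalgebra.comul_mem j b hb) hv]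
    rfl
  change TensorProduct.assoc k V W U (act₂ (tensorAct ρ ρ' hρ) ρ'' (comul k H x) t) =
    act₂ ρ (tensorAct ρ' ρ'' hρ') (comul k H x) (TensorProduct.assoc k V W U t)
  rw [h1, h2, assoc_superTensor ρ ρ' ρ'', Coalgebra.coassoc_apply]

theorem isEven_assoc : IsEven (TensorProduct.assoc k V W U).toLinearMap := by
  rw [isEven_iff]
  intro t
  induction t with
  | zero => simp
  | add a b ha hb => simp only [map_add, ha, hb]
  | tmul z u =>
  refine homog_tensor_induction (by simp) (fun a b ha hb => by
    simp only [add_tmul, map_add, ha, hb]) ?_ z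
  intro p q v hv w hw
  refine homog_induction k (fun a b ha hb => by simp only [tmul_add, map_add, ha, hb]) ?_ u
  intro r u hu
  rw [oddPart_of_mem (tmul_mem_tensorGr (tmul_mem_tensorGr hv hw rfl) hu rfl), map_smul,
    LinearEquiv.coe_coe, assoc_tmul,
    oddPart_of_mem (tmul_mem_tensorGr hv (tmul_mem_tensorGr hw hu rfl) rfl), add_assoc]

theorem mem_gr_field (c : k) : c ∈ gr k (V := k) 0 := by
  change c ∈ (if (0 : ZMod 2) = 0 then (⊤ : Submodule k k) else ⊥)
  rw [if_pos rfl]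
  exact Submodule.mem_top

theorem isEven_lid : IsEven (TensorProduct.lid k V).toLinearMap := by
  rw [isEven_iff]
  intro t
  refine homog_tensor_induction (by simp) (fun a b ha hb => by simp only [map_add, ha, hb]) ?_ t
  intro i j c _ v hv
  rw [oddPart_of_mem (tmul_mem_tensorGr (mem_gr_field c) hv rfl), map_smul, LinearEquiv.coe_coe,
    lid_tmul, oddPart_of_mem (Submodule.smul_mem _ c hv), zero_add]

theorem isEven_rid : IsEven (TensorProduct.rid k V).toLinearMap := by
  rw [isEven_iff]
  intro t
  refine homog_tensor_induction (by simp) (fun a b ha hb => by simp only [map_add, ha, hb]) ?_ t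
  intro i j v hv c _
  rw [oddPart_of_mem (tmul_mem_tensorGr hv (mem_gr_field c) rfl), map_smul, LinearEquiv.coe_coe,
    rid_tmul, oddPart_of_mem (Submodule.smul_mem _ c hv), add_zero]

theorem lid_tensorAct (ρ : H →ₐ[k] Module.End k V) (x : H) (t : k ⊗[k] V) :
    TensorProduct.lid k V (tensorAct (trivAct k H) ρ trivAct_graded x t) =
      ρ x (TensorProduct.lid k V t) := by
  have h : ∀ y : H ⊗[k] H, TensorProduct.lid k V (act₂ (trivAct k H) ρ y t) =
      ρ (TensorProduct.lid k H ((counit k H).rTensor H y)) (TensorProduct.lid k V t) := by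
    intro y
    refine homog_tensor_induction (by simp) (fun a b ha hb => by
      simp only [map_add, LinearMap.add_apply, ha, hb]) ?_ y
    intro i j a _ b hb
    induction t with
    | zero => simp
    | add a b ha hb => simp only [map_add, ha, hb]
    | tmul c v =>
    rw [act₂_tmul _ _ _ _ hb (mem_gr_field c)]
    simp [trivAct, smul_smul, mul_comm]
  change TensorProduct.lid k V (act₂ (trivAct k H) ρ (comul k H x) t) = _
  rw [h, Coalgebra.rTensor_counit_comul]
  simp

theorem rid_tensorAct {ρ : H →ₐ[k] Module.End k V} (hρ : IsGradedAct ρ) (x : H) (t : V ⊗[k] k) :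
    TensorProduct.rid k V (tensorAct ρ (trivAct k H) hρ x t) =
      ρ x (TensorProduct.rid k V t) := by
  have h : ∀ y : H ⊗[k] H, TensorProduct.rid k V (act₂ ρ (trivAct k H) y t) =
      ρ (TensorProduct.rid k H ((counit k H).lTensor H y)) (TensorProduct.rid k V t) := by
    intro y
    refine homog_tensor_induction (by simp) (fun a b ha hb => by
      simp only [map_add, LinearMap.add_apply, ha, hb]) ?_ y
    intro i j a _ b hb
    refine homog_tensor_induction (by simp) (fun a b ha hb => by
      simp only [map_add, ha, hb]) ?_ t
    intro p q v hv c _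
    rw [act₂_tmul _ _ _ _ hb hv]
    rcases zmod2_cases j with rfl | rfl
    · simp [trivAct, smul_smul, mul_comm]
    · simp [trivAct, HopfSuperalgebra.counit_odd b hb]
  change TensorProduct.rid k V (act₂ ρ (trivAct k H) (comul k H x) t) = _
  rw [h, Coalgebra.lTensor_counit_comul]
  simp

end HopfModules

/-! ### The category of finite-dimensional modules -/

section Category

variable (k : Type u) (H : Type w) [Field k] [Ring H] [Algebra k H] [Coalgebra k H]
  [SuperSpace k H] [HopfSuperalgebra k H]

/-- A finite-dimensional module over the Hopf superalgebra `H`. -/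
structure HMod where
  carrier : Type u
  [addCommGroup : AddCommGroup carrier]
  [module : Module k carrier]
  [finite : FiniteDimensional k carrier]
  [super : SuperSpace k carrier]
  /-- The action of `H`. -/
  act : H →ₐ[k] Module.End k carrier
  act_graded : IsGradedAct act

attribute [instance] HMod.addCommGroup HMod.module HMod.finite HMod.super

variable {k H}

/-- Morphisms of `H`-modules: the even `H`-linear maps. -/
def HMod.homs (V W : HMod k H) : Submodule k (V.carrier →ₗ[k] W.carrier) where
  carrier := {f | IsEven f ∧ ∀ x v, f (V.act x v) = W.act x (f v)}
  add_mem' {f g} hf hg := ⟨fun i v hv => Submodule.add_mem _ (hf.1 i v hv) (hg.1 i v hv),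
    fun x v => by simp only [LinearMap.add_apply, hf.2, hg.2, map_add]⟩
  zero_mem' := ⟨fun i v _ => Submodule.zero_mem _, fun x v => by simp⟩
  smul_mem' c f hf := ⟨fun i v hv => Submodule.smul_mem _ c (hf.1 i v hv),
    fun x v => by simp only [LinearMap.smul_apply, hf.2, map_smul]⟩

instance : Category (HMod k H) where
  Hom V W := HMod.homs V W
  id V := ⟨LinearMap.id, fun _ _ hv => hv, fun _ _ => rfl⟩
  comp f g := ⟨g.1 ∘ₗ f.1, fun i v hv => g.2.1 i _ (f.2.1 i v hv), fun x v => by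
    simp only [LinearMap.comp_apply, f.2.2, g.2.2]⟩

/-- The linear map underlying a morphism. -/
def HMod.lin {V W : HMod k H} (f : V ⟶ W) : V.carrier →ₗ[k] W.carrier := Subtype.val f

/-- Even `H`-linear maps are morphisms. -/
def HMod.ofLin {V W : HMod k H} (f : V.carrier →ₗ[k] W.carrier) (hf : IsEven f)
    (hl : ∀ x v, f (V.act x v) = W.act x (f v)) : V ⟶ W := ⟨f, hf, hl⟩

@[simp] theorem HMod.lin_ofLin {V W : HMod k H} (f : V.carrier →ₗ[k] W.carrier) (hf : IsEven f)
    (hl : ∀ x v, f (V.act x v) = W.act x (f v)) : HMod.lin (HMod.ofLin f hf hl) = f := rfl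

@[simp] theorem HMod.lin_id (V : HMod k H) : HMod.lin (𝟙 V) = LinearMap.id := rfl

@[simp] theorem HMod.lin_comp {V W U : HMod k H} (f : V ⟶ W) (g : W ⟶ U) :
    HMod.lin (f ≫ g) = HMod.lin g ∘ₗ HMod.lin f := rfl

@[ext] theorem HMod.hom_ext {V W : HMod k H} {f g : V ⟶ W} (h : HMod.lin f = HMod.lin g) :
    f = g := Subtype.ext h

theorem HMod.lin_even {V W : HMod k H} (f : V ⟶ W) : IsEven (HMod.lin f) := f.2.1

theorem HMod.lin_act {V W : HMod k H} (f : V ⟶ W) (x : H) (v : V.carrier) :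
    HMod.lin f (V.act x v) = W.act x (HMod.lin f v) := f.2.2 x v

instance : Preadditive (HMod k H) where
  homGroup V W := inferInstanceAs (AddCommGroup (HMod.homs V W))
  add_comp V W U f f' g := HMod.hom_ext (LinearMap.comp_add (HMod.lin f) (HMod.lin f') (HMod.lin g))
  comp_add V W U f g g' := HMod.hom_ext (LinearMap.ext fun _ => rfl)

instance : Linear k (HMod k H) where
  homModule V W := inferInstanceAs (Module k (HMod.homs V W))
  smul_comp V W U r f g := HMod.hom_ext (LinearMap.ext fun v => map_smul (HMod.lin g) r _)
  comp_smul V W U f r g := HMod.hom_ext (LinearMap.ext fun _ => rfl)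

/-- Bijective even `H`-linear maps are isomorphisms. -/
def HMod.mkIso {V W : HMod k H} (e : V.carrier ≃ₗ[k] W.carrier) (he : IsEven e.toLinearMap)
    (hl : ∀ x v, e (V.act x v) = W.act x (e v)) : V ≅ W where
  hom := HMod.ofLin e.toLinearMap he hl
  inv := HMod.ofLin e.symm.toLinearMap (isEven_symm he) (fun x w => by
    apply e.injective
    simp only [LinearEquiv.coe_coe, LinearEquiv.apply_symm_apply, hl])
  hom_inv_id := HMod.hom_ext (LinearMap.ext fun v => e.symm_apply_apply v)
  inv_hom_id := HMod.hom_ext (LinearMap.ext fun v => e.apply_symm_apply v)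

/-- The tensor product of modules. -/
def HMod.tensor (V W : HMod k H) : HMod k H where
  carrier := V.carrier ⊗[k] W.carrier
  act := tensorAct V.act W.act V.act_graded
  act_graded := tensorAct_graded V.act_graded W.act_graded

variable (k H) in
/-- The trivial module. -/
def HMod.unit : HMod k H where
  carrier := k
  act := trivAct k H
  act_graded := trivAct_graded

/-- The dual module, with action `(x φ) v = (-1) ^ (|x| |φ|) φ (S x v)`. -/
def HMod.dual (V : HMod k H) : HMod k H where
  carrier := Module.Dual k V.carrier
  act := dualAct V.act V.act_graded
  act_graded := dualAct_graded V.act_graded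

/-- The tensor product of morphisms. -/
def HMod.tensorMap {V W V' W' : HMod k H} (f : V ⟶ V') (g : W ⟶ W') :
    HMod.tensor V W ⟶ HMod.tensor V' W' :=
  HMod.ofLin (TensorProduct.map (HMod.lin f) (HMod.lin g))
    (isEven_map (HMod.lin_even f) (HMod.lin_even g))
    (fun x z => map_act₂ (HMod.lin_even f) (HMod.lin_act f) (HMod.lin_act g) _ z)

/-- The transpose `φ ↦ φ ∘ f` of a morphism. -/
def HMod.dualMap {V W : HMod k H} (f : V ⟶ W) : HMod.dual W ⟶ HMod.dual V :=
  HMod.ofLin (V := HMod.dual W) (W := HMod.dual V) (HMod.lin f).dualMap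
    (fun i φ hφ => mem_gr_dual.2 fun v hv =>
      mem_gr_dual.1 hφ _ (HMod.lin_even f (i + 1) v hv))
    (fun x φ => by
      change (HMod.lin f).dualMap (dualActLin W.act x φ) =
        dualActLin V.act x ((HMod.lin f).dualMap φ)
      refine homog_induction k (fun a b ha hb => by
        rw [map_add, map_add]
        exact (map_add (HMod.lin f).dualMap _ _).trans (congrArg₂ (· + ·) ha hb)) ?_ x
      intro i x hx
      refine homog_induction k (V := Module.Dual k W.carrier) (fun a b ha hb => by
        simp only [map_add, ha, hb]) ?_ φ
      intro j φ hφ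
      have hφ' : (HMod.lin f).dualMap φ ∈ gr k j := mem_gr_dual.2 fun v hv =>
        mem_gr_dual.1 hφ _ (HMod.lin_even f (j + 1) v hv)
      refine LinearMap.ext fun v => ?_
      rw [LinearMap.dualMap_apply, dualActLin_apply _ hx hφ, dualActLin_apply _ hx hφ',
        LinearMap.dualMap_apply, HMod.lin_act])

instance : MonoidalCategoryStruct (HMod k H) where
  tensorObj := HMod.tensor
  tensorHom := HMod.tensorMap
  whiskerLeft V _ _ f := HMod.tensorMap (𝟙 V) f
  whiskerRight f V := HMod.tensorMap f (𝟙 V)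
  tensorUnit := HMod.unit k H
  associator V W U := HMod.mkIso (V := HMod.tensor (HMod.tensor V W) U)
    (W := HMod.tensor V (HMod.tensor W U))
    (TensorProduct.assoc k V.carrier W.carrier U.carrier) isEven_assoc
    (assoc_tensorAct U.act V.act_graded W.act_graded)
  leftUnitor V := HMod.mkIso (V := HMod.tensor (HMod.unit k H) V) (W := V)
    (TensorProduct.lid k V.carrier) isEven_lid (lid_tensorAct V.act)
  rightUnitor V := HMod.mkIso (V := HMod.tensor V (HMod.unit k H)) (W := V)
    (TensorProduct.rid k V.carrier) isEven_rid (rid_tensorAct V.act_graded)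

instance : MonoidalCategory (HMod k H) :=
  MonoidalCategory.ofTensorHom
    (id_tensorHom_id := fun V W => HMod.hom_ext TensorProduct.map_id)
    (id_tensorHom := fun _ _ _ _ => rfl)
    (tensorHom_id := fun _ _ => rfl)
    (tensorHom_comp_tensorHom := fun f₁ f₂ g₁ g₂ => HMod.hom_ext
      (TensorProduct.map_comp (HMod.lin g₁) (HMod.lin g₂) (HMod.lin f₁) (HMod.lin f₂)).symm)
    (associator_naturality := fun f₁ f₂ f₃ => HMod.hom_ext
      (TensorProduct.ext_threefold fun _ _ _ => rfl))
    (leftUnitor_naturality := fun {V W} f => HMod.hom_ext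
      (TensorProduct.ext' fun (c : k) v => (map_smul (HMod.lin f) c v).symm))
    (rightUnitor_naturality := fun {V W} f => HMod.hom_ext
      (TensorProduct.ext' fun v (c : k) => (map_smul (HMod.lin f) c v).symm))
    (pentagon := fun V W X Y => HMod.hom_ext
      (TensorProduct.ext_fourfold fun _ _ _ _ => rfl))
    (triangle := fun V W => HMod.hom_ext
      (TensorProduct.ext_threefold fun v (c : k) w => TensorProduct.tmul_smul c v w))

end Category

/-! ### Ribbon structures -/

section Ribbon

variable (k : Type u) (H : Type w) [Field k] [Ring H] [Algebra k H] [Coalgebra k H]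
  [SuperSpace k H] [HopfSuperalgebra k H]

/-- A ribbon structure on the Hopf superalgebra `H`: an even universal `R`-matrix `R` (with inverse
`Rinv` in the graded tensor square) and an even central ribbon element `θ`. -/
structure RibbonStructure where
  R : H ⊗[k] H
  Rinv : H ⊗[k] H
  R_mul_Rinv : mul₂ k H R Rinv = 1 ⊗ₜ 1
  Rinv_mul_R : mul₂ k H Rinv R = 1 ⊗ₜ 1
  R_even : R ∈ gr k (V := H ⊗[k] H) 0
  R_mul_comul : ∀ x : H, mul₂ k H R (comul k H x) = mul₂ k H (superFlip k H H (comul k H x)) R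
  /-- `(Δ ⊗ 1) R = R₁₃ R₂₃` -/
  comul_rTensor_R : (comul k H).rTensor H R =
    mul₃ k H ((TensorProduct.assoc k H H H).symm ((TensorProduct.mk k H H 1).lTensor H R))
      ((TensorProduct.assoc k H H H).symm (1 ⊗ₜ R))
  /-- `(1 ⊗ Δ) R = R₁₃ R₁₂` -/
  comul_lTensor_R : (TensorProduct.assoc k H H H).symm ((comul k H).lTensor H R) =
    mul₃ k H ((TensorProduct.assoc k H H H).symm ((TensorProduct.mk k H H 1).lTensor H R))
      (R ⊗ₜ 1)
  θ : Hˣ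
  θ_even : (θ : H) ∈ gr k (V := H) 0
  θ_central : ∀ x : H, (θ : H) * x = x * θ
  /-- `R₂₁ R Δ(θ) = θ ⊗ θ` -/
  comul_θ : mul₂ k H (mul₂ k H (superFlip k H H R) R) (comul k H θ) = (θ : H) ⊗ₜ (θ : H)
  counit_θ : counit k H θ = 1
  antipode_θ : antipode k H θ = θ

namespace RibbonStructure

variable {k H} (ℛ : RibbonStructure k H)

/-- The Drinfeld element `u = ∑ (-1) ^ (|a| |b|) S(b) a`, where `R = ∑ a ⊗ b`. -/
def drinfeld : H :=
  LinearMap.mul' k H ((antipode k H).rTensor H (superFlip k H H ℛ.R))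

/-- The pivot `g = u θ⁻¹`. -/
def pivot : H := ℛ.drinfeld * (ℛ.θ⁻¹ : Hˣ)

/-- The braiding `v ⊗ w ↦ τ (R (v ⊗ w))` as a linear equivalence. -/
def braidEquiv (V W : HMod k H) : V.carrier ⊗[k] W.carrier ≃ₗ[k] W.carrier ⊗[k] V.carrier :=
  LinearEquiv.ofLinearMap
    (superFlip k V.carrier W.carrier ∘ₗ act₂ V.act W.act ℛ.R)
    (act₂ V.act W.act ℛ.Rinv ∘ₗ superFlip k W.carrier V.carrier)
    (by
      refine LinearMap.ext fun z => ?_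
      have h := LinearMap.congr_fun (act₂_mul (ρ' := W.act) V.act_graded ℛ.R ℛ.Rinv)
        (superFlip k W.carrier V.carrier z)
      rw [ℛ.R_mul_Rinv, act₂_one] at h
      simp only [LinearMap.comp_apply, LinearMap.id_apply]
      rw [← Module.End.mul_apply, ← h, Module.End.one_apply, superFlip_superFlip])
    (by
      refine LinearMap.ext fun z => ?_
      have h := LinearMap.congr_fun (act₂_mul (ρ' := W.act) V.act_graded ℛ.Rinv ℛ.R) z
      rw [ℛ.Rinv_mul_R, act₂_one] at h
      simp only [LinearMap.comp_apply, LinearMap.id_apply]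
      rw [superFlip_superFlip, ← Module.End.mul_apply, ← h, Module.End.one_apply])

theorem braidEquiv_act (V W : HMod k H) (x : H) (z : V.carrier ⊗[k] W.carrier) :
    ℛ.braidEquiv V W (act₂ V.act W.act (comul k H x) z) =
      act₂ W.act V.act (comul k H x) (ℛ.braidEquiv V W z) := by
  have h1 := LinearMap.congr_fun (act₂_mul (ρ' := W.act) V.act_graded ℛ.R (comul k H x)) z
  rw [ℛ.R_mul_comul, act₂_mul V.act_graded, Module.End.mul_apply, Module.End.mul_apply] at h1
  have h2 := superFlip_act₂ V.act_graded W.act_graded (superFlip k H H (comul k H x))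
    (act₂ V.act W.act ℛ.R z)
  rw [superFlip_superFlip, h1] at h2
  exact h2

/-- The braiding of the category of `H`-modules. -/
def braid (V W : HMod k H) : V ⊗ W ≅ W ⊗ V :=
  HMod.mkIso (V := HMod.tensor V W) (W := HMod.tensor W V) (ℛ.braidEquiv V W)
    (fun i z hz => by
      have h := act₂_mem V.act_graded W.act_graded ℛ.R_even hz
      rw [zero_add] at h
      exact superFlip_mem h)
    (ℛ.braidEquiv_act V W)

/-- The automorphism of a module given by the action of `θ`. -/
def thetaIso (V : HMod k H) : V ≅ V :=
  HMod.mkIso (LinearEquiv.ofLinearMap (V.act ℛ.θ) (V.act (ℛ.θ⁻¹ : Hˣ))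
      (by rw [← Module.End.mul_eq_comp, ← map_mul, Units.mul_inv, map_one]; rfl)
      (by rw [← Module.End.mul_eq_comp, ← map_mul, Units.inv_mul, map_one]; rfl))
    (fun i v hv => by
      have h := V.act_graded 0 i _ ℛ.θ_even v hv
      rwa [zero_add] at h)
    (fun x v => by
      change V.act ℛ.θ (V.act x v) = V.act x (V.act ℛ.θ v)
      rw [← Module.End.mul_apply, ← map_mul, ℛ.θ_central, map_mul, Module.End.mul_apply])

/-- The twist of a module: the action of `θ⁻¹`. -/
def twist (V : HMod k H) : V ⟶ V := (ℛ.thetaIso V).inv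

theorem lin_twist (V : HMod k H) : HMod.lin (ℛ.twist V) = V.act (ℛ.θ⁻¹ : Hˣ) := rfl

theorem lin_braid (V W : HMod k H) : HMod.lin (ℛ.braid V W).hom =
    superFlip k V.carrier W.carrier ∘ₗ act₂ V.act W.act ℛ.R := rfl

/-- A half twist: a natural automorphism of the identity functor of the category of `H`-modules
that squares to the twist, is compatible with duals, and is trivial on the unit object. -/
structure HalfTwist where
  iso : 𝟭 (HMod k H) ≅ 𝟭 (HMod k H)
  sq : ∀ V : HMod k H, iso.hom.app V ≫ iso.hom.app V = ℛ.twist V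
  dual : ∀ V : HMod k H, iso.hom.app (HMod.dual V) = HMod.dualMap (iso.hom.app V)
  unit : iso.hom.app (𝟙_ (HMod k H)) = 𝟙 (𝟙_ (HMod k H))

variable {ℛ} in
/-- The isomorphism `X = (√θ)⁻¹ ∘ c ∘ (√θ ⊗ √θ) : V ⊗ W ≅ W ⊗ V`. -/
def HalfTwist.X (s : ℛ.HalfTwist) (V W : HMod k H) : V ⊗ W ≅ W ⊗ V :=
  (s.iso.app V ⊗ᵢ s.iso.app W) ≪≫ ℛ.braid V W ≪≫ (s.iso.app (W ⊗ V)).symm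

end RibbonStructure

end Ribbon

/-! ### The anti-superautomorphism -/

section Dagger

variable {k : Type u} {H : Type w} [Field k] [StarRing k] [Ring H] [Algebra k H] [Coalgebra k H]
  [SuperSpace k H] [HopfSuperalgebra k H]

/-- An antilinear bijective anti-superautomorphism `†` of `H`, such that
`Δ(x†) = († ⊗ †) (τ (Δ x))`, `(† ⊗ †) R = τ (R⁻¹)` and `g† = g⁻¹`. -/
structure Dagger (ℛ : RibbonStructure k H) where
  dag : H ≃ₗ⋆[k] H
  dag_mem : ∀ i, ∀ x ∈ gr k (V := H) i, dag x ∈ gr k (V := H) i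
  dag_mul : ∀ i j, ∀ x ∈ gr k (V := H) i, ∀ y ∈ gr k (V := H) j,
    dag (x * y) = koszulSign k i j • (dag y * dag x)
  comul_dag : ∀ x : H, comul k H (dag x) =
    TensorProduct.map dag.toLinearMap dag.toLinearMap (superFlip k H H (comul k H x))
  dag_R : TensorProduct.map dag.toLinearMap dag.toLinearMap ℛ.R = superFlip k H H ℛ.Rinv
  dag_pivot_mul : dag ℛ.pivot * ℛ.pivot = 1
  pivot_mul_dag : ℛ.pivot * dag ℛ.pivot = 1

namespace Dagger

variable {ℛ : RibbonStructure k H} (D : Dagger ℛ)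

theorem dag_one : D.dag 1 = 1 := by
  obtain ⟨y, hy⟩ := D.dag.surjective 1
  have h : ∀ y, D.dag y = D.dag y * D.dag 1 := by
    refine homog_induction k (fun a b ha hb => by
      rw [map_add, add_mul, ← ha, ← hb]) ?_
    intro i y hy
    have := D.dag_mul _ _ 1 one_mem_gr y hy
    rw [one_mul, koszulSign_zero_left, one_smul] at this
    exact this
  have := h y
  rw [hy, one_mul] at this
  exact this.symm

theorem counit_dag (x : H) : counit k H (D.dag x) = star (counit k H x) := by
  let ε' : H →ₗ[k] k :=
    (starLinearEquiv k (A := k)).toLinearMap ∘ₛₗ (counit k H ∘ₛₗ D.dag.toLinearMap)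
  have hε' : ∀ a, ε' a = star (counit k H (D.dag a)) := fun _ => rfl
  have key : ∀ y : H ⊗[k] H,
      TensorProduct.rid k H ((counit k H).lTensor H
        (TensorProduct.map D.dag.toLinearMap D.dag.toLinearMap (superFlip k H H y))) =
      D.dag (TensorProduct.lid k H (ε'.rTensor H y)) := by
    intro y
    refine homog_tensor_induction (by simp) (fun a b ha hb => by simp only [map_add, ha, hb]) ?_ y
    intro i j a ha b hb
    have h : koszulSign k i j * counit k H (D.dag a) = counit k H (D.dag a) := by
      rcases zmod2_cases i with rfl | rfl
      · simp
      · rw [HopfSuperalgebra.counit_odd _ (D.dag_mem 1 a ha), mul_zero]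
    rw [superFlip_tmul ha hb]
    simp [hε', LinearEquiv.map_smulₛₗ, smul_smul, h, star_koszulSign, starRingEnd_apply]
  have h1 := key (comul k H x)
  rw [← D.comul_dag, Coalgebra.lTensor_counit_comul] at h1
  simp only [TensorProduct.rid_tmul, one_smul] at h1
  have h2 := congrArg (counit k H) (D.dag.injective h1)
  have h3 : ∀ y : H ⊗[k] H, counit k H (TensorProduct.lid k H (ε'.rTensor H y)) =
      ε' (TensorProduct.rid k H ((counit k H).lTensor H y)) := by
    intro y
    induction y with
    | zero => simp
    | add a b ha hb => simp only [map_add, ha, hb]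
    | tmul a b => simp [mul_comm]
  rw [h3, Coalgebra.lTensor_counit_comul] at h2
  simp only [TensorProduct.rid_tmul, one_smul] at h2
  rw [h2, hε', star_star]

theorem dag_oddPart (x : H) : D.dag (oddPart k H x) = oddPart k H (D.dag x) := by
  refine homog_induction k (fun a b ha hb => by simp only [map_add, ha, hb]) ?_ x
  intro i x hx
  rw [oddPart_of_mem hx, oddPart_of_mem (D.dag_mem i x hx), LinearEquiv.map_smulₛₗ, map_natCast]

theorem mem_of_dag_mem {i : ZMod 2} {x : H} (hx : D.dag x ∈ gr k (V := H) i) :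
    x ∈ gr k (V := H) i := by
  rw [mem_gr_iff] at hx ⊢
  apply D.dag.injective
  rw [dag_oddPart, hx, LinearEquiv.map_smulₛₗ, map_natCast]

theorem antipode_dag (x : H) : antipode k H (D.dag x) = D.dag (antipode k H x) := by
  let T : H →ₗ[k] H :=
    D.dag.symm.toLinearMap ∘ₛₗ (antipode k H ∘ₛₗ D.dag.toLinearMap)
  have hT : ∀ a, D.dag (T a) = antipode k H (D.dag a) := fun a => D.dag.apply_symm_apply _
  have hTm : ∀ i, ∀ a ∈ gr k (V := H) i, T a ∈ gr k (V := H) i := by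
    intro i a ha
    refine D.mem_of_dag_mem ?_
    rw [hT]
    exact HopfSuperalgebra.antipode_mem i _ (D.dag_mem i a ha)
  have key : ∀ y : H ⊗[k] H, D.dag (LinearMap.mul' k H (T.lTensor H y)) =
      LinearMap.mul' k H ((antipode k H).rTensor H
        (TensorProduct.map D.dag.toLinearMap D.dag.toLinearMap (superFlip k H H y))) := by
    intro y
    refine homog_tensor_induction (by simp) (fun a b ha hb => by simp only [map_add, ha, hb]) ?_ y
    intro i j a ha b hb
    rw [superFlip_tmul ha hb]
    simp [LinearMap.map_smulₛₗ, D.dag_mul _ _ a ha _ (hTm j b hb), hT,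
      star_koszulSign, starRingEnd_apply]
  have h : antipode k H = T := by
    refine antipode_unique (LinearMap.ext fun x => D.dag.injective ?_)
    have h1 := LinearMap.congr_fun
      (HopfSuperalgebra.mul_antipode_rTensor_comul (k := k) (H := H)) (D.dag x)
    simp only [LinearMap.comp_apply] at h1 ⊢
    rw [key, ← D.comul_dag, h1, Algebra.linearMap_apply, Algebra.linearMap_apply,
      Algebra.algebraMap_eq_smul_one, Algebra.algebraMap_eq_smul_one, LinearEquiv.map_smulₛₗ,
      D.dag_one, D.counit_dag]
    rfl
  rw [h, hT, ← h]

end Dagger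

end Dagger

/-! ### Sesquilinear forms -/

section Sesquilinear

variable {k : Type*} [Field k] [StarRing k]
variable {V W : Type*} [AddCommGroup V] [Module k V] [AddCommGroup W] [Module k W]
  [SuperSpace k V] [SuperSpace k W]

/-- A sesquilinear form is even if vectors of opposite parity are orthogonal. -/
def EvenForm (B : V →ₗ⋆[k] V →ₗ[k] k) : Prop :=
  ∀ i j, i ≠ j → ∀ v ∈ gr k (V := V) i, ∀ w ∈ gr k (V := V) j, B v w = 0

/-- The form `(v ⊗ w | v' ⊗ w')ₚ = (-1) ^ (|v'| |w|) (v | v') (w | w')`. -/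
def pForm (B : V →ₗ⋆[k] V →ₗ[k] k) (B' : W →ₗ⋆[k] W →ₗ[k] k) :
    V ⊗[k] W →ₗ⋆[k] V ⊗[k] W →ₗ[k] k :=
  (superTensor B B').compr₂ₛₗ (LinearMap.mul' k k)

theorem pForm_tmul (B : V →ₗ⋆[k] V →ₗ[k] k) (B' : W →ₗ⋆[k] W →ₗ[k] k) {i j : ZMod 2} (v : V)
    {w : W} {v' : V} (w' : W) (hw : w ∈ gr k i) (hv' : v' ∈ gr k j) :
    pForm B B' (v ⊗ₜ w) (v' ⊗ₜ w') = koszulSign k i j * (B v v' * B' w w') := by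
  have h := superTensor_tmul B B' v w' hw hv'
  simp only [pForm, LinearMap.compr₂ₛₗ_apply, h, map_smul, LinearMap.mul'_apply, smul_eq_mul]

theorem pForm_even {B : V →ₗ⋆[k] V →ₗ[k] k} {B' : W →ₗ⋆[k] W →ₗ[k] k} (hB : EvenForm B)
    (hB' : EvenForm B') : EvenForm (pForm B B') := by
  intro i j hij x hx y hy
  let S : Submodule k (V ⊗[k] W) :=
    { carrier := {x | ∀ y ∈ gr k (V := V ⊗[k] W) j, pForm B B' x y = 0}
      add_mem' := fun {a b} ha hb y hy => by
        rw [map_add, LinearMap.add_apply, ha y hy, hb y hy, add_zero]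
      zero_mem' := fun y _ => by simp
      smul_mem' := fun c a ha y hy => by
        rw [LinearMap.map_smulₛₗ, LinearMap.smul_apply, ha y hy, smul_zero] }
  have h1 : tensorGr k V W i ≤ S := by
    refine tensorGr_le fun p q hpq v hv w hw => ?_
    intro y hy
    have h2 : tensorGr k V W j ≤ LinearMap.ker (pForm B B' (v ⊗ₜ w)) := by
      refine tensorGr_le fun r s hrs v' hv' w' hw' => ?_
      rw [LinearMap.mem_ker, pForm_tmul B B' v w' hw hv']
      by_cases h : p = r
      · have h' : q ≠ s := fun h' => hij (by rw [← hpq, ← hrs, h, h'])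
        rw [hB' q s h' w hw w' hw', mul_zero, mul_zero]
      · rw [hB p r h v hv v' hv', zero_mul, mul_zero]
    exact h2 hy
  exact h1 hx y hy

/-- A conjugation of a finite-dimensional space. -/
theorem exists_conj (V : Type*) [AddCommGroup V] [Module k V] [FiniteDimensional k V] :
    Nonempty (V ≃ₗ⋆[k] V) := by
  let b := (Module.finBasis k V).equivFun
  exact ⟨(b.trans (starLinearEquiv k (A := Fin (Module.finrank k V) → k))).trans b.symm⟩

theorem flat_bijective [FiniteDimensional k V] {B : V →ₗ⋆[k] V →ₗ[k] k}
    (hB : B.SeparatingLeft) : Function.Bijective (B : V → V →ₗ[k] k) := by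
  have hinj : Function.Injective (B : V → V →ₗ[k] k) := by
    rw [injective_iff_map_eq_zero]
    exact LinearMap.separatingLeft_iff_linear_nontrivial.1 hB
  refine ⟨hinj, fun φ => ?_⟩
  obtain ⟨C⟩ := exists_conj (k := k) V
  let F : V →ₗ[k] (V →ₗ[k] k) := B ∘ₛₗ C.toLinearMap
  have hF : Function.Injective F := hinj.comp C.injective
  obtain ⟨v, hv⟩ := (LinearMap.injective_iff_surjective_of_finrank_eq_finrank
    (Subspace.dual_finrank_eq (K := k) (V := V)).symm).1 hF φ
  exact ⟨C v, hv⟩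

theorem nondegenerate_of_separatingLeft [FiniteDimensional k V] {B : V →ₗ⋆[k] V →ₗ[k] k}
    (hB : B.SeparatingLeft) : B.Nondegenerate := by
  refine ⟨hB, fun w hw => ?_⟩
  refine (Module.forall_dual_apply_eq_zero_iff k w).1 fun φ => ?_
  obtain ⟨v, rfl⟩ := (flat_bijective hB).2 φ
  exact hw v

/-- The map `v ↦ (v | ·)`. -/
def flat [FiniteDimensional k V] (B : V →ₗ⋆[k] V →ₗ[k] k) (hB : B.Nondegenerate) :
    V ≃ₗ⋆[k] Module.Dual k V := LinearEquiv.ofBijective B (flat_bijective hB.1)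

theorem flat_apply [FiniteDimensional k V] (B : V →ₗ⋆[k] V →ₗ[k] k) (hB : B.Nondegenerate)
    (v w : V) : flat B hB v w = B v w := rfl

theorem flat_mem {B : V →ₗ⋆[k] V →ₗ[k] k} (eB : EvenForm B) {i : ZMod 2} {v : V}
    (hv : v ∈ gr k i) : (B v : Module.Dual k V) ∈ gr k (V := Module.Dual k V) i :=
  mem_gr_dual.2 fun w hw => eB i (i + 1) (by simp) v hv w hw

theorem mem_of_flat_mem [FiniteDimensional k V] {B : V →ₗ⋆[k] V →ₗ[k] k} (hB : B.Nondegenerate)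
    (eB : EvenForm B) {i : ZMod 2} {v : V}
    (hv : (B v : Module.Dual k V) ∈ gr k (V := Module.Dual k V) i) : v ∈ gr k i := by
  have h : ∀ v, B (oddPart k V v) = oddPart k (Module.Dual k V) (B v) := by
    refine homog_induction k (fun a b ha hb => by simp only [map_add, ha, hb]) ?_
    intro j v hv
    rw [oddPart_of_mem hv, oddPart_of_mem (flat_mem eB hv), LinearMap.map_smulₛₗ, map_natCast]
  rw [mem_gr_iff] at hv ⊢
  apply (flat_bijective hB.1).1
  rw [h, hv, LinearMap.map_smulₛₗ, map_natCast]

theorem pForm_nondegenerate [FiniteDimensional k V] [FiniteDimensional k W]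
    {B : V →ₗ⋆[k] V →ₗ[k] k} {B' : W →ₗ⋆[k] W →ₗ[k] k} (hB : B.Nondegenerate)
    (hB' : B'.Nondegenerate) (eB : EvenForm B) (eB' : EvenForm B') :
    (pForm B B').Nondegenerate := by
  refine nondegenerate_of_separatingLeft ?_
  have key : ∀ x y, pForm B B' x y = TensorProduct.dualDistribEquiv k V W
      (TensorProduct.congr (flat B hB) (flat B' hB')
        ((TensorProduct.comm k V W).symm (superFlip k V W x))) y := by
    intro x
    refine homog_tensor_induction (by simp) (fun a b ha hb y => by
      simp only [map_add, LinearMap.add_apply, ha, hb]) ?_ x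
    intro i j v hv w hw y
    refine homog_tensor_induction (by simp) (fun a b ha hb => by
      simp only [map_add, ha, hb]) ?_ y
    intro p q v' hv' w' hw'
    rw [pForm_tmul B B' v w' hw hv', superFlip_tmul hv hw]
    rw [map_smul, TensorProduct.comm_symm_tmul, LinearEquiv.map_smulₛₗ, map_smul,
      TensorProduct.congr_tmul, LinearMap.smul_apply, starRingEnd_apply, star_koszulSign,
      smul_eq_mul]
    change _ = koszulSign k i j * (B v v' * B' w w')
    by_cases h : i = p
    · rw [← h, koszulSign_comm]
    · rw [eB i p h v hv v' hv', zero_mul, mul_zero, mul_zero]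
  intro x hx
  have h := LinearMap.ext (f := _) (g := 0) fun y => (key x y).symm.trans (hx y)
  rw [LinearEquiv.map_eq_zero_iff, LinearEquiv.map_eq_zero_iff, LinearEquiv.map_eq_zero_iff] at h
  rw [← superFlip_superFlip x, h, map_zero]

/-- The form on the dual space: `(φ | ψ) = ∑ᵢ conj (φ eᵢ) (ψ e'ᵢ)`, where `(eᵢ | e'ⱼ) = δᵢⱼ`
(see `dualForm_eq_sum`). -/
def dualForm [FiniteDimensional k V] (B : V →ₗ⋆[k] V →ₗ[k] k) (hB : B.Nondegenerate) :
    Module.Dual k V →ₗ⋆[k] Module.Dual k V →ₗ[k] k :=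
  LinearMap.mk₂'ₛₗ (starRingEnd k) (.id k) (fun φ ψ => star (φ ((flat B hB).symm ψ)))
    (fun _ _ _ => by simp) (fun _ _ _ => by simp [starRingEnd_apply]) (fun _ _ _ => by simp)
    (fun c φ ψ => by simp [LinearEquiv.map_smulₛₗ, starRingEnd_apply])

theorem dualForm_apply [FiniteDimensional k V] (B : V →ₗ⋆[k] V →ₗ[k] k) (hB : B.Nondegenerate)
    (φ : Module.Dual k V) (v : V) : dualForm B hB φ (B v) = star (φ v) := by
  have : (flat B hB).symm (B v) = v := (flat B hB).symm_apply_apply v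
  change star (φ ((flat B hB).symm (B v))) = _
  rw [this]

theorem dualForm_eq_sum [FiniteDimensional k V] (B : V →ₗ⋆[k] V →ₗ[k] k) (hB : B.Nondegenerate)
    {ι : Type*} [Fintype ι] [DecidableEq ι] (e : Module.Basis ι k V) (e' : ι → V)
    (he : ∀ i j, B (e i) (e' j) = if i = j then 1 else 0) (φ ψ : Module.Dual k V) :
    dualForm B hB φ ψ = ∑ i, star (φ (e i)) * ψ (e' i) := by
  obtain ⟨v, rfl⟩ := (flat_bijective hB.1).2 ψ
  rw [dualForm_apply]
  have hv : v = ∑ i, e.repr v i • e i := (e.sum_repr v).symm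
  generalize (e.repr v : ι → k) = c at hv
  subst hv
  simp [LinearMap.map_smulₛₗ, he, mul_comm, starRingEnd_apply]

theorem dualForm_even [FiniteDimensional k V] {B : V →ₗ⋆[k] V →ₗ[k] k} (hB : B.Nondegenerate)
    (eB : EvenForm B) : EvenForm (dualForm B hB) := by
  intro i j hij φ hφ ψ hψ
  obtain ⟨v, rfl⟩ := (flat_bijective hB.1).2 ψ
  have hv := mem_of_flat_mem hB eB hψ
  have : j = i + 1 := by
    clear hφ hψ hv
    revert i j
    decide
  subst this
  rw [dualForm_apply, mem_gr_dual.1 hφ v hv, star_zero]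

theorem dualForm_nondegenerate [FiniteDimensional k V] {B : V →ₗ⋆[k] V →ₗ[k] k}
    (hB : B.Nondegenerate) : (dualForm B hB).Nondegenerate := by
  refine nondegenerate_of_separatingLeft fun φ hφ => LinearMap.ext fun v => ?_
  have := hφ (B v)
  rwa [dualForm_apply, star_eq_zero] at this

end Sesquilinear

/-! ### The category of sesquilinear modules -/

section SesqModules

variable {k : Type u} {H : Type w} [Field k] [StarRing k] [Ring H] [Algebra k H] [Coalgebra k H]
  [SuperSpace k H] [HopfSuperalgebra k H] {ℛ : RibbonStructure k H}

namespace Dagger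

variable (D : Dagger ℛ)

theorem superFlip_dag (y : H ⊗[k] H) :
    superFlip k H H (TensorProduct.map D.dag.toLinearMap D.dag.toLinearMap y) =
      TensorProduct.map D.dag.toLinearMap D.dag.toLinearMap (superFlip k H H y) := by
  refine homog_tensor_induction (by simp) (fun a b ha hb => by simp only [map_add, ha, hb]) ?_ y
  intro i j a ha b hb
  rw [superFlip_tmul ha hb, LinearMap.map_smulₛₗ, TensorProduct.map_tmul, TensorProduct.map_tmul,
    starRingEnd_apply, star_koszulSign]
  exact superFlip_tmul (D.dag_mem i a ha) (D.dag_mem j b hb)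

/-- A form is compatible with `†` if `(x v | w) = (-1) ^ (|x| |v|) (v | x† w)`. -/
def Compatible {V : Type*} [AddCommGroup V] [Module k V] [SuperSpace k V]
    (ρ : H →ₐ[k] Module.End k V) (B : V →ₗ⋆[k] V →ₗ[k] k) : Prop :=
  ∀ i j, ∀ x ∈ gr k (V := H) i, ∀ v ∈ gr k (V := V) j, ∀ w : V,
    B (ρ x v) w = koszulSign k i j * B v (ρ (D.dag x) w)

theorem pForm_act₂ {V W : Type*} [AddCommGroup V] [Module k V] [SuperSpace k V]
    [AddCommGroup W] [Module k W] [SuperSpace k W] {ρ : H →ₐ[k] Module.End k V}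
    {ρ' : H →ₐ[k] Module.End k W} (hρ : IsGradedAct ρ) (hρ' : IsGradedAct ρ')
    {B : V →ₗ⋆[k] V →ₗ[k] k} {B' : W →ₗ⋆[k] W →ₗ[k] k} (hB : D.Compatible ρ B)
    (hB' : D.Compatible ρ' B') {i j : ZMod 2} {b : H ⊗[k] H} {x : V ⊗[k] W}
    (hb : b ∈ gr k (V := H ⊗[k] H) i) (hx : x ∈ gr k (V := V ⊗[k] W) j) (y : V ⊗[k] W) :
    pForm B B' (act₂ ρ ρ' b x) y = koszulSign k i j *
      pForm B B' x (act₂ ρ ρ' (TensorProduct.map D.dag.toLinearMap D.dag.toLinearMap b) y) := by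
  let S : Submodule k (H ⊗[k] H) :=
    { carrier := {b | ∀ x ∈ gr k (V := V ⊗[k] W) j, ∀ y, pForm B B' (act₂ ρ ρ' b x) y =
        koszulSign k i j * pForm B B' x
          (act₂ ρ ρ' (TensorProduct.map D.dag.toLinearMap D.dag.toLinearMap b) y)}
      add_mem' := fun {a b} ha hb x hx y => by
        simp only [map_add, LinearMap.add_apply, ha x hx y, hb x hx y, mul_add]
      zero_mem' := fun x hx y => by simp
      smul_mem' := fun c a ha x hx y => by
        simp only [map_smul, LinearMap.smul_apply, LinearMap.map_smulₛₗ, ha x hx y, smul_eq_mul]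
        ring }
  have h1 : tensorGr k H H i ≤ S := by
    refine tensorGr_le fun p p' hp a ha b hb x hx y => ?_
    let T : Submodule k (V ⊗[k] W) :=
      { carrier := {x | ∀ y, pForm B B' (act₂ ρ ρ' (a ⊗ₜ b) x) y =
          koszulSign k i j * pForm B B' x
            (act₂ ρ ρ' (TensorProduct.map D.dag.toLinearMap D.dag.toLinearMap (a ⊗ₜ b)) y)}
        add_mem' := fun {a b} ha hb y => by
          simp only [map_add, LinearMap.add_apply, ha y, hb y, mul_add]
        zero_mem' := fun y => by simp
        smul_mem' := fun c a ha y => by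
          simp only [map_smul, LinearMap.smul_apply, LinearMap.map_smulₛₗ, ha y, smul_eq_mul]
          ring }
    have h2 : tensorGr k V W j ≤ T := by
      refine tensorGr_le fun q q' hq v hv w hw y => ?_
      refine homog_tensor_induction (by simp) (fun a b ha hb => by
        simp only [map_add, ha, hb, mul_add]) ?_ y
      intro r r' v' hv' w' hw'
      have e : TensorProduct.map D.dag.toLinearMap D.dag.toLinearMap (a ⊗ₜ[k] b) =
        D.dag a ⊗ₜ[k] D.dag b := rfl
      rw [act₂_tmul _ _ _ _ hb hv, e, act₂_tmul _ _ _ _ (D.dag_mem p' b hb) hv',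
        LinearMap.map_smulₛₗ, LinearMap.smul_apply, map_smul,
        pForm_tmul _ _ _ _ (hρ' p' q' b hb w hw) hv',
        pForm_tmul _ _ _ _ hw (hρ p r _ (D.dag_mem p a ha) v' hv'), hB p q a ha v hv,
        hB' p' q' b hb w hw, starRingEnd_apply, star_koszulSign, smul_eq_mul, smul_eq_mul,
        ← hp, ← hq]
      simp only [koszulSign_add_left, koszulSign_add_right]
      rw [koszulSign_comm q' p]
      linear_combination -(koszulSign k p' q * koszulSign k p' r * koszulSign k q' r *
        koszulSign k p q * koszulSign k p' q' * (B v (ρ (D.dag a) v')) *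
        (B' w (ρ' (D.dag b) w'))) * koszulSign_mul_self (k := k) p q'
    exact h2 hx y
  exact h1 hb x hx y

end Dagger

/-- A sesquilinear module: a finite-dimensional `H`-module with an even non-degenerate
sesquilinear form, antilinear in the first variable, that is compatible with `†`. The half twist `s`
only serves to single out the tensor product of sesquilinear modules. -/
structure SesqMod (D : Dagger ℛ) (s : ℛ.HalfTwist) extends HMod k H where
  form : carrier →ₗ⋆[k] carrier →ₗ[k] k
  form_nondegenerate : form.Nondegenerate
  form_even : EvenForm form
  form_compatible : D.Compatible act form

namespace SesqMod

variable {D : Dagger ℛ} {s : ℛ.HalfTwist}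

/-- Morphisms of sesquilinear modules: all even `H`-linear maps. -/
instance : Category (SesqMod D s) where
  Hom V W := V.toHMod ⟶ W.toHMod
  id V := 𝟙 V.toHMod
  comp f g := CategoryStruct.comp (obj := HMod k H) f g
  id_comp f := Category.id_comp (obj := HMod k H) f
  comp_id f := Category.comp_id (obj := HMod k H) f
  assoc f g h := Category.assoc (obj := HMod k H) f g h

instance : Preadditive (SesqMod D s) where
  homGroup V W := inferInstanceAs (AddCommGroup (V.toHMod ⟶ W.toHMod))
  add_comp _ _ _ f f' g := Preadditive.add_comp (C := HMod k H) _ _ _ f f' g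
  comp_add _ _ _ f g g' := Preadditive.comp_add (C := HMod k H) _ _ _ f g g'

instance : Linear k (SesqMod D s) where
  homModule V W := inferInstanceAs (Module k (V.toHMod ⟶ W.toHMod))
  smul_comp _ _ _ r f g := Linear.smul_comp (C := HMod k H) _ _ _ r f g
  comp_smul _ _ _ f r g := Linear.comp_smul (C := HMod k H) _ _ _ f r g

/-- The linear map underlying a morphism. -/
def lin {V W : SesqMod D s} (f : V ⟶ W) : V.carrier →ₗ[k] W.carrier :=
  HMod.lin (V := V.toHMod) (W := W.toHMod) f

/-- The linear map `τ ∘ X`. -/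
def flipX (s : ℛ.HalfTwist) (V W : HMod k H) :
    V.carrier ⊗[k] W.carrier →ₗ[k] V.carrier ⊗[k] W.carrier :=
  superFlip k W.carrier V.carrier ∘ₗ
    HMod.lin (V := HMod.tensor V W) (W := HMod.tensor W V) (s.X V W).hom

/-- The tensor product form `(z | z') = (z | τ (X z'))ₚ`. -/
def tensorForm (V W : SesqMod D s) : V.carrier ⊗[k] W.carrier →ₗ⋆[k]
    V.carrier ⊗[k] W.carrier →ₗ[k] k :=
  (pForm V.form W.form).compl₂ (flipX s V.toHMod W.toHMod)

theorem tensorForm_apply (V W : SesqMod D s) (z z' : V.carrier ⊗[k] W.carrier) :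
    tensorForm V W z z' = pForm V.form W.form z (superFlip k W.carrier V.carrier
      (HMod.lin (V := HMod.tensor V.toHMod W.toHMod) (W := HMod.tensor W.toHMod V.toHMod)
        (s.X V.toHMod W.toHMod).hom z')) := rfl

theorem flipX_mem (V W : HMod k H) {i : ZMod 2} {z : V.carrier ⊗[k] W.carrier}
    (hz : z ∈ gr k i) : flipX s V W z ∈ gr k (V := V.carrier ⊗[k] W.carrier) i :=
  superFlip_mem (HMod.lin_even (V := HMod.tensor V W) (W := HMod.tensor W V) (s.X V W).hom i z hz)

theorem flipX_act (V W : HMod k H) (x : H) (z : V.carrier ⊗[k] W.carrier) :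
    flipX s V W (act₂ V.act W.act (comul k H (D.dag x)) z) =
      act₂ V.act W.act (TensorProduct.map D.dag.toLinearMap D.dag.toLinearMap (comul k H x))
        (flipX s V W z) := by
  have h1 := HMod.lin_act (V := HMod.tensor V W) (W := HMod.tensor W V) (s.X V W).hom (D.dag x) z
  have h2 := superFlip_act₂ W.act_graded V.act_graded (comul k H (D.dag x))
    (HMod.lin (V := HMod.tensor V W) (W := HMod.tensor W V) (s.X V W).hom z)
  rw [D.comul_dag, D.superFlip_dag, superFlip_superFlip, ← D.comul_dag] at h2
  exact (congrArg (superFlip k W.carrier V.carrier) h1).trans h2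

theorem flipX_surjective (V W : HMod k H) : Function.Surjective (flipX s V W) := by
  intro z
  refine ⟨HMod.lin (V := HMod.tensor W V) (W := HMod.tensor V W) (s.X V W).inv
    (superFlip k V.carrier W.carrier z), ?_⟩
  have h := LinearMap.congr_fun (congrArg (HMod.lin (V := HMod.tensor W V) (W := HMod.tensor W V))
    (s.X V W).inv_hom_id) (superFlip k V.carrier W.carrier z)
  exact (congrArg (superFlip k W.carrier V.carrier) h).trans (superFlip_superFlip z)

theorem tensorForm_nondegenerate (V W : SesqMod D s) : (tensorForm V W).Nondegenerate := by
  refine nondegenerate_of_separatingLeft fun z hz => ?_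
  refine (pForm_nondegenerate V.form_nondegenerate W.form_nondegenerate V.form_even
    W.form_even).1 z fun z' => ?_
  obtain ⟨y, rfl⟩ := flipX_surjective (s := s) V.toHMod W.toHMod z'
  exact hz y

theorem tensorForm_even (V W : SesqMod D s) : EvenForm (tensorForm V W) :=
  fun i j hij z hz z' hz' =>
    pForm_even V.form_even W.form_even i j hij z hz _ (flipX_mem V.toHMod W.toHMod hz')

theorem tensorForm_compatible (V W : SesqMod D s) :
    D.Compatible (tensorAct V.act W.act V.act_graded) (tensorForm V W) := by
  intro i j x hx z hz z'
  have h := D.pForm_act₂ V.act_graded W.act_graded V.form_compatible W.form_compatible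
    (HopfSuperalgebra.comul_mem i x hx) hz (flipX s V.toHMod W.toHMod z')
  rw [← flipX_act] at h
  exact h

/-- The tensor product of sesquilinear modules. -/
def tensor (V W : SesqMod D s) : SesqMod D s where
  toHMod := HMod.tensor V.toHMod W.toHMod
  form := tensorForm V W
  form_nondegenerate := tensorForm_nondegenerate V W
  form_even := tensorForm_even V W
  form_compatible := tensorForm_compatible V W

variable (k) in
/-- The form `(a | b) = conj a * b` on the ground field. -/
def unitForm : k →ₗ⋆[k] k →ₗ[k] k :=
  (LinearMap.mul k k) ∘ₛₗ (starLinearEquiv k (A := k)).toLinearMap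

theorem unitForm_apply (a b : k) : unitForm k a b = star a * b := rfl

theorem unitForm_nondegenerate : (unitForm k).Nondegenerate := by
  refine nondegenerate_of_separatingLeft fun a ha => ?_
  have h := ha 1
  rw [unitForm_apply] at h
  simpa using h

theorem mem_gr_field_one {c : k} (hc : c ∈ gr k (V := k) 1) : c = 0 := by
  change c ∈ (if (1 : ZMod 2) = 0 then (⊤ : Submodule k k) else ⊥) at hc
  rw [if_neg one_ne_zero] at hc
  exact hc

theorem unitForm_even : EvenForm (unitForm k) := by
  intro i j hij a ha b hb
  rw [unitForm_apply]
  rcases zmod2_cases i with rfl | rfl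
  · rcases zmod2_cases j with rfl | rfl
    · exact absurd rfl hij
    · rw [mem_gr_field_one hb, mul_zero]
  · rw [mem_gr_field_one ha, star_zero, zero_mul]

theorem unitForm_compatible : D.Compatible (trivAct k H) (unitForm k) := by
  intro i j x hx a ha b
  change star (counit k H x * a) * b = koszulSign k i j * (star a * (counit k H (D.dag x) * b))
  rw [D.counit_dag]
  rcases zmod2_cases i with rfl | rfl
  · rw [star_mul, koszulSign_zero_left]; ring
  · rw [HopfSuperalgebra.counit_odd x hx]; simp

variable (D s) in
/-- The unit object, with the form `(a | b) = conj a * b`. -/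
def unit : SesqMod D s where
  toHMod := HMod.unit k H
  form := unitForm k
  form_nondegenerate := unitForm_nondegenerate
  form_even := unitForm_even
  form_compatible := unitForm_compatible

theorem dualForm_compatible (V : SesqMod D s) :
    D.Compatible (dualAct V.act V.act_graded) (dualForm V.form V.form_nondegenerate) := by
  intro i j x hx φ hφ ψ
  refine homog_induction k (V := Module.Dual k V.carrier) (fun a b ha hb => by
    simp only [map_add, ha, hb, mul_add]) ?_ ψ
  intro l ψ hψ
  obtain ⟨v, rfl⟩ := (flat_bijective V.form_nondegenerate.1).2 ψ
  have hv := mem_of_flat_mem V.form_nondegenerate V.form_even hψ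
  have e : dualAct V.act V.act_graded (D.dag x) (V.form v) =
      V.form (V.act (antipode k H x) v) := by
    refine LinearMap.ext fun w => ?_
    refine (dualActLin_apply V.act (D.dag_mem i x hx) hψ w).trans ?_
    rw [V.form_compatible i l _ (HopfSuperalgebra.antipode_mem i x hx) v hv, D.antipode_dag]
  rw [e, dualForm_apply, dualForm_apply]
  refine (congrArg star (dualActLin_apply V.act hx hφ v)).trans ?_
  rw [star_mul, star_koszulSign, mul_comm]

/-- The dual of a sesquilinear module. -/
def dual (V : SesqMod D s) : SesqMod D s where
  toHMod := HMod.dual V.toHMod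
  form := dualForm V.form V.form_nondegenerate
  form_nondegenerate := dualForm_nondegenerate V.form_nondegenerate
  form_even := dualForm_even V.form_nondegenerate V.form_even
  form_compatible := dualForm_compatible V

/-- An isomorphism of the underlying modules is an isomorphism. -/
def mkIso {V W : SesqMod D s} (e : V.toHMod ≅ W.toHMod) : V ≅ W where
  hom := e.hom
  inv := e.inv
  hom_inv_id := e.hom_inv_id
  inv_hom_id := e.inv_hom_id

instance : MonoidalCategoryStruct (SesqMod D s) where
  tensorObj := tensor
  tensorHom {V₁ W₁ V₂ W₂} f g :=
    HMod.tensorMap (V := V₁.toHMod) (V' := W₁.toHMod) (W := V₂.toHMod) (W' := W₂.toHMod) f g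
  whiskerLeft V W W' f :=
    HMod.tensorMap (V := V.toHMod) (V' := V.toHMod) (W := W.toHMod) (W' := W'.toHMod) (𝟙 V) f
  whiskerRight {V V'} f W :=
    HMod.tensorMap (V := V.toHMod) (V' := V'.toHMod) (W := W.toHMod) (W' := W.toHMod) f (𝟙 W)
  tensorUnit := unit D s
  associator V W U := mkIso (V := tensor (tensor V W) U) (W := tensor V (tensor W U))
    (MonoidalCategory.associator V.toHMod W.toHMod U.toHMod)
  leftUnitor V := mkIso (V := tensor (unit D s) V) (W := V)
    (MonoidalCategory.leftUnitor V.toHMod)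
  rightUnitor V := mkIso (V := tensor V (unit D s)) (W := V)
    (MonoidalCategory.rightUnitor V.toHMod)

instance : MonoidalCategory (SesqMod D s) :=
  MonoidalCategory.ofTensorHom
    (id_tensorHom_id := fun V W => MonoidalCategory.id_tensorHom_id (C := HMod k H) _ _)
    (id_tensorHom := fun _ _ _ _ => rfl)
    (tensorHom_id := fun _ _ => rfl)
    (tensorHom_comp_tensorHom := fun f₁ f₂ g₁ g₂ =>
      MonoidalCategory.tensorHom_comp_tensorHom (C := HMod k H) f₁ f₂ g₁ g₂)
    (associator_naturality := fun f₁ f₂ f₃ =>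
      MonoidalCategory.associator_naturality (C := HMod k H) f₁ f₂ f₃)
    (leftUnitor_naturality := fun f => HMod.hom_ext
      (TensorProduct.ext' fun (c : k) v => (map_smul (lin f) c v).symm))
    (rightUnitor_naturality := fun f => HMod.hom_ext
      (TensorProduct.ext' fun v (c : k) => (map_smul (lin f) c v).symm))
    (pentagon := fun V W X Y => MonoidalCategory.pentagon (C := HMod k H) _ _ _ _)
    (triangle := fun V W => MonoidalCategory.triangle (C := HMod k H) _ _)

end SesqMod

end SesqModules

/-! ### Sesquilinear pivotal categories -/

section Pivotal

variable (k : Type*) [Field k] (C : Type*) [Category* C] [MonoidalCategory C] [Preadditive C]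
  [Linear k C]

/-- A tensor `k`-category: composition and tensor product are bilinear, and `k ≅ End 𝟙`. -/
structure IsTensorCategoryOver : Prop where
  preadditive : MonoidalPreadditive C
  linear : MonoidalLinear k C
  bijective : Function.Bijective fun a : k => a • 𝟙 (𝟙_ C)

/-- A pivotal structure: each object `V` has the two-sided dual `dual V`, and the two dualities are
compatible, i.e. they induce the same transposes of morphisms and the same isomorphisms
`W* ⊗ V* ≅ (V ⊗ W)*`. -/
structure PivotalStructure (C : Type*) [Category* C] [MonoidalCategory C] (dual : C → C) where
  /-- `coev : 𝟙 ⟶ V ⊗ V*` and `ev : V* ⊗ V ⟶ 𝟙` -/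
  left : ∀ V : C, ExactPairing V (dual V)
  /-- `coev : 𝟙 ⟶ V* ⊗ V` and `ev : V ⊗ V* ⟶ 𝟙` -/
  right : ∀ V : C, ExactPairing (dual V) V
  transpose : ∀ {V W : C} (f : V ⟶ W),
    @rightAdjointMate C _ _ V W (@HasRightDual.mk C _ _ V (dual V) (left V))
        (@HasRightDual.mk C _ _ W (dual W) (left W)) f =
      @leftAdjointMate C _ _ V W (@HasLeftDual.mk C _ _ V (dual V) (right V))
        (@HasLeftDual.mk C _ _ W (dual W) (right W)) f
  dual_tensor : ∀ V W : C,
    (rightDualIso (@ExactPairing.tensor C _ _ V W (dual V) (dual W) (left V) (left W))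
        (left (V ⊗ W))).hom =
      (leftDualIso (@ExactPairing.tensor C _ _ (dual W) (dual V) W V (right W) (right V))
        (right (V ⊗ W))).hom

/-- A not necessarily involutive conjugation: antilinear bijections `Hom(V, W) → Hom(W, V)`
compatible with composition and tensor product; the associativity and unit isomorphisms, which are
identities in a strict category, are unitary. -/
structure Conjugation [StarRing k] where
  dag : ∀ {V W : C}, (V ⟶ W) → (W ⟶ V)
  dag_bijective : ∀ V W : C, Function.Bijective (dag : (V ⟶ W) → (W ⟶ V))
  dag_linear : ∀ {V W : C} (a b : k) (f g : V ⟶ W),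
    dag (a • f + b • g) = star a • dag f + star b • dag g
  dag_tensor : ∀ {V W V' W' : C} (f : V ⟶ W) (g : V' ⟶ W'),
    dag (f ⊗ₘ g) = dag f ⊗ₘ dag g
  dag_comp : ∀ {V W U : C} (f : V ⟶ W) (g : W ⟶ U), dag (f ≫ g) = dag g ≫ dag f
  dag_associator : ∀ V W U : C, dag (α_ V W U).hom = (α_ V W U).inv
  dag_leftUnitor : ∀ V : C, dag (λ_ V).hom = (λ_ V).inv
  dag_rightUnitor : ∀ V : C, dag (ρ_ V).hom = (ρ_ V).inv

/-- A sesquilinear pivotal structure: a pivotal structure and a conjugation that exchanges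
the two dualities. -/
structure SesquilinearPivotalStructure [StarRing k] (dual : C → C) extends
    PivotalStructure C dual, Conjugation k C where
  dag_left_coev : ∀ V : C, dag (left V).coevaluation' = (right V).evaluation'
  dag_left_ev : ∀ V : C, dag (left V).evaluation' = (right V).coevaluation'
  dag_right_coev : ∀ V : C, dag (right V).coevaluation' = (left V).evaluation'
  dag_right_ev : ∀ V : C, dag (right V).evaluation' = (left V).coevaluation'

end Pivotal

/-! ### The duality maps and the braiding of sesquilinear modules -/

section Duality

variable {k : Type u} {H : Type w} [Field k] [Ring H] [Algebra k H] [Coalgebra k H]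
  [SuperSpace k H] [HopfSuperalgebra k H]

/-- The map `1 ↦ ∑ vᵢ ⊗ vᵢ*`. -/
def HMod.leftCoev (V : HMod k H) : k →ₗ[k] V.carrier ⊗[k] Module.Dual k V.carrier :=
  coevaluation k V.carrier

/-- The map `f ⊗ v ↦ f v`. -/
def HMod.leftEv (V : HMod k H) : Module.Dual k V.carrier ⊗[k] V.carrier →ₗ[k] k :=
  contractLeft k V.carrier

/-- The map `1 ↦ ∑ (-1) ^ |vᵢ| vᵢ* ⊗ g⁻¹ vᵢ`. -/
def HMod.rightCoev (ℛ : RibbonStructure k H) (V : HMod k H) :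
    k →ₗ[k] Module.Dual k V.carrier ⊗[k] V.carrier :=
  (V.act (Ring.inverse ℛ.pivot)).lTensor (Module.Dual k V.carrier) ∘ₗ
    superFlip k V.carrier (Module.Dual k V.carrier) ∘ₗ coevaluation k V.carrier

/-- The map `v ⊗ f ↦ (-1) ^ (|f| |v|) f (g v)`. -/
def HMod.rightEv (ℛ : RibbonStructure k H) (V : HMod k H) :
    V.carrier ⊗[k] Module.Dual k V.carrier →ₗ[k] k :=
  contractLeft k V.carrier ∘ₗ (V.act ℛ.pivot).lTensor (Module.Dual k V.carrier) ∘ₗ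
    superFlip k V.carrier (Module.Dual k V.carrier)

variable [StarRing k] {ℛ : RibbonStructure k H} {D : Dagger ℛ} {s : ℛ.HalfTwist}

/-- The braiding `v ⊗ w ↦ τ (R (v ⊗ w))` of sesquilinear modules. -/
def SesqMod.braid (V W : SesqMod D s) : V ⊗ W ≅ W ⊗ V :=
  SesqMod.mkIso (V := SesqMod.tensor V W) (W := SesqMod.tensor W V)
    (ℛ.braid V.toHMod W.toHMod)

end Duality

end SuperHopf

end

open SuperHopf

/-! Everything rests on the isomorphism `X`. It is natural, since both the braiding and the half
twist are. It squares to the identity, because `τ(R) R Δ(θ) = θ ⊗ θ` says that the twist is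
balanced: the double braiding is exactly what the twist of `V ⊗ W` has beyond the twists of `V` and
`W`. It satisfies the cactus relation, because both composites reverse three strands and carry the
same half twists. It is trivial when one factor is the unit. Thus `X` makes the module category a
coboundary category, and the form on `V ⊗ W` is the strictly associative form `(·|·)_p` corrected by
`τ X`. Adjoints exist and are unique by non-degeneracy. Naturality of `X` gives `(f ⊗ g)† = f† ⊗ g†`
(`adjoint_tensorHom`), the cactus relation makes the associator unitary (`adjoint_associator`), and
triviality on the unit makes the unitors unitary. The braiding is unitary because it commutes with
`X` and `(† ⊗ †) R = τ(R⁻¹)` (`adjoint_braid`).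

The left duality is the usual one for vector spaces; its `H`-linearity is the antipode axiom. The
right duality is taken to be the conjugate of the left one, which gives the zigzag identities and
two of the four adjunction identities at once. It remains to recognise it. The adjoint of the
coevaluation is `ev ∘ X`. Since the half twist is compatible with duals and trivial on the unit,
this equals `ev ∘ c ∘ (θ_V ⊗ 1)`, and the definition of the Drinfeld element turns it into `v ⊗ f ↦
± f(u θ⁻¹ v) = ± f(g v)` (`lin_X_comp_ev`). The right coevaluation is then forced by a zigzag
identity. That conjugating again returns the left duality follows from `g† = g⁻¹` and `X² = 1`.

For the pivotal axioms, conjugation always carries left-dual transposes to right-dual ones, so it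
suffices that adjoints commute with transposes and that `W* ⊗ V* ≅ (V ⊗ W)*` is unitary. The first
is immediate from the form on the dual. The second says that `X` on duals is the transpose of `X`
(`X_comp_dualTensor`), which needs `(S ⊗ S) R = R` and the compatibility of the half twist with
duals. -/

namespace SuperHopf

/-! ### Braidings corrected by a half twist, in an arbitrary braided category -/

section HalfBraiding

open BraidedCategory ExactPairing

variable {C : Type*} [Category* C] [MonoidalCategory C] [BraidedCategory C] (t : 𝟭 C ≅ 𝟭 C)

/-- The braiding twisted by an automorphism of the identity functor. -/
def halfBraid (V W : C) : V ⊗ W ≅ W ⊗ V :=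
  (t.app V ⊗ᵢ t.app W) ≪≫ β_ V W ≪≫ (t.app (W ⊗ V)).symm

/-- The component of an automorphism of the identity functor. -/
abbrev tw (V : C) : V ⟶ V := t.hom.app V

/-- The inverse of the component of an automorphism of the identity functor. -/
abbrev twInv (V : C) : V ⟶ V := t.inv.app V

theorem tw_naturality {V W : C} (f : V ⟶ W) : f ≫ tw t W = tw t V ≫ f := t.hom.naturality f

theorem twInv_naturality {V W : C} (f : V ⟶ W) : f ≫ twInv t W = twInv t V ≫ f :=
  t.inv.naturality f

theorem twInv_naturality_assoc {V W U : C} (f : V ⟶ W) (g : W ⟶ U) :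
    f ≫ twInv t W ≫ g = twInv t V ≫ f ≫ g := by
  rw [← Category.assoc, twInv_naturality, Category.assoc]

theorem tw_twInv (V : C) : tw t V ≫ twInv t V = 𝟙 V := t.hom_inv_id_app V

theorem tw_twInv_assoc {V W : C} (f : V ⟶ W) : tw t V ≫ twInv t V ≫ f = f := by
  rw [← Category.assoc, tw_twInv, Category.id_comp]

theorem twInv_tw (V : C) : twInv t V ≫ tw t V = 𝟙 V := t.inv_hom_id_app V

theorem halfBraid_hom (V W : C) : (halfBraid t V W).hom =
    (tw t V ⊗ₘ tw t W) ≫ (β_ V W).hom ≫ twInv t (W ⊗ V) := rfl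

theorem halfBraid_naturality {V W V' W' : C} (f : V ⟶ V') (g : W ⟶ W') :
    (f ⊗ₘ g) ≫ (halfBraid t V' W').hom = (halfBraid t V W).hom ≫ (g ⊗ₘ f) := by
  simp only [halfBraid_hom, Category.assoc]
  rw [← twInv_naturality, ← braiding_naturality_assoc, tensorHom_comp_tensorHom_assoc,
    tensorHom_comp_tensorHom_assoc, tw_naturality, tw_naturality]

theorem halfBraid_comp_braiding_inv (V W : C) :
    (halfBraid t W V).hom ≫ (β_ W V).inv = (β_ V W).inv ≫ (halfBraid t V W).hom := by
  simp only [halfBraid_hom, Category.assoc]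
  rw [← braiding_inv_naturality_assoc, Iso.inv_hom_id_assoc, ← twInv_naturality,
    Iso.hom_inv_id_assoc]

/-- The hypothesis says that `t²` is a balanced twist. By naturality all half twists can be moved to
the ends, and what is left is the double braiding between `t_V² ⊗ t_W²` and `t⁻²` on the product. -/
theorem halfBraid_symm (V W : C)
    (h : tw t (V ⊗ W) ≫ tw t (V ⊗ W) =
      (tw t V ⊗ₘ tw t W) ≫ (tw t V ⊗ₘ tw t W) ≫ (β_ V W).hom ≫ (β_ W V).hom) :
    (halfBraid t V W).hom ≫ (halfBraid t W V).hom = 𝟙 (V ⊗ W) := by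
  have e : (halfBraid t V W).hom ≫ (halfBraid t W V).hom =
      ((tw t V ⊗ₘ tw t W) ≫ (tw t V ⊗ₘ tw t W) ≫ (β_ V W).hom ≫ (β_ W V).hom) ≫
        twInv t (V ⊗ W) ≫ twInv t (V ⊗ W) := by
    simp only [halfBraid_hom, Category.assoc]
    rw [← twInv_naturality_assoc, ← twInv_naturality_assoc, ← braiding_naturality_assoc]
  rw [e, ← h, Category.assoc, tw_twInv_assoc, tw_twInv]

/-- The Yang–Baxter relation for the reversal of three strands, in the bracketing needed for the
cactus relation: naturality of the braiding followed by both hexagons. -/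
theorem braiding_whiskerRight_braiding (V W U : C) :
    (β_ V W).hom ▷ U ≫ (β_ (W ⊗ V) U).hom =
      (α_ V W U).hom ≫ V ◁ (β_ W U).hom ≫ (β_ V (U ⊗ W)).hom ≫ (α_ U W V).hom := by
  rw [braiding_naturality_left, braiding_tensor_left_hom, braiding_tensor_right_hom]
  simp only [Category.assoc, Iso.inv_hom_id, Category.comp_id]

/-- The factor `t⁻¹` that ends the inner half-braiding cancels the `t` that the outer one puts on `W
⊗ V`. Only one `t` per strand and a single `t⁻¹` on the whole product survive. -/
theorem halfBraid_whiskerRight_halfBraid (V W U : C) :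
    (halfBraid t V W).hom ▷ U ≫ (halfBraid t (W ⊗ V) U).hom =
      (tw t V ⊗ₘ tw t W) ▷ U ≫ (V ⊗ W) ◁ tw t U ≫ (β_ V W).hom ▷ U ≫ (β_ (W ⊗ V) U).hom ≫
        twInv t _ := by
  have e : twInv t (W ⊗ V) ▷ U ≫ tw t (W ⊗ V) ▷ U = 𝟙 _ := by
    rw [← comp_whiskerRight]
    exact (congrArg (· ▷ U) (twInv_tw t _)).trans (id_whiskerRight _ _)
  rw [halfBraid_hom, halfBraid_hom, MonoidalCategory.tensorHom_def (tw t (W ⊗ V)),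
    whisker_exchange_assoc, comp_whiskerRight, comp_whiskerRight, Category.assoc, Category.assoc,
    Category.assoc, reassoc_of% e]

theorem halfBraid_whiskerLeft_halfBraid (V W U : C) :
    V ◁ (halfBraid t W U).hom ≫ (halfBraid t V (U ⊗ W)).hom =
      tw t V ▷ (W ⊗ U) ≫ V ◁ (tw t W ⊗ₘ tw t U) ≫ V ◁ (β_ W U).hom ≫ (β_ V (U ⊗ W)).hom ≫
        twInv t _ := by
  have e : V ◁ twInv t (U ⊗ W) ≫ V ◁ tw t (U ⊗ W) = 𝟙 _ := by
    rw [← MonoidalCategory.whiskerLeft_comp]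
    exact (congrArg (V ◁ ·) (twInv_tw t _)).trans (MonoidalCategory.whiskerLeft_id _ _)
  rw [halfBraid_hom, halfBraid_hom, MonoidalCategory.tensorHom_def' (tw t V),
    ← whisker_exchange_assoc, MonoidalCategory.whiskerLeft_comp,
    MonoidalCategory.whiskerLeft_comp, Category.assoc, Category.assoc,
    Category.assoc, reassoc_of% e, whisker_exchange_assoc]

/-- Naturality moves the inner half-braiding in front of the outer one on both sides. Each side is
then the full reversal of three strands, with `t` on every strand and `t⁻¹` on the product, so
Yang–Baxter finishes. -/
theorem halfBraid_cactus (V W U : C) :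
    (halfBraid t (V ⊗ W) U).hom ≫ U ◁ (halfBraid t V W).hom =
      (α_ V W U).hom ≫ (halfBraid t V (W ⊗ U)).hom ≫ (halfBraid t W U).hom ▷ V ≫
        (α_ U W V).hom := by
  have h1 := halfBraid_naturality t (halfBraid t V W).hom (𝟙 U)
  have h2 := halfBraid_naturality t (𝟙 V) (halfBraid t W U).hom
  rw [tensorHom_id, id_tensorHom] at h1 h2
  rw [← h1, halfBraid_whiskerRight_halfBraid, ← Category.assoc (halfBraid t V _).hom, ← h2,
    halfBraid_whiskerLeft_halfBraid]
  simp only [Category.assoc]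
  rw [← twInv_naturality, reassoc_of% braiding_whiskerRight_braiding V W U]
  simp [MonoidalCategory.tensorHom_def]

theorem halfBraid_tensorUnit_left (V : C) (h : tw t (𝟙_ C) = 𝟙 (𝟙_ C)) :
    (halfBraid t (𝟙_ C) V).hom = (λ_ V).hom ≫ (ρ_ V).inv := by
  rw [halfBraid_hom, h, id_tensorHom, braiding_naturality_right_assoc, braiding_tensorUnit_left,
    Category.assoc, ← rightUnitor_inv_naturality_assoc, twInv_naturality, tw_twInv_assoc]

theorem halfBraid_tensorUnit_right (V : C) (h : tw t (𝟙_ C) = 𝟙 (𝟙_ C)) :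
    (halfBraid t V (𝟙_ C)).hom = (ρ_ V).hom ≫ (λ_ V).inv := by
  rw [halfBraid_hom, h, tensorHom_id, braiding_naturality_left_assoc, braiding_tensorUnit_right,
    Category.assoc, ← leftUnitor_inv_naturality_assoc, twInv_naturality, tw_twInv_assoc]

/-- The factor `t⁻¹` on the product moves through `e` to the unit, where it is trivial. The `t` on
`V'` slides along `e` to the other leg, so `V` receives `t` twice: the half twists become a full
twist. -/
theorem halfBraid_comp_evaluation {V V' : C} (e : V' ⊗ V ⟶ 𝟙_ C) (h : tw t (𝟙_ C) = 𝟙 (𝟙_ C))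
    (he : tw t V' ▷ V ≫ e = V' ◁ tw t V ≫ e) :
    (halfBraid t V V').hom ≫ e = (tw t V ≫ tw t V) ▷ V' ≫ (β_ V V').hom ≫ e := by
  have h' : twInv t (𝟙_ C) = 𝟙 (𝟙_ C) := by
    rw [← tw_twInv t (𝟙_ C), h, Category.id_comp]
  rw [halfBraid_hom, Category.assoc, Category.assoc, ← twInv_naturality, h', Category.comp_id,
    comp_whiskerRight, Category.assoc, braiding_naturality_left_assoc, ← he,
    ← braiding_naturality_right_assoc, MonoidalCategory.tensorHom_def, Category.assoc]

end HalfBraiding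

end SuperHopf

namespace SuperHopf

/-! ### Counit and antipode identities for the R-matrix -/

section RMatrix

variable {k : Type*} {H : Type*} [Field k] [Ring H] [Algebra k H] [Coalgebra k H]
  [SuperSpace k H] [HopfSuperalgebra k H]

/-- To prove an additive property of all even tensors it suffices to treat tensors of homogeneous
vectors of the same parity. -/
@[elab_as_elim]
theorem even_tensor_induction {V W : Type*} [AddCommGroup V] [Module k V] [AddCommGroup W]
    [Module k W] [SuperSpace k V] [SuperSpace k W] {p : V ⊗[k] W → Prop} (hzero : p 0)
    (hadd : ∀ a b, p a → p b → p (a + b))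
    (hom : ∀ i, ∀ v ∈ gr k i, ∀ w ∈ gr k i, p (v ⊗ₜ w)) (x : V ⊗[k] W)
    (hx : x ∈ gr k (V := V ⊗[k] W) 0) : p x := by
  refine Submodule.iSup_induction _ (motive := p) hx (fun i x hx => ?_) hzero hadd
  have hi : 0 - i = i := by rcases zmod2_cases i with rfl | rfl <;> rfl
  rw [hi, Submodule.map₂_eq_span_image2] at hx
  suffices h : ∀ c : k, p (c • x) by simpa using h 1
  induction hx using Submodule.span_induction with
  | mem y hy =>
    obtain ⟨v, hv, w, hw, rfl⟩ := hy
    intro c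
    exact hom i (c • v) (Submodule.smul_mem _ c hv) w hw
  | zero => simpa using hzero
  | add y z _ _ hy hz => intro c; rw [smul_add]; exact hadd _ _ (hy c) (hz c)
  | smul a y _ hy => intro c; rw [smul_smul]; exact hy _

/-- The product of the tensor product of `H` and its opposite, without signs. -/
def opMul₂ (k H : Type*) [Field k] [Ring H] [Algebra k H] :
    H ⊗[k] H →ₗ[k] H ⊗[k] H →ₗ[k] H ⊗[k] H :=
  plainTensor (LinearMap.mul k H) (LinearMap.mul k H).flip

theorem opMul₂_tmul (a b c d : H) :
    opMul₂ k H (a ⊗ₜ b) (c ⊗ₜ d) = (a * c) ⊗ₜ (d * b) := rfl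

theorem opMul₂_assoc (x y z : H ⊗[k] H) :
    opMul₂ k H (opMul₂ k H x y) z = opMul₂ k H x (opMul₂ k H y z) := by
  induction x with
  | zero => simp
  | add a b ha hb => simp only [map_add, LinearMap.add_apply, ha, hb]
  | tmul a b =>
  induction y with
  | zero => simp
  | add a b ha hb => simp only [map_add, LinearMap.add_apply, ha, hb]
  | tmul c d =>
  induction z with
  | zero => simp
  | add a b ha hb => simp only [map_add, ha, hb]
  | tmul e f => simp only [opMul₂_tmul, mul_assoc]

theorem opMul₂_one (x : H ⊗[k] H) : opMul₂ k H x (1 ⊗ₜ 1) = x := by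
  induction x with
  | zero => simp
  | add a b ha hb => simp only [map_add, LinearMap.add_apply, ha, hb]
  | tmul a b => simp only [opMul₂_tmul, mul_one, one_mul]

theorem one_opMul₂ (x : H ⊗[k] H) : opMul₂ k H (1 ⊗ₜ 1) x = x := by
  induction x with
  | zero => simp
  | add a b ha hb => simp only [map_add, ha, hb]
  | tmul a b => simp only [opMul₂_tmul, mul_one, one_mul]

theorem mul₂_one (x : H ⊗[k] H) : mul₂ k H x (1 ⊗ₜ 1) = x := by
  rw [mul₂_one_tmul]; simp

theorem one_mul₂ (x : H ⊗[k] H) : mul₂ k H (1 ⊗ₜ 1) x = x := by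
  refine homog_tensor_induction (by simp) (fun a b ha hb => by simp only [map_add, ha, hb]) ?_ x
  intro i j a ha b hb
  rw [mul₂_tmul _ _ one_mem_gr ha]
  simp

/-- The Koszul sign of the graded product compares the second leg of `x` with the first leg of `y`,
that of the antipode compares it with the second leg of `y`. For even `y` these legs have equal
parity and the signs cancel, so `1 ⊗ S` lands in the ungraded `H ⊗ Hᵒᵖ`. -/
theorem lTensor_antipode_mul₂ (x : H ⊗[k] H) {y : H ⊗[k] H}
    (hy : y ∈ gr k (V := H ⊗[k] H) 0) : (antipode k H).lTensor H (mul₂ k H x y) =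
      opMul₂ k H ((antipode k H).lTensor H x) ((antipode k H).lTensor H y) := by
  refine even_tensor_induction (by simp) (fun a b ha hb => by simp only [map_add, ha, hb]) ?_ y hy
  intro i c hc d hd
  refine homog_tensor_induction (by simp) (fun a b ha hb => by
    simp only [map_add, LinearMap.add_apply, ha, hb]) ?_ x
  intro p q a ha b hb
  rw [mul₂_tmul a d hb hc, map_smul, LinearMap.lTensor_tmul, antipode_mul hb hd, tmul_smul,
    smul_smul, koszulSign_mul_self, one_smul]
  rfl

/-- `x₁₃ y₂₃` -/
theorem mul₃_left_tmul {i j : ZMod 2} (a : H) {b c : H} (d : H) (hb : b ∈ gr k i)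
    (hc : c ∈ gr k j) : mul₃ k H ((a ⊗ₜ 1) ⊗ₜ b) ((1 ⊗ₜ c) ⊗ₜ d) =
      koszulSign k i j • ((a ⊗ₜ c) ⊗ₜ (b * d)) := by
  have h : (1 : H) ⊗ₜ[k] c ∈ gr k (V := H ⊗[k] H) j :=
    tmul_mem_tensorGr one_mem_gr hc (zero_add j)
  refine (superTensor_tmul (mul₂ k H) (LinearMap.mul k H) _ _ hb h).trans ?_
  rw [mul₂_tmul _ _ one_mem_gr one_mem_gr]
  simp

/-- `x₁₃ y₁₂` -/
theorem mul₃_right_tmul {i p q : ZMod 2} (a : H) {b c d : H} (hb : b ∈ gr k i)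
    (hc : c ∈ gr k p) (hd : d ∈ gr k q) : mul₃ k H ((a ⊗ₜ 1) ⊗ₜ b) ((c ⊗ₜ d) ⊗ₜ 1) =
      koszulSign k i (p + q) • (((a * c) ⊗ₜ d) ⊗ₜ b) := by
  have h : c ⊗ₜ[k] d ∈ gr k (V := H ⊗[k] H) (p + q) := tmul_mem_tensorGr hc hd rfl
  refine (superTensor_tmul (mul₂ k H) (LinearMap.mul k H) _ _ hb h).trans ?_
  rw [mul₂_tmul _ _ one_mem_gr hc]
  simp

end RMatrix

namespace RibbonStructure

variable {k : Type u} {H : Type w} [Field k] [Ring H] [Algebra k H] [Coalgebra k H]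
  [SuperSpace k H] [HopfSuperalgebra k H] (ℛ : RibbonStructure k H)

theorem mul₂_left_cancel {x y : H ⊗[k] H} (h : mul₂ k H x ℛ.R = y) :
    x = mul₂ k H y ℛ.Rinv := by
  rw [← h, mul₂_assoc, ℛ.R_mul_Rinv, mul₂_one]

/-- The counit on the first leg of `(Δ ⊗ 1) R = R₁₃ R₂₃` gives `R = (1 ⊗ a) R` with `a` the
contraction of `R`; invertibility of `R` forces `a = 1`. -/
theorem counit_rTensor_R : (counit k H).rTensor H ℛ.R = 1 ⊗ₜ 1 := by
  let E : (H ⊗[k] H) ⊗[k] H →ₗ[k] H ⊗[k] H :=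
    (TensorProduct.lid k H ∘ₗ (counit k H).rTensor H).rTensor H
  have h1 : ∀ y : H ⊗[k] H, E ((comul k H).rTensor H y) = y := by
    intro y
    simp only [E]
    rw [← LinearMap.comp_apply, ← LinearMap.rTensor_comp, LinearMap.comp_assoc,
      Coalgebra.rTensor_counit_comp_comul]
    have : (TensorProduct.lid k H).toLinearMap ∘ₗ (TensorProduct.mk k k H) 1 = LinearMap.id := by
      ext; simp
    rw [this, LinearMap.rTensor_id, LinearMap.id_apply]
  have h2 : ∀ x y : H ⊗[k] H, E (mul₃ k H
      ((TensorProduct.assoc k H H H).symm ((TensorProduct.mk k H H 1).lTensor H x))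
      ((TensorProduct.assoc k H H H).symm (1 ⊗ₜ y))) =
      mul₂ k H (1 ⊗ₜ TensorProduct.lid k H ((counit k H).rTensor H x)) y := by
    intro x y
    refine homog_tensor_induction (by simp) (fun a b ha hb => by
      simp only [map_add, LinearMap.add_apply, tmul_add, ha, hb]) ?_ x
    intro i j a ha b hb
    refine homog_tensor_induction (by simp) (fun a b ha hb => by
      simp only [map_add, tmul_add, ha, hb]) ?_ y
    intro p q c hc d hd
    simp only [LinearMap.lTensor_tmul, TensorProduct.mk_apply, TensorProduct.assoc_symm_tmul,
      LinearMap.rTensor_tmul, TensorProduct.lid_tmul]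
    rw [mul₃_left_tmul a d hb hc, mul₂_tmul _ _ (Submodule.smul_mem _ _ hb) hc]
    simp [E, smul_tmul', smul_smul]
  have h3 := h2 ℛ.R ℛ.R
  rw [← ℛ.comul_rTensor_R, h1] at h3
  have h4 := ℛ.mul₂_left_cancel h3.symm
  rw [ℛ.R_mul_Rinv] at h4
  -- `h4` only reads `1 ⊗ 1 = 1 ⊗ a`, up to order; a second counit on the first leg extracts `a`.
  have h5 := congrArg (fun z => TensorProduct.lid k H ((counit k H).rTensor H z)) h4
  simp only [LinearMap.rTensor_tmul, TensorProduct.lid_tmul, HopfSuperalgebra.counit_one,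
    one_smul] at h5
  rw [← (TensorProduct.lid k H).injective.eq_iff, h5]
  simp

theorem counit_lTensor_R : (counit k H).lTensor H ℛ.R = 1 ⊗ₜ 1 := by
  let E : (H ⊗[k] H) ⊗[k] H →ₗ[k] H ⊗[k] H :=
    TensorProduct.rid k (H ⊗[k] H) ∘ₗ (counit k H).lTensor (H ⊗[k] H)
  have h1 : ∀ y : H ⊗[k] H, E ((TensorProduct.assoc k H H H).symm ((comul k H).lTensor H y)) =
      y := by
    have h0 : ∀ (a : H) (z : H ⊗[k] H), E ((TensorProduct.assoc k H H H).symm (a ⊗ₜ z)) =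
        a ⊗ₜ TensorProduct.rid k H ((counit k H).lTensor H z) := by
      intro a z
      induction z with
      | zero => simp
      | add b c hb hc => simp only [tmul_add, map_add, hb, hc]
      | tmul b c => simp [E]
    intro y
    induction y with
    | zero => simp
    | add a b ha hb => simp only [map_add, ha, hb]
    | tmul a b =>
      rw [LinearMap.lTensor_tmul, h0, Coalgebra.lTensor_counit_comul]
      simp
  have h2 : ∀ x y : H ⊗[k] H, E (mul₃ k H
      ((TensorProduct.assoc k H H H).symm ((TensorProduct.mk k H H 1).lTensor H x)) (y ⊗ₜ 1)) =
      mul₂ k H (TensorProduct.rid k H ((counit k H).lTensor H x) ⊗ₜ 1) y := by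
    intro x y
    refine homog_tensor_induction (by simp) (fun a b ha hb => by
      simp only [map_add, LinearMap.add_apply, add_tmul, ha, hb]) ?_ x
    intro i j a ha b hb
    refine homog_tensor_induction (by simp) (fun a b ha hb => by
      simp only [map_add, add_tmul, ha, hb]) ?_ y
    intro p q c hc d hd
    simp only [LinearMap.lTensor_tmul, TensorProduct.mk_apply, TensorProduct.assoc_symm_tmul,
      TensorProduct.rid_tmul]
    rw [mul₃_right_tmul a hb hc hd, mul₂_tmul _ _ one_mem_gr hc]
    -- A sign can occur only for odd `b`, and there the counit vanishes.
    rcases zmod2_cases j with rfl | rfl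
    · simp [E, smul_tmul']
    · simp [E, HopfSuperalgebra.counit_odd b hb]
  have h3 := h2 ℛ.R ℛ.R
  rw [← ℛ.comul_lTensor_R, h1] at h3
  have h4 := ℛ.mul₂_left_cancel h3.symm
  rw [ℛ.R_mul_Rinv] at h4
  have h5 := congrArg (fun z => TensorProduct.rid k H ((counit k H).lTensor H z)) h4
  simp only [LinearMap.lTensor_tmul, TensorProduct.rid_tmul, HopfSuperalgebra.counit_one,
    one_smul] at h5
  rw [← (TensorProduct.rid k H).injective.eq_iff, h5]
  simp

/-- `(S ⊗ 1) R = R⁻¹` -/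
theorem antipode_rTensor_R : (antipode k H).rTensor H ℛ.R = ℛ.Rinv := by
  let E : (H ⊗[k] H) ⊗[k] H →ₗ[k] H ⊗[k] H :=
    (LinearMap.mul' k H ∘ₗ (antipode k H).rTensor H).rTensor H
  have h1 : ∀ y : H ⊗[k] H, E ((comul k H).rTensor H y) =
      (Algebra.linearMap k H).rTensor H ((counit k H).rTensor H y) := by
    intro y
    simp only [E]
    rw [← LinearMap.comp_apply, ← LinearMap.rTensor_comp, LinearMap.comp_assoc,
      HopfSuperalgebra.mul_antipode_rTensor_comul, LinearMap.rTensor_comp, LinearMap.comp_apply]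
  have h2 : ∀ x y : H ⊗[k] H, E (mul₃ k H
      ((TensorProduct.assoc k H H H).symm ((TensorProduct.mk k H H 1).lTensor H x))
      ((TensorProduct.assoc k H H H).symm (1 ⊗ₜ y))) =
      mul₂ k H ((antipode k H).rTensor H x) y := by
    intro x y
    refine homog_tensor_induction (by simp) (fun a b ha hb => by
      simp only [map_add, LinearMap.add_apply, ha, hb]) ?_ x
    intro i j a ha b hb
    refine homog_tensor_induction (by simp) (fun a b ha hb => by
      simp only [map_add, tmul_add, ha, hb]) ?_ y
    intro p q c hc d hd
    simp only [LinearMap.lTensor_tmul, TensorProduct.mk_apply, TensorProduct.assoc_symm_tmul,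
      LinearMap.rTensor_tmul]
    rw [mul₃_left_tmul a d hb hc, mul₂_tmul _ _ hb hc]
    simp [E]
  -- Contracting the first two legs of `(Δ ⊗ 1) R = R₁₃ R₂₃` with `m (S ⊗ 1)` yields `1 = (S ⊗ 1)R ·
  -- R`; cancelling `R` on the right identifies the inverse.
  have h3 := h2 ℛ.R ℛ.R
  rw [← ℛ.comul_rTensor_R, h1, ℛ.counit_rTensor_R] at h3
  have h4 := ℛ.mul₂_left_cancel h3.symm
  rw [h4]
  simp [one_mul₂]

/-- `(1 ⊗ S) R⁻¹ = R` -/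
theorem antipode_lTensor_Rinv : (antipode k H).lTensor H ℛ.Rinv = ℛ.R := by
  let E : (H ⊗[k] H) ⊗[k] H →ₗ[k] H ⊗[k] H :=
    (LinearMap.mul' k H ∘ₗ (antipode k H).lTensor H).lTensor H ∘ₗ TensorProduct.assoc k H H H
  have h1 : ∀ y : H ⊗[k] H, E ((TensorProduct.assoc k H H H).symm ((comul k H).lTensor H y)) =
      (Algebra.linearMap k H).lTensor H ((counit k H).lTensor H y) := by
    intro y
    simp only [E]
    rw [LinearMap.comp_apply, LinearEquiv.coe_coe, LinearEquiv.apply_symm_apply,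
      ← LinearMap.comp_apply, ← LinearMap.lTensor_comp, LinearMap.comp_assoc,
      HopfSuperalgebra.mul_antipode_lTensor_comul, LinearMap.lTensor_comp, LinearMap.comp_apply]
  have h2 : ∀ x y : H ⊗[k] H, y ∈ gr k (V := H ⊗[k] H) 0 → E (mul₃ k H
      ((TensorProduct.assoc k H H H).symm ((TensorProduct.mk k H H 1).lTensor H x)) (y ⊗ₜ 1)) =
      opMul₂ k H ((antipode k H).lTensor H x) y := by
    intro x y hy
    refine homog_tensor_induction (by simp) (fun a b ha hb => by
      simp only [map_add, LinearMap.add_apply, ha, hb]) ?_ x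
    intro i j a ha b hb
    refine even_tensor_induction (by simp) (fun a b ha hb => by
      simp only [map_add, add_tmul, ha, hb]) ?_ y hy
    intro p c hc d hd
    simp only [LinearMap.lTensor_tmul, TensorProduct.mk_apply, TensorProduct.assoc_symm_tmul]
    rw [mul₃_right_tmul a hb hc hd, opMul₂_tmul, CharTwo.add_self_eq_zero]
    simp [E]
  have h3 := h2 ℛ.R ℛ.R ℛ.R_even
  rw [← ℛ.comul_lTensor_R, h1, ℛ.counit_lTensor_R] at h3
  have h4 := lTensor_antipode_mul₂ ℛ.Rinv ℛ.R_even
  rw [ℛ.Rinv_mul_R] at h4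
  -- In `H ⊗ Hᵒᵖ` the element `(1 ⊗ S)R` has the left inverse `(1 ⊗ S)R⁻¹` (by `h4`) and the right
  -- inverse `R` (by `h3`), so the two coincide.
  have h5 := opMul₂_assoc ((antipode k H).lTensor H ℛ.Rinv) ((antipode k H).lTensor H ℛ.R) ℛ.R
  rw [← h4, ← h3] at h5
  simpa [antipode_one, one_opMul₂, opMul₂_one] using h5.symm

/-- `(S ⊗ S) R = R` -/
theorem map_antipode_R : TensorProduct.map (antipode k H) (antipode k H) ℛ.R = ℛ.R := by
  rw [← LinearMap.lTensor_comp_rTensor, LinearMap.comp_apply, ℛ.antipode_rTensor_R,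
    ℛ.antipode_lTensor_Rinv]

end RibbonStructure

end SuperHopf

noncomputable section

namespace SuperHopf

/-! ### The hexagons and the braided category of modules -/

section Sign

variable (k : Type*) [Field k]

/-- The sign `(-1) ^ i` of a parity. -/
def paritySign (i : ZMod 2) : k := koszulSign k i 1

theorem paritySign_mul (i j : ZMod 2) :
    paritySign k i * paritySign k j = paritySign k (i + j) :=
  (koszulSign_add_left i j 1).symm

/-- With every sign written as `(-1)` to a polynomial over `ℤ/2`, a sign identity becomes an
equality of polynomial functions that `decide` can check. -/
theorem koszulSign_eq_paritySign (i j : ZMod 2) : koszulSign k i j = paritySign k (i * j) := by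
  rcases zmod2_cases i with rfl | rfl
  · rw [zero_mul]; simp [paritySign]
  · rw [one_mul, koszulSign_comm]; rfl

end Sign

section ThreeFold

variable {k : Type*} {H : Type*} [Field k] [Ring H] [Algebra k H] [Coalgebra k H]
  [SuperSpace k H] [HopfSuperalgebra k H]
variable {V W U : Type*} [AddCommGroup V] [Module k V] [AddCommGroup W] [Module k W]
  [AddCommGroup U] [Module k U] [SuperSpace k V] [SuperSpace k W] [SuperSpace k U]

@[elab_as_elim]
theorem homog_threefold_induction {p : (V ⊗[k] W) ⊗[k] U → Prop} (hzero : p 0)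
    (hadd : ∀ a b, p a → p b → p (a + b))
    (hom : ∀ i j l, ∀ v ∈ gr k i, ∀ w ∈ gr k j, ∀ u ∈ gr k l, p ((v ⊗ₜ w) ⊗ₜ u))
    (x : (V ⊗[k] W) ⊗[k] U) : p x := by
  induction x with
  | zero => exact hzero
  | add a b ha hb => exact hadd _ _ ha hb
  | tmul z u =>
    refine homog_induction k (fun a b ha hb => by rw [tmul_add]; exact hadd _ _ ha hb) ?_ u
    intro l u hu
    refine homog_tensor_induction (by rw [zero_tmul]; exact hzero)
      (fun a b ha hb => by rw [add_tmul]; exact hadd _ _ ha hb) ?_ z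
    intro i j v hv w hw
    exact hom i j l v hv w hw u hu

variable (ρ : H →ₐ[k] Module.End k V) (ρ' : H →ₐ[k] Module.End k W)
  (ρ'' : H →ₐ[k] Module.End k U)

/-- The action of `(H ⊗ H) ⊗ H` on `(V ⊗ W) ⊗ U`. -/
def act₃ : (H ⊗[k] H) ⊗[k] H →ₗ[k] Module.End k ((V ⊗[k] W) ⊗[k] U) :=
  superTensor (act₂ ρ ρ') ρ''.toLinearMap

variable {ρ ρ' ρ''}

theorem act₃_tmul {i j : ZMod 2} (x : H ⊗[k] H) {c : H} {z : V ⊗[k] W} (u : U)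
    (hc : c ∈ gr k i) (hz : z ∈ gr k (V := V ⊗[k] W) j) :
    act₃ ρ ρ' ρ'' (x ⊗ₜ c) (z ⊗ₜ u) = koszulSign k i j • (act₂ ρ ρ' x z ⊗ₜ ρ'' c u) :=
  superTensor_tmul (act₂ ρ ρ') ρ''.toLinearMap x u hc hz

theorem act₃_mul (hρ : IsGradedAct ρ) (hρ' : IsGradedAct ρ') (x y : (H ⊗[k] H) ⊗[k] H) :
    act₃ ρ ρ' ρ'' (mul₃ k H x y) = act₃ ρ ρ' ρ'' x * act₃ ρ ρ' ρ'' y := by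
  refine homog_threefold_induction (by simp) (fun a b ha hb => by
    simp only [map_add, LinearMap.add_apply, ha, hb, add_mul]) ?_ x
  intro i j l a ha b hb c hc
  refine homog_threefold_induction (by simp) (fun a b ha hb => by
    simp only [map_add, ha, hb, mul_add]) ?_ y
  intro i' j' l' a' ha' b' hb' c' hc'
  refine LinearMap.ext fun t => ?_
  refine homog_threefold_induction (by simp) (fun a b ha hb => by simp only [map_add, ha, hb]) ?_ t
  intro p q r v hv w hw u hu
  have hab' := tmul_mem_tensorGr (k := k) ha' hb' rfl
  have hvw := tmul_mem_tensorGr (k := k) hv hw rfl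
  have e : mul₃ k H ((a ⊗ₜ b) ⊗ₜ c) ((a' ⊗ₜ b') ⊗ₜ c') =
      koszulSign k l (i' + j') • (mul₂ k H (a ⊗ₜ b) (a' ⊗ₜ b') ⊗ₜ (c * c')) :=
    superTensor_tmul (mul₂ k H) (LinearMap.mul k H) _ _ hc hab'
  rw [e, map_smul, LinearMap.smul_apply, act₃_tmul _ _ (mul_mem_gr hc hc') hvw,
    Module.End.mul_apply, act₃_tmul _ _ hc' hvw, map_smul,
    act₃_tmul _ _ hc (act₂_mem hρ hρ' hab' hvw), act₂_mul hρ, map_mul, smul_smul, smul_smul,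
    Module.End.mul_apply, Module.End.mul_apply]
  congr 1
  simp only [koszulSign_add_left, koszulSign_add_right]
  ring

theorem act₃_comul_rTensor (hρ : IsGradedAct ρ) (y : H ⊗[k] H) :
    act₂ (tensorAct ρ ρ' hρ) ρ'' y = act₃ ρ ρ' ρ'' ((comul k H).rTensor H y) := by
  refine homog_tensor_induction (by simp) (fun a b ha hb => by simp only [map_add, ha, hb]) ?_ y
  intro i j a _ b hb
  refine LinearMap.ext fun z => ?_
  refine homog_tensor_induction (by simp) (fun a b ha hb => by simp only [map_add, ha, hb]) ?_ z
  intro p q v hv w _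
  rw [act₂_tmul _ _ _ _ hb hv, LinearMap.rTensor_tmul, act₃_tmul _ _ hb hv]
  rfl

theorem act₃_comul_lTensor (hρ' : IsGradedAct ρ') (y : H ⊗[k] H) (t : (V ⊗[k] W) ⊗[k] U) :
    act₂ ρ (tensorAct ρ' ρ'' hρ') y (TensorProduct.assoc k V W U t) =
      TensorProduct.assoc k V W U (act₃ ρ ρ' ρ''
        ((TensorProduct.assoc k H H H).symm ((comul k H).lTensor H y)) t) := by
  rw [act₃, assoc_superTensor, LinearEquiv.apply_symm_apply]
  generalize TensorProduct.assoc k V W U t = t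
  revert t
  refine homog_tensor_induction (by simp) (fun a b ha hb t => by
    simp only [map_add, LinearMap.add_apply, ha, hb]) ?_ y
  intro i j a _ b hb z
  refine homog_tensor_induction (by simp) (fun a b ha hb => by simp only [map_add, ha, hb]) ?_ z
  intro p q v hv w _
  rw [act₂_tmul _ _ _ _ hb hv, LinearMap.lTensor_tmul,
    superTensor_tmul _ _ _ _ (HopfSuperalgebra.comul_mem j b hb) hv]
  rfl

theorem act₃_tmul_one (y : H ⊗[k] H) (t : (V ⊗[k] W) ⊗[k] U) :
    act₃ ρ ρ' ρ'' (y ⊗ₜ 1) t = (act₂ ρ ρ' y).rTensor U t := by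
  refine homog_threefold_induction (by simp) (fun a b ha hb => by simp only [map_add, ha, hb]) ?_ t
  intro p q r v hv w hw u hu
  rw [act₃_tmul _ _ one_mem_gr (tmul_mem_tensorGr (k := k) hv hw rfl)]
  simp

/-- An even `y` crosses the factor `V` without a sign. -/
theorem act₃_one_tmul {y : H ⊗[k] H} (hy : y ∈ gr k (V := H ⊗[k] H) 0)
    (t : V ⊗[k] (W ⊗[k] U)) :
    act₃ ρ ρ' ρ'' ((TensorProduct.assoc k H H H).symm (1 ⊗ₜ y))
      ((TensorProduct.assoc k V W U).symm t) =
      (TensorProduct.assoc k V W U).symm ((act₂ ρ' ρ'' y).lTensor V t) := by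
  rw [LinearEquiv.eq_symm_apply, act₃, assoc_superTensor, LinearEquiv.apply_symm_apply,
    LinearEquiv.apply_symm_apply]
  refine homog_tensor_induction (by simp) (fun a b ha hb => by simp only [map_add, ha, hb]) ?_ t
  intro p q v hv w hw
  rw [superTensor_tmul _ _ _ _ hy hv]
  simp

/-- The second leg of `y₁₃` crosses `W` when it acts, and the first leg crosses `W` when `V` is
flipped past it. For even `y` the two legs have equal parity, so these signs cancel and `W` is a
spectator. -/
theorem hexagon_forward_aux (y : H ⊗[k] H) (hy : y ∈ gr k (V := H ⊗[k] H) 0)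
    (hρ : IsGradedAct ρ) (hρ' : IsGradedAct ρ') (hρ'' : IsGradedAct ρ'')
    (t : (V ⊗[k] W) ⊗[k] U) :
    TensorProduct.assoc k W U V (superFlip k V (W ⊗[k] U) (TensorProduct.assoc k V W U
      (act₃ ρ ρ' ρ'' ((TensorProduct.assoc k H H H).symm
        ((TensorProduct.mk k H H 1).lTensor H y)) t))) =
      (superFlip k V U ∘ₗ act₂ ρ ρ'' y).lTensor W
        (TensorProduct.assoc k W V U ((superFlip k V W).rTensor U t)) := by
  refine even_tensor_induction (by simp) (fun a b ha hb => by
    simp only [map_add, LinearMap.add_apply, LinearMap.comp_add, LinearMap.lTensor_add, ha, hb])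
    ?_ y hy
  intro i a ha b hb
  refine homog_threefold_induction (by simp) (fun a b ha hb => by simp only [map_add, ha, hb]) ?_ t
  intro p q r v hv w hw u hu
  simp only [LinearMap.lTensor_tmul, TensorProduct.mk_apply, TensorProduct.assoc_symm_tmul,
    LinearMap.rTensor_tmul]
  rw [act₃_tmul _ _ hb (tmul_mem_tensorGr (k := k) hv hw rfl), act₂_tmul _ _ _ _ one_mem_gr hv,
    superFlip_tmul hv hw]
  simp only [koszulSign_zero_left, one_smul, map_smul, TensorProduct.assoc_tmul, map_one,
    Module.End.one_apply, ← smul_tmul', LinearMap.lTensor_tmul, LinearMap.comp_apply]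
  rw [superFlip_tmul (hρ _ _ a ha v hv) (tmul_mem_tensorGr (k := k) hw (hρ'' _ _ b hb u hu) rfl),
    act₂_tmul _ _ _ _ hb hv]
  simp only [map_smul, superFlip_tmul (hρ _ _ a ha v hv) (hρ'' _ _ b hb u hu),
    TensorProduct.assoc_tmul, tmul_smul, smul_smul]
  congr 1
  simp only [koszulSign_eq_paritySign, paritySign_mul]
  congr 1
  clear * -
  revert i p q r
  decide

theorem hexagon_reverse_aux (y : H ⊗[k] H) (hy : y ∈ gr k (V := H ⊗[k] H) 0)
    (hρ : IsGradedAct ρ) (hρ' : IsGradedAct ρ') (hρ'' : IsGradedAct ρ'')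
    (t : (V ⊗[k] W) ⊗[k] U) :
    (TensorProduct.assoc k U V W).symm (superFlip k (V ⊗[k] W) U
      (act₃ ρ ρ' ρ'' ((TensorProduct.assoc k H H H).symm
        ((TensorProduct.mk k H H 1).lTensor H y)) t)) =
      (superFlip k V U ∘ₗ act₂ ρ ρ'' y).rTensor W
        ((TensorProduct.assoc k V U W).symm ((superFlip k W U).lTensor V
          (TensorProduct.assoc k V W U t))) := by
  refine even_tensor_induction (by simp) (fun a b ha hb => by
    simp only [map_add, LinearMap.add_apply, LinearMap.comp_add, LinearMap.rTensor_add, ha, hb])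
    ?_ y hy
  intro i a ha b hb
  refine homog_threefold_induction (by simp) (fun a b ha hb => by simp only [map_add, ha, hb]) ?_ t
  intro p q r v hv w hw u hu
  simp only [LinearMap.lTensor_tmul, TensorProduct.mk_apply, TensorProduct.assoc_symm_tmul,
    TensorProduct.assoc_tmul]
  rw [act₃_tmul _ _ hb (tmul_mem_tensorGr (k := k) hv hw rfl), act₂_tmul _ _ _ _ one_mem_gr hv,
    superFlip_tmul hw hu]
  simp only [koszulSign_zero_left, one_smul, map_smul, TensorProduct.assoc_symm_tmul, map_one,
    Module.End.one_apply, tmul_smul, LinearMap.rTensor_tmul, LinearMap.comp_apply]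
  rw [superFlip_tmul (tmul_mem_tensorGr (k := k) (hρ _ _ a ha v hv) hw rfl) (hρ'' _ _ b hb u hu),
    act₂_tmul _ _ _ _ hb hv]
  simp only [map_smul, superFlip_tmul (hρ _ _ a ha v hv) (hρ'' _ _ b hb u hu),
    TensorProduct.assoc_symm_tmul, ← smul_tmul', smul_smul]
  congr 1
  simp only [koszulSign_eq_paritySign, paritySign_mul]
  congr 1
  clear * -
  revert i p q r
  decide

end ThreeFold

section Braided

variable {k : Type u} {H : Type w} [Field k] [Ring H] [Algebra k H] [Coalgebra k H]
  [SuperSpace k H] [HopfSuperalgebra k H] (ℛ : RibbonStructure k H)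

theorem RibbonStructure.braid_naturality {V W V' W' : HMod k H} (f : V ⟶ V') (g : W ⟶ W') :
    (f ⊗ₘ g) ≫ (ℛ.braid V' W').hom = (ℛ.braid V W).hom ≫ (g ⊗ₘ f) := by
  refine HMod.hom_ext (LinearMap.ext fun z => ?_)
  refine (congrArg (superFlip k V'.carrier W'.carrier) (map_act₂ (HMod.lin_even f)
    (HMod.lin_act f) (HMod.lin_act g) ℛ.R z).symm).trans ?_
  exact superFlip_map (HMod.lin_even f) (HMod.lin_even g) _

/-- The braiding of the category of modules. -/
@[reducible]
def RibbonStructure.braidedCategory : BraidedCategory (HMod k H) where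
  braiding := ℛ.braid
  braiding_naturality_right V _ _ f := ℛ.braid_naturality (𝟙 V) f
  braiding_naturality_left f W := ℛ.braid_naturality f (𝟙 W)
  hexagon_forward V W U := by
    refine HMod.hom_ext (LinearMap.ext
      fun t : (V.carrier ⊗[k] W.carrier) ⊗[k] U.carrier => ?_)
    -- `(1 ⊗ Δ) R = R₁₃ R₁₂`: first `R₁₂` acts, for the braiding of `V` past `W`, then `R₁₃`, for
    -- that of `V` past `U`.
    have h1 := act₃_comul_lTensor (ρ := V.act) (ρ'' := U.act) W.act_graded ℛ.R t
    rw [ℛ.comul_lTensor_R, act₃_mul V.act_graded W.act_graded, Module.End.mul_apply,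
      act₃_tmul_one] at h1
    have h2 := hexagon_forward_aux ℛ.R ℛ.R_even V.act_graded W.act_graded U.act_graded
      ((act₂ V.act W.act ℛ.R).rTensor U.carrier t)
    rw [← h1, ← LinearMap.comp_apply ((superFlip k V.carrier W.carrier).rTensor _),
      ← LinearMap.rTensor_comp] at h2
    exact h2
  hexagon_reverse V W U := by
    refine HMod.hom_ext (LinearMap.ext
      fun t : V.carrier ⊗[k] (W.carrier ⊗[k] U.carrier) => ?_)
    -- `(Δ ⊗ 1) R = R₁₃ R₂₃`: `U` meets `W` first and `V` afterwards.
    have h1 := LinearMap.congr_fun (act₃_comul_rTensor (ρ := V.act) (ρ' := W.act) (ρ'' := U.act)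
      V.act_graded ℛ.R) ((TensorProduct.assoc k _ _ _).symm t)
    rw [ℛ.comul_rTensor_R, act₃_mul V.act_graded W.act_graded, Module.End.mul_apply,
      act₃_one_tmul ℛ.R_even] at h1
    have h2 := hexagon_reverse_aux ℛ.R ℛ.R_even V.act_graded W.act_graded U.act_graded
      ((TensorProduct.assoc k _ _ _).symm ((act₂ W.act U.act ℛ.R).lTensor V.carrier t))
    rw [← h1, LinearEquiv.apply_symm_apply,
      ← LinearMap.comp_apply ((superFlip k W.carrier U.carrier).lTensor _),
      ← LinearMap.lTensor_comp] at h2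
    exact h2

end Braided

end SuperHopf

end

noncomputable section

namespace SuperHopf

/-! ### The coboundary structure `X` on modules -/

namespace RibbonStructure.HalfTwist

variable {k : Type u} {H : Type w} [Field k] [Ring H] [Algebra k H] [Coalgebra k H]
  [SuperSpace k H] [HopfSuperalgebra k H] {ℛ : RibbonStructure k H} (s : ℛ.HalfTwist)

theorem X_naturality {V W V' W' : HMod k H} (f : V ⟶ V') (g : W ⟶ W') :
    (f ⊗ₘ g) ≫ (s.X V' W').hom = (s.X V W).hom ≫ (g ⊗ₘ f) :=
  letI := ℛ.braidedCategory
  halfBraid_naturality s.iso f g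

theorem X_comp_braid_inv (V W : HMod k H) :
    (s.X W V).hom ≫ (ℛ.braid W V).inv = (ℛ.braid V W).inv ≫ (s.X V W).hom :=
  letI := ℛ.braidedCategory
  halfBraid_comp_braiding_inv s.iso V W

theorem X_cactus (V W U : HMod k H) :
    (s.X (V ⊗ W) U).hom ≫ U ◁ (s.X V W).hom =
      (α_ V W U).hom ≫ (s.X V (W ⊗ U)).hom ≫ (s.X W U).hom ▷ V ≫ (α_ U W V).hom :=
  letI := ℛ.braidedCategory
  halfBraid_cactus s.iso V W U

theorem X_tensorUnit_left (V : HMod k H) :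
    (s.X (𝟙_ (HMod k H)) V).hom = (λ_ V).hom ≫ (ρ_ V).inv :=
  letI := ℛ.braidedCategory
  halfBraid_tensorUnit_left s.iso V s.unit

theorem X_tensorUnit_right (V : HMod k H) :
    (s.X V (𝟙_ (HMod k H))).hom = (ρ_ V).hom ≫ (λ_ V).inv :=
  letI := ℛ.braidedCategory
  halfBraid_tensorUnit_right s.iso V s.unit

/-- The balancing axiom. It is the action of `τ(R) R Δ(θ) = θ ⊗ θ`, inverted because the twist acts
by `θ⁻¹`; naturality of the braiding carries the twists of the factors across the double braiding.
-/
theorem braid_braid_twist (V W : HMod k H) :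
    (ℛ.twist V ⊗ₘ ℛ.twist W) ≫ (ℛ.braid V W).hom ≫ (ℛ.braid W V).hom = ℛ.twist (V ⊗ W) := by
  have h1 : (ℛ.thetaIso (V ⊗ W)).hom ≫ (ℛ.braid V W).hom ≫ (ℛ.braid W V).hom =
      (ℛ.thetaIso V).hom ⊗ₘ (ℛ.thetaIso W).hom := by
    refine HMod.hom_ext (LinearMap.ext fun z : V.carrier ⊗[k] W.carrier => ?_)
    have h := LinearMap.congr_fun (congrArg (act₂ V.act W.act) ℛ.comul_θ) z
    rw [act₂_mul V.act_graded, act₂_mul V.act_graded, Module.End.mul_apply,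
      Module.End.mul_apply] at h
    -- Conjugation by the flip turns the `R` of the second braiding into `τ(R)`, so the double
    -- braiding acts as `τ(R) R`.
    have h2 := superFlip_act₂ W.act_graded V.act_graded ℛ.R
      (superFlip k V.carrier W.carrier (act₂ V.act W.act ℛ.R
        (act₂ V.act W.act (comul k H ℛ.θ) z)))
    rw [superFlip_superFlip, h] at h2
    refine h2.trans ?_
    change act₂ V.act W.act ((ℛ.θ : H) ⊗ₜ (ℛ.θ : H)) z =
      TensorProduct.map (V.act (ℛ.θ : H)) (W.act (ℛ.θ : H)) z
    refine homog_tensor_induction (by simp) (fun a b ha hb => by simp only [map_add, ha, hb]) ?_ z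
    intro i j v hv w hw
    rw [act₂_tmul _ _ _ _ ℛ.θ_even hv]
    simp
  have h2 : (ℛ.braid V W).hom ≫ (ℛ.braid W V).hom =
      ℛ.twist (V ⊗ W) ≫ ((ℛ.thetaIso V).hom ⊗ₘ (ℛ.thetaIso W).hom) := by
    rw [← h1]
    exact ((ℛ.thetaIso (V ⊗ W)).inv_hom_id_assoc _).symm
  have h3 : (ℛ.twist V ⊗ₘ ℛ.twist W) ≫ (ℛ.braid V W).hom ≫ (ℛ.braid W V).hom =
      ((ℛ.braid V W).hom ≫ (ℛ.braid W V).hom) ≫ (ℛ.twist V ⊗ₘ ℛ.twist W) := by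
    rw [reassoc_of% ℛ.braid_naturality (ℛ.twist V) (ℛ.twist W), ℛ.braid_naturality,
      Category.assoc]
  rw [h3, h2, Category.assoc, tensorHom_comp_tensorHom]
  have h4 : ∀ V : HMod k H, (ℛ.thetaIso V).hom ≫ ℛ.twist V = 𝟙 V :=
    fun V => (ℛ.thetaIso V).hom_inv_id
  rw [h4, h4, id_tensorHom_id, Category.comp_id]

theorem X_symm (V W : HMod k H) : (s.X V W).hom ≫ (s.X W V).hom = 𝟙 (V ⊗ W) := by
  let := ℛ.braidedCategory
  refine halfBraid_symm s.iso V W ((s.sq _).trans ?_)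
  rw [tensorHom_comp_tensorHom_assoc]
  refine (braid_braid_twist V W).symm.trans ?_
  rw [← s.sq, ← s.sq]
  rfl

end RibbonStructure.HalfTwist

/-! ### Evaluation, coevaluation and the pivot -/

section DualTensor

variable {k : Type*} {H : Type*} [Field k] [Ring H] [Algebra k H] [Coalgebra k H]
  [SuperSpace k H] [HopfSuperalgebra k H]
variable {V W : Type*} [AddCommGroup V] [Module k V] [SuperSpace k V]
  [AddCommGroup W] [Module k W] [SuperSpace k W]

variable (k V) in
/-- The map `v ⊗ φ ↦ (w ↦ φ w • v)`. -/
def tensorDualHom : V ⊗[k] Module.Dual k V →ₗ[k] Module.End k V :=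
  dualTensorHom k V V ∘ₗ (TensorProduct.comm k V (Module.Dual k V)).toLinearMap

@[simp]
theorem tensorDualHom_tmul (v : V) (φ : Module.Dual k V) (w : V) :
    tensorDualHom k V (v ⊗ₜ φ) w = φ w • v := rfl

theorem tensorDualHom_injective [FiniteDimensional k V] :
    Function.Injective (tensorDualHom k V) := by
  have h : Function.Injective (dualTensorHom k V V) := (dualTensorHomEquiv k V V).injective
  exact h.comp (TensorProduct.comm k V (Module.Dual k V)).injective

/-- The coevaluation is the tensor of the identity. As `V ⊗ V* → End V` is injective, claims about
it can be checked on operators, with no homogeneous basis. -/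
theorem tensorDualHom_coevaluation [FiniteDimensional k V] :
    tensorDualHom k V (coevaluation k V 1) = 1 := by
  refine LinearMap.ext fun w => ?_
  rw [coevaluation_apply_one]
  simp only [map_sum, LinearMap.sum_apply, tensorDualHom_tmul]
  exact (Module.Basis.ofVectorSpace k V).sum_repr w

theorem tensorDualHom_rTensor (T : Module.End k V) (z : V ⊗[k] Module.Dual k V) :
    tensorDualHom k V (T.rTensor _ z) = T * tensorDualHom k V z := by
  induction z with
  | zero => simp
  | add a b ha hb => simp only [map_add, ha, hb, mul_add]
  | tmul v φ => ext w; simp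

theorem eq_of_dual_apply_ne_zero {i j : ZMod 2} {v : V} {φ : Module.Dual k V} (hv : v ∈ gr k i)
    (hφ : φ ∈ gr k j) (h : φ v ≠ 0) : j = i := by
  by_contra hij
  have : i = j + 1 := by clear hv hφ; revert i j; decide
  subst this
  exact h (mem_gr_dual.1 hφ v hv)

theorem tensorDualHom_mem {n i : ZMod 2} {z : V ⊗[k] Module.Dual k V}
    (hz : z ∈ gr k (V := V ⊗[k] Module.Dual k V) n) {w : V} (hw : w ∈ gr k i) :
    tensorDualHom k V z w ∈ gr k (V := V) (i + n) := by
  have : tensorGr k V (Module.Dual k V) n ≤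
      Submodule.comap (LinearMap.applyₗ w ∘ₗ tensorDualHom k V) (gr k (i + n)) := by
    refine tensorGr_le fun p q hpq v hv φ hφ => ?_
    change φ w • v ∈ gr k (i + n)
    by_cases h : φ w = 0
    · rw [h, zero_smul]; exact Submodule.zero_mem _
    · obtain rfl := eq_of_dual_apply_ne_zero hw hφ h
      have : q + n = p := by rw [← hpq, add_left_comm, CharTwo.add_self_eq_zero, add_zero]
      rw [this]
      exact Submodule.smul_mem _ _ hv
  exact this hz

theorem eq_zero_of_mem_gr_of_mem_gr_add_one {i : ZMod 2} {v : V} (h : v ∈ gr k i)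
    (h' : v ∈ gr k (i + 1)) : v = 0 := by
  have hd := Submodule.disjoint_def.1 (SuperSpace.isCompl (k := k) (V := V)).disjoint
  rcases zmod2_cases i with rfl | rfl
  · exact hd v h h'
  · exact hd v h' h

/-- The basis defining the coevaluation need not be homogeneous, so evenness is seen through `End
V`: the operator of the odd component reverses parity, but it also preserves parity, being the
identity minus the operator of the even component. Hence it vanishes. -/
theorem coevaluation_mem [FiniteDimensional k V] :
    coevaluation k V 1 ∈ gr k (V := V ⊗[k] Module.Dual k V) 0 := by
  obtain ⟨z₀, z₁, h₀, h₁, h⟩ := Submodule.codisjoint_iff_exists_add_eq.1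
    (SuperSpace.isCompl (k := k) (V := V ⊗[k] Module.Dual k V)).codisjoint (coevaluation k V 1)
  have h2 : z₁ = 0 := by
    apply tensorDualHom_injective
    rw [map_zero]
    refine LinearMap.ext fun v => ?_
    refine homog_induction k (fun a b ha hb => by simp only [map_add, ha, hb]) ?_ v
    intro i v hv
    refine eq_zero_of_mem_gr_of_mem_gr_add_one ?_ (tensorDualHom_mem h₁ hv)
    have e : tensorDualHom k V z₁ v = v - tensorDualHom k V z₀ v := by
      have := LinearMap.congr_fun (tensorDualHom_coevaluation (k := k) (V := V)) v
      rw [← h, map_add, LinearMap.add_apply, Module.End.one_apply] at this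
      exact eq_sub_of_add_eq' this
    have h3 := tensorDualHom_mem h₀ hv
    rw [add_zero] at h3
    rw [e]
    exact Submodule.sub_mem _ hv h3
  rw [← h, h2, add_zero]
  exact h₀

variable {ρ : H →ₐ[k] Module.End k V}

/-- On even tensors `a ⊗ b` acts by `T ↦ ρ(a) T ρ(S b)`, the sign of the tensor action cancelling
that of the dual action. At `T = 1` this is the action of `a S(b)`, so invariance of the
coevaluation is the antipode axiom. -/
theorem tensorDualHom_act₂ (hρ : IsGradedAct ρ) (y : H ⊗[k] H) (z : V ⊗[k] Module.Dual k V)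
    (hz : z ∈ gr k (V := V ⊗[k] Module.Dual k V) 0) (hz' : tensorDualHom k V z = 1) :
    tensorDualHom k V (act₂ ρ (dualAct ρ hρ) y z) =
      ρ (LinearMap.mul' k H ((antipode k H).lTensor H y)) := by
  refine homog_tensor_induction (by simp) (fun a b ha hb => by
    simp only [map_add, LinearMap.add_apply, ha, hb]) ?_ y
  intro i j a ha b hb
  have : tensorDualHom k V (act₂ ρ (dualAct ρ hρ) (a ⊗ₜ b) z) =
      ρ a * tensorDualHom k V z * ρ (antipode k H b) := by
    refine even_tensor_induction (by simp) (fun a b ha hb => by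
      simp only [map_add, ha, hb, mul_add, add_mul]) ?_ z hz
    intro p v hv φ hφ
    refine LinearMap.ext fun w => ?_
    rw [act₂_tmul _ _ _ _ hb hv, map_smul, LinearMap.smul_apply, tensorDualHom_tmul]
    have e : dualAct ρ hρ b φ w = koszulSign k j p * φ (ρ (antipode k H b) w) :=
      dualActLin_apply ρ hb hφ w
    rw [e, smul_smul, ← mul_assoc, koszulSign_mul_self, one_mul]
    simp
  rw [this, hz', mul_one]
  simp

/-- The signs of the two legs combine into one that sees only the total parity of `y`, leaving the
operator `S(a) b` of the other antipode axiom. -/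
theorem contractLeft_act₂ (hρ : IsGradedAct ρ) {i j : ZMod 2} {y : H ⊗[k] H}
    (hy : y ∈ gr k (V := H ⊗[k] H) i) {φ : Module.Dual k V} (hφ : φ ∈ gr k j) (v : V) :
    contractLeft k V (act₂ (dualAct ρ hρ) ρ y (φ ⊗ₜ v)) =
      koszulSign k i j * φ (ρ (LinearMap.mul' k H ((antipode k H).rTensor H y)) v) := by
  have : tensorGr k H H i ≤ LinearMap.ker (contractLeft k V ∘ₗ
      LinearMap.applyₗ (φ ⊗ₜ[k] v) ∘ₗ act₂ (dualAct ρ hρ) ρ - koszulSign k i j •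
        (φ ∘ₗ LinearMap.applyₗ v ∘ₗ ρ.toLinearMap ∘ₗ LinearMap.mul' k H ∘ₗ
          (antipode k H).rTensor H)) := by
    refine tensorGr_le fun p q hpq a ha b hb => ?_
    rw [LinearMap.mem_ker, LinearMap.sub_apply, sub_eq_zero]
    simp only [LinearMap.comp_apply, LinearMap.applyₗ_apply_apply, LinearMap.smul_apply,
      AlgHom.toLinearMap_apply, LinearMap.rTensor_tmul, LinearMap.mul'_apply, smul_eq_mul]
    rw [act₂_tmul _ _ _ _ hb hφ, map_smul, contractLeft_apply]
    have e : dualAct ρ hρ a φ (ρ b v) = koszulSign k p j * φ (ρ (antipode k H a) (ρ b v)) :=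
      dualActLin_apply ρ ha hφ _
    rw [e, ← hpq, koszulSign_add_left, smul_eq_mul, map_mul, Module.End.mul_apply]
    ring
  have h := this hy
  rwa [LinearMap.mem_ker, LinearMap.sub_apply, sub_eq_zero] at h

theorem isEven_contractLeft :
    IsEven (k := k) (V := Module.Dual k V ⊗[k] V) (W := k) (contractLeft k V) := by
  intro n z hz
  have : tensorGr k (Module.Dual k V) V n ≤
      Submodule.comap (contractLeft k V) (gr k (V := k) n) := by
    refine tensorGr_le fun p q hpq φ hφ v hv => ?_
    change φ v ∈ gr k (V := k) n
    by_cases h : φ v = 0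
    · rw [h]; exact Submodule.zero_mem _
    · obtain rfl := eq_of_dual_apply_ne_zero hv hφ h
      rw [← hpq, CharTwo.add_self_eq_zero]
      exact mem_gr_field _
  exact this hz

theorem contractLeft_tensorAct (hρ : IsGradedAct ρ) (x : H) (z : Module.Dual k V ⊗[k] V) :
    contractLeft k V (act₂ (dualAct ρ hρ) ρ (comul k H x) z) =
      counit k H x * contractLeft k V z := by
  revert z
  refine homog_induction k (fun a b ha hb z => by
    simp only [map_add, LinearMap.add_apply, ha, hb, add_mul]) ?_ x
  intro i x hx z
  refine homog_tensor_induction (by simp) (fun a b ha hb => by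
    simp only [map_add, ha, hb, mul_add]) ?_ z
  intro p q φ hφ v hv
  rw [contractLeft_act₂ hρ (HopfSuperalgebra.comul_mem i x hx) hφ]
  have h := LinearMap.congr_fun
    (HopfSuperalgebra.mul_antipode_rTensor_comul (k := k) (H := H)) x
  simp only [LinearMap.comp_apply] at h
  rw [h, contractLeft_apply]
  rcases zmod2_cases i with rfl | rfl
  · simp [Algebra.algebraMap_eq_smul_one]
  · simp [HopfSuperalgebra.counit_odd x hx]

theorem coevaluation_apply_eq_smul [FiniteDimensional k V] (c : k) :
    coevaluation k V c = c • coevaluation k V 1 := by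
  rw [← map_smul, smul_eq_mul, mul_one]

theorem isEven_coevaluation [FiniteDimensional k V] :
    IsEven (k := k) (V := k) (W := V ⊗[k] Module.Dual k V) (coevaluation k V) := by
  intro i c hc
  rw [coevaluation_apply_eq_smul]
  rcases zmod2_cases i with rfl | rfl
  · exact Submodule.smul_mem _ _ coevaluation_mem
  · change c ∈ (if (1 : ZMod 2) = 0 then (⊤ : Submodule k k) else ⊥) at hc
    rw [if_neg one_ne_zero, Submodule.mem_bot] at hc
    rw [hc, zero_smul]
    exact Submodule.zero_mem _

theorem coevaluation_counit [FiniteDimensional k V] (hρ : IsGradedAct ρ) (x : H) (c : k) :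
    coevaluation k V (counit k H x * c) =
      act₂ ρ (dualAct ρ hρ) (comul k H x) (coevaluation k V c) := by
  rw [coevaluation_apply_eq_smul, coevaluation_apply_eq_smul c, map_smul, mul_comm, mul_smul]
  congr 1
  apply tensorDualHom_injective
  rw [tensorDualHom_act₂ hρ _ _ coevaluation_mem tensorDualHom_coevaluation]
  have h := LinearMap.congr_fun
    (HopfSuperalgebra.mul_antipode_lTensor_comul (k := k) (H := H)) x
  simp only [LinearMap.comp_apply] at h
  rw [h, map_smul, tensorDualHom_coevaluation, Algebra.linearMap_apply, AlgHom.commutes,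
    Algebra.algebraMap_eq_smul_one]

end DualTensor

namespace HMod

variable {k : Type u} {H : Type w} [Field k] [Ring H] [Algebra k H] [Coalgebra k H]
  [SuperSpace k H] [HopfSuperalgebra k H]

/-- The evaluation as a morphism. -/
def ev (V : HMod k H) : HMod.dual V ⊗ V ⟶ 𝟙_ (HMod k H) :=
  HMod.ofLin (V := HMod.tensor (HMod.dual V) V) (W := HMod.unit k H) V.leftEv isEven_contractLeft
    (contractLeft_tensorAct V.act_graded)

/-- The coevaluation as a morphism. -/
def coev (V : HMod k H) : 𝟙_ (HMod k H) ⟶ V ⊗ HMod.dual V :=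
  HMod.ofLin (V := HMod.unit k H) (W := HMod.tensor V (HMod.dual V)) V.leftCoev
    isEven_coevaluation (coevaluation_counit V.act_graded)

variable {ℛ : RibbonStructure k H}

theorem rightEv_tmul {V : HMod k H} {i j : ZMod 2} {v : V.carrier}
    {φ : Module.Dual k V.carrier} (hv : v ∈ gr k i) (hφ : φ ∈ gr k j) :
    V.rightEv ℛ (v ⊗ₜ φ) = koszulSign k i j * φ (V.act ℛ.pivot v) := by
  simp only [rightEv, LinearMap.comp_apply]
  rw [superFlip_tmul hv hφ]
  simp

/-- Since `(b φ)(a v) = ± φ(S(b) a v)`, contracting after the flip applies to `y` the recipe that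
defines the Drinfeld element from `R`. Evenness of `y` makes the signs agree. -/
theorem contractLeft_superFlip_act₂ (V : HMod k H) {y : H ⊗[k] H}
    (hy : y ∈ gr k (V := H ⊗[k] H) 0) {i j : ZMod 2} {v : V.carrier}
    {φ : Module.Dual k V.carrier} (hv : v ∈ gr k i) (hφ : φ ∈ gr k j) :
    contractLeft k V.carrier (superFlip k V.carrier (Module.Dual k V.carrier)
      (act₂ V.act (dualAct V.act V.act_graded) y (v ⊗ₜ φ))) =
      koszulSign k i j * φ (V.act (LinearMap.mul' k H
        ((antipode k H).rTensor H (superFlip k H H y))) v) := by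
  refine even_tensor_induction (by simp) (fun a b ha hb => by
    simp only [map_add, LinearMap.add_apply, ha, hb, mul_add]) ?_ y hy
  intro p a ha b hb
  rw [act₂_tmul _ _ _ _ hb hv, map_smul, superFlip_tmul (V.act_graded p i a ha v hv)
    (dualAct_graded V.act_graded p j b hb φ hφ), superFlip_tmul ha hb]
  have e : dualAct V.act V.act_graded b φ (V.act a v) =
      koszulSign k p j * φ (V.act (antipode k H b) (V.act a v)) :=
    dualActLin_apply V.act hb hφ _
  simp only [map_smul, contractLeft_apply, e, LinearMap.rTensor_tmul, LinearMap.mul'_apply,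
    LinearMap.smul_apply, map_mul, Module.End.mul_apply, smul_eq_mul, ← mul_assoc]
  congr 1
  simp only [koszulSign_eq_paritySign, paritySign_mul]
  congr 1
  clear * -
  revert i j p
  decide

theorem contractLeft_superFlip_R (V : HMod k H) (z : V.carrier ⊗[k] Module.Dual k V.carrier) :
    contractLeft k V.carrier (superFlip k V.carrier (Module.Dual k V.carrier)
      (act₂ V.act (dualAct V.act V.act_graded) ℛ.R
        ((V.act (ℛ.θ⁻¹ : Hˣ)).rTensor (Module.Dual k V.carrier) z))) = V.rightEv ℛ z := by
  refine homog_tensor_induction (by simp) (fun a b ha hb => by simp only [map_add, ha, hb]) ?_ z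
  intro i j v hv φ hφ
  have hv' : V.act (ℛ.θ⁻¹ : Hˣ) v ∈ gr k i := HMod.lin_even (ℛ.twist V) i v hv
  rw [LinearMap.rTensor_tmul, contractLeft_superFlip_act₂ V ℛ.R_even hv' hφ, rightEv_tmul hv hφ,
    RibbonStructure.pivot, map_mul, Module.End.mul_apply]
  rfl

/-- The point where the pivot enters: in `ev ∘ X` the two half twists merge into `θ⁻¹` acting on
`V`, and the braiding with `V*` contributes `u`, so that `g = u θ⁻¹` appears. -/
theorem lin_X_comp_ev (s : ℛ.HalfTwist) (V : HMod k H) :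
    HMod.lin ((s.X V (HMod.dual V)).hom ≫ V.ev) = V.rightEv ℛ := by
  let := ℛ.braidedCategory
  -- Sliding the half twist along `ev` is the axiom that the half twist of the dual is the
  -- transpose.
  have he : tw s.iso (HMod.dual V) ▷ V ≫ V.ev = HMod.dual V ◁ tw s.iso V ≫ V.ev := by
    have := s.dual V
    rw [tw, this]
    refine HMod.hom_ext (TensorProduct.ext' fun (φ : Module.Dual k V.carrier) v => ?_)
    rfl
  have h := halfBraid_comp_evaluation s.iso V.ev s.unit he
  refine (congrArg HMod.lin h).trans ?_
  have h2 : tw s.iso V ≫ tw s.iso V = ℛ.twist V := s.sq V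
  rw [h2]
  exact LinearMap.ext (contractLeft_superFlip_R V)

end HMod

end SuperHopf

end

noncomputable section

namespace SuperHopf

/-! ### Adjoints and tensor products of sesquilinear forms -/

section Forms

variable {k : Type*} [Field k] [StarRing k]
variable {V W U V' W' : Type*} [AddCommGroup V] [Module k V] [AddCommGroup W] [Module k W]
  [AddCommGroup U] [Module k U] [AddCommGroup V'] [Module k V'] [AddCommGroup W'] [Module k W']
  [SuperSpace k V] [SuperSpace k W] [SuperSpace k U] [SuperSpace k V'] [SuperSpace k W']

/-- The form `(v | w)' = conj (w | v)`. -/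
def conjFlip (B : V →ₗ⋆[k] V →ₗ[k] k) : V →ₗ⋆[k] V →ₗ[k] k :=
  LinearMap.mk₂'ₛₗ (starRingEnd k) (.id k) (fun v w => star (B w v))
    (fun _ _ _ => by simp) (fun _ _ _ => by simp [starRingEnd_apply]) (fun _ _ _ => by simp)
    (fun c v w => by simp [starRingEnd_apply])

@[simp]
theorem conjFlip_apply (B : V →ₗ⋆[k] V →ₗ[k] k) (v w : V) :
    conjFlip B v w = star (B w v) := rfl

theorem conjFlip_nondegenerate {B : V →ₗ⋆[k] V →ₗ[k] k} (hB : B.Nondegenerate) :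
    (conjFlip B).Nondegenerate := by
  refine ⟨fun v hv => hB.2 v fun w => ?_, fun v hv => hB.1 v fun w => ?_⟩
  · simpa using hv w
  · simpa using hv w

theorem conjFlip_even {B : V →ₗ⋆[k] V →ₗ[k] k} (hB : EvenForm B) : EvenForm (conjFlip B) :=
  fun i j hij v hv w hw => by rw [conjFlip_apply, hB j i hij.symm w hw v hv, star_zero]

theorem eq_of_form_left {B : V →ₗ⋆[k] V →ₗ[k] k} (hB : B.Nondegenerate) {v v' : V}
    (h : ∀ w, B v w = B v' w) : v = v' :=
  sub_eq_zero.1 (hB.1 _ fun w => by rw [map_sub, LinearMap.sub_apply, h, sub_self])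

theorem eq_of_form_right {B : V →ₗ⋆[k] V →ₗ[k] k} (hB : B.Nondegenerate) {w w' : V}
    (h : ∀ v, B v w = B v w') : w = w' :=
  sub_eq_zero.1 (hB.2 _ fun v => by rw [map_sub, h, sub_self])

section

variable [FiniteDimensional k V] [FiniteDimensional k W]

/-- The adjoint of a linear map with respect to non-degenerate sesquilinear forms. -/
def formAdjoint {B : V →ₗ⋆[k] V →ₗ[k] k} (hB : B.Nondegenerate) {C : W →ₗ⋆[k] W →ₗ[k] k}
    (hC : C.Nondegenerate) (f : V →ₗ[k] W) : W →ₗ[k] V :=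
  -- The adjoint sits in the second variable, whereas `flat` represents functionals through the
  -- first; `conjFlip` exchanges the two. Two antilinear maps surround the transpose, so the
  -- composite is linear.
  (flat (conjFlip B) (conjFlip_nondegenerate hB)).symm.toLinearMap ∘ₛₗ
    (f.dualMap ∘ₛₗ (flat (conjFlip C) (conjFlip_nondegenerate hC)).toLinearMap)

variable {B : V →ₗ⋆[k] V →ₗ[k] k} (hB : B.Nondegenerate) {C : W →ₗ⋆[k] W →ₗ[k] k}
  (hC : C.Nondegenerate) (f : V →ₗ[k] W)

theorem conjFlip_formAdjoint (w : W) :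
    conjFlip B (formAdjoint hB hC f w) = (conjFlip C w : W →ₗ[k] k) ∘ₗ f :=
  (flat (conjFlip B) (conjFlip_nondegenerate hB)).apply_symm_apply _

theorem formAdjoint_apply (v : V) (w : W) : C (f v) w = B v (formAdjoint hB hC f w) :=
  star_injective (LinearMap.congr_fun (conjFlip_formAdjoint hB hC f w) v).symm

theorem isEven_formAdjoint (eB : EvenForm B) (eC : EvenForm C) {f : V →ₗ[k] W} (hf : IsEven f) :
    IsEven (formAdjoint hB hC f) := by
  intro i w hw
  refine mem_of_flat_mem (conjFlip_nondegenerate hB) (conjFlip_even eB) ?_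
  rw [conjFlip_formAdjoint]
  refine mem_gr_dual.2 fun v hv => ?_
  exact conjFlip_even eC i (i + 1) (by simp) w hw _ (hf _ v hv)

end

theorem pForm_map {B : V →ₗ⋆[k] V →ₗ[k] k} {B' : W →ₗ⋆[k] W →ₗ[k] k} {C : V' →ₗ⋆[k] V' →ₗ[k] k}
    {C' : W' →ₗ⋆[k] W' →ₗ[k] k} {f : V →ₗ[k] V'} {g : W →ₗ[k] W'} {f' : V' →ₗ[k] V}
    {g' : W' →ₗ[k] W} (hg : IsEven g) (hf' : IsEven f') (hf : ∀ v v', C (f v) v' = B v (f' v'))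
    (hgg' : ∀ w w', C' (g w) w' = B' w (g' w')) (z : V ⊗[k] W) (y : V' ⊗[k] W') :
    pForm C C' (TensorProduct.map f g z) y = pForm B B' z (TensorProduct.map f' g' y) := by
  refine homog_tensor_induction (by simp) (fun a b ha hb => by
    simp only [map_add, LinearMap.add_apply, ha, hb]) ?_ z
  intro i j v hv w hw
  refine homog_tensor_induction (by simp) (fun a b ha hb => by simp only [map_add, ha, hb]) ?_ y
  intro p q v' hv' w' hw'
  rw [map_tmul, map_tmul, pForm_tmul _ _ _ _ (hg j w hw) hv',
    pForm_tmul _ _ _ _ hw (hf' p v' hv'), hf, hgg']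

theorem pForm_compl₂_left (B : V →ₗ⋆[k] V →ₗ[k] k) (B' : W →ₗ⋆[k] W →ₗ[k] k) {F : V →ₗ[k] V}
    (hF : IsEven F) (z y : V ⊗[k] W) :
    pForm (B.compl₂ F) B' z y = pForm B B' z (F.rTensor W y) := by
  refine homog_tensor_induction (by simp) (fun a b ha hb => by
    simp only [map_add, LinearMap.add_apply, ha, hb]) ?_ z
  intro i j v hv w hw
  refine homog_tensor_induction (by simp) (fun a b ha hb => by simp only [map_add, ha, hb]) ?_ y
  intro p q v' hv' w' hw'
  rw [pForm_tmul _ _ _ _ hw hv', LinearMap.rTensor_tmul, pForm_tmul _ _ _ _ hw (hF p v' hv')]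
  rfl

theorem pForm_compl₂_right (B : V →ₗ⋆[k] V →ₗ[k] k) (B' : W →ₗ⋆[k] W →ₗ[k] k) (F : W →ₗ[k] W)
    (z y : V ⊗[k] W) : pForm B (B'.compl₂ F) z y = pForm B B' z (F.lTensor V y) := by
  refine homog_tensor_induction (by simp) (fun a b ha hb => by
    simp only [map_add, LinearMap.add_apply, ha, hb]) ?_ z
  intro i j v hv w hw
  refine homog_tensor_induction (by simp) (fun a b ha hb => by simp only [map_add, ha, hb]) ?_ y
  intro p q v' hv' w' hw'
  rw [pForm_tmul _ _ _ _ hw hv', LinearMap.lTensor_tmul, pForm_tmul _ _ _ _ hw hv']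
  rfl

/-- In either bracketing the total sign compares `w` with `v'` and `u` with both `v'` and `w'`. The
form `(·|·)_p` is thus strictly associative, and only the correction by `X` has to be studied. -/
theorem pForm_assoc {B : V →ₗ⋆[k] V →ₗ[k] k} {B' : W →ₗ⋆[k] W →ₗ[k] k}
    {B'' : U →ₗ⋆[k] U →ₗ[k] k} (z y : (V ⊗[k] W) ⊗[k] U) :
    pForm B (pForm B' B'') (TensorProduct.assoc k V W U z) (TensorProduct.assoc k V W U y) =
      pForm (pForm B B') B'' z y := by
  refine homog_threefold_induction (by simp) (fun a b ha hb => by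
    simp only [map_add, LinearMap.add_apply, ha, hb]) ?_ z
  intro i j l v hv w hw u hu
  refine homog_threefold_induction (by simp) (fun a b ha hb => by
    simp only [map_add, ha, hb]) ?_ y
  intro i' j' l' v' hv' w' hw' u' hu'
  rw [assoc_tmul, assoc_tmul, pForm_tmul _ _ _ _ (tmul_mem_tensorGr hw hu rfl) hv',
    pForm_tmul _ _ _ _ hu hw', pForm_tmul _ _ _ _ hu (tmul_mem_tensorGr hv' hw' rfl),
    pForm_tmul _ _ _ _ hw hv', koszulSign_add_left, koszulSign_add_right]
  ring

/-- Evenness leaves only pairs with matching parities, for which the signs of the two flips are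
equal and cancel. -/
theorem pForm_superFlip {B : V →ₗ⋆[k] V →ₗ[k] k} {B' : W →ₗ⋆[k] W →ₗ[k] k} (hB : EvenForm B)
    (hB' : EvenForm B') (z y : V ⊗[k] W) :
    pForm B' B (superFlip k V W z) (superFlip k V W y) = pForm B B' z y := by
  refine homog_tensor_induction (by simp) (fun a b ha hb => by
    simp only [map_add, LinearMap.add_apply, ha, hb]) ?_ z
  intro i j v hv w hw
  refine homog_tensor_induction (by simp) (fun a b ha hb => by simp only [map_add, ha, hb]) ?_ y
  intro p q v' hv' w' hw'
  rw [superFlip_tmul hv hw, superFlip_tmul hv' hw', map_smul, LinearMap.map_smulₛₗ,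
    LinearMap.smul_apply, pForm_tmul _ _ _ _ hv hw', pForm_tmul _ _ _ _ hw hv', starRingEnd_apply,
    star_koszulSign, smul_eq_mul, smul_eq_mul]
  by_cases h : i = p
  · by_cases h' : j = q
    · subst h h'
      rw [koszulSign_comm j i, ← mul_assoc, koszulSign_mul_self, one_mul, mul_comm (B' w w')]
    · rw [hB' j q h' w hw w' hw']; simp
  · rw [hB i p h v hv v' hv']; simp

/-- Two ways to reverse three factors by flips, with the same product of signs. It removes the flips
when the cactus relation for `X` is transferred to `τ X`. -/
theorem superFlip_assoc (y : (U ⊗[k] W) ⊗[k] V) :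
    TensorProduct.assoc k V W U ((superFlip k W V).rTensor U
      (superFlip k U (W ⊗[k] V) (TensorProduct.assoc k U W V y))) =
      (superFlip k U W).lTensor V (superFlip k (U ⊗[k] W) V y) := by
  refine homog_threefold_induction (by simp) (fun a b ha hb => by simp only [map_add, ha, hb]) ?_ y
  intro i j l u hu w hw v hv
  rw [assoc_tmul, superFlip_tmul hu (tmul_mem_tensorGr (k := k) hw hv rfl),
    superFlip_tmul (tmul_mem_tensorGr (k := k) hu hw rfl) hv, map_smul, map_smul, map_smul,
    LinearMap.rTensor_tmul, LinearMap.lTensor_tmul, superFlip_tmul hw hv, superFlip_tmul hu hw,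
    ← smul_tmul', map_smul, assoc_tmul, tmul_smul, smul_smul, smul_smul]
  congr 1
  simp only [koszulSign_add_left, koszulSign_add_right]
  ring

end Forms

/-! ### The conjugation by adjoints, and unitarity of the structural isomorphisms -/

namespace SesqMod

variable {k : Type u} {H : Type w} [Field k] [StarRing k] [Ring H] [Algebra k H] [Coalgebra k H]
  [SuperSpace k H] [HopfSuperalgebra k H] {ℛ : RibbonStructure k H} {D : Dagger ℛ}
  {s : ℛ.HalfTwist}

theorem hom_ext {V W : SesqMod D s} {f g : V ⟶ W} (h : lin f = lin g) : f = g :=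
  HMod.hom_ext (V := V.toHMod) (W := W.toHMod) h

theorem lin_even {V W : SesqMod D s} (f : V ⟶ W) : IsEven (lin f) :=
  HMod.lin_even (V := V.toHMod) (W := W.toHMod) f

theorem lin_act {V W : SesqMod D s} (f : V ⟶ W) (x : H) (v : V.carrier) :
    lin f (V.act x v) = W.act x (lin f v) :=
  HMod.lin_act (V := V.toHMod) (W := W.toHMod) f x v

theorem formAdjoint_act {V W : SesqMod D s} (f : V ⟶ W) (x : H) (w : W.carrier) :
    formAdjoint V.form_nondegenerate W.form_nondegenerate (lin f) (W.act x w) =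
      V.act x (formAdjoint V.form_nondegenerate W.form_nondegenerate (lin f) w) := by
  refine eq_of_form_right V.form_nondegenerate fun v => ?_
  rw [← formAdjoint_apply]
  -- Compatibility moves `x` to `x†` in the second variable, so the acting element has to be written
  -- as some `x†`. As `f` is even, both forms then produce the same sign.
  obtain ⟨x, rfl⟩ := D.dag.surjective x
  refine homog_induction k (fun a b ha hb => by
    simp only [map_add, LinearMap.add_apply, ha, hb]) ?_ x
  intro i x hx
  refine homog_induction k (fun a b ha hb => by
    simp only [map_add, LinearMap.add_apply, ha, hb]) ?_ v
  intro j v hv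
  have h1 := W.form_compatible i j x hx _ (lin_even f j v hv) w
  have h2 := V.form_compatible i j x hx v hv
    (formAdjoint V.form_nondegenerate W.form_nondegenerate (lin f) w)
  rw [← lin_act, formAdjoint_apply V.form_nondegenerate W.form_nondegenerate, h2] at h1
  have h3 := congrArg (koszulSign k i j * ·) h1
  simp only [← mul_assoc, koszulSign_mul_self, one_mul] at h3
  exact h3.symm

/-- The adjoint of a morphism. -/
def adjoint {V W : SesqMod D s} (f : V ⟶ W) : W ⟶ V :=
  HMod.ofLin (V := W.toHMod) (W := V.toHMod)
    (formAdjoint V.form_nondegenerate W.form_nondegenerate (lin f))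
    (isEven_formAdjoint _ _ V.form_even W.form_even (lin_even f)) (formAdjoint_act f)

theorem form_adjoint {V W : SesqMod D s} (f : V ⟶ W) (v : V.carrier) (w : W.carrier) :
    W.form (lin f v) w = V.form v (lin (adjoint f) w) :=
  formAdjoint_apply V.form_nondegenerate W.form_nondegenerate (lin f) v w

theorem adjoint_eq_iff {V W : SesqMod D s} {f : V ⟶ W} {h : W ⟶ V} :
    adjoint f = h ↔ ∀ v w, W.form (lin f v) w = V.form v (lin h w) := by
  refine ⟨fun e => e ▸ form_adjoint f, fun e => hom_ext (LinearMap.ext fun w => ?_)⟩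
  exact eq_of_form_right V.form_nondegenerate fun v => (form_adjoint f v w).symm.trans (e v w)

theorem adjoint_smul_add {V W : SesqMod D s} (a b : k) (f g : V ⟶ W) :
    adjoint (a • f + b • g) = star a • adjoint f + star b • adjoint g := by
  rw [adjoint_eq_iff]
  intro v w
  change W.form (a • lin f v + b • lin g v) w =
    V.form v (star a • lin (adjoint f) w + star b • lin (adjoint g) w)
  simp [LinearMap.map_smulₛₗ, starRingEnd_apply, form_adjoint]

theorem adjoint_comp {V W U : SesqMod D s} (f : V ⟶ W) (g : W ⟶ U) :
    adjoint (f ≫ g) = adjoint g ≫ adjoint f := by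
  rw [adjoint_eq_iff]
  intro v u
  exact (form_adjoint g _ u).trans (form_adjoint f v _)

theorem adjoint_injective (V W : SesqMod D s) :
    Function.Injective (adjoint : (V ⟶ W) → (W ⟶ V)) := by
  intro f g h
  refine hom_ext (LinearMap.ext fun v => eq_of_form_left W.form_nondegenerate fun w => ?_)
  rw [form_adjoint, form_adjoint, h]

/-- The forms need not be hermitian, so taking adjoints need not be involutive and surjectivity is
not formal. The double adjoint is linear and injective on a finite-dimensional space of morphisms,
hence surjective. -/
theorem adjoint_bijective (V W : SesqMod D s) :
    Function.Bijective (adjoint : (V ⟶ W) → (W ⟶ V)) := by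
  refine ⟨adjoint_injective V W, ?_⟩
  let T : (W ⟶ V) →ₗ[k] (W ⟶ V) :=
    { toFun := fun f => adjoint (adjoint f)
      map_add' := fun f g => by
        have := adjoint_smul_add 1 1 f g
        simp only [one_smul, star_one] at this
        have h2 := adjoint_smul_add 1 1 (adjoint f) (adjoint g)
        simp only [one_smul, star_one] at h2
        rw [this, h2]
      map_smul' := fun c f => by
        have := adjoint_smul_add c 0 f 0
        simp only [zero_smul, star_zero, add_zero] at this
        have h2 := adjoint_smul_add (star c) 0 (adjoint f) 0
        simp only [zero_smul, star_zero, add_zero, star_star] at h2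
        rw [this, h2]
        rfl }
  have hT : Function.Injective T := (adjoint_injective V W).comp (adjoint_injective W V)
  have : FiniteDimensional k (W ⟶ V) :=
    inferInstanceAs (FiniteDimensional k (HMod.homs W.toHMod V.toHMod))
  intro f
  obtain ⟨g, hg⟩ := LinearMap.injective_iff_surjective.1 hT f
  exact ⟨adjoint g, hg⟩

/-- The linear map underlying the isomorphism `X`. -/
def linX (s : ℛ.HalfTwist) (V W : HMod k H) :
    V.carrier ⊗[k] W.carrier →ₗ[k] W.carrier ⊗[k] V.carrier :=
  HMod.lin (V := HMod.tensor V W) (W := HMod.tensor W V) (s.X V W).hom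

theorem flipX_apply (V W : HMod k H) (z : V.carrier ⊗[k] W.carrier) :
    flipX s V W z = superFlip k W.carrier V.carrier (linX s V W z) := rfl

theorem isEven_linX (V W : HMod k H) : IsEven (linX s V W) :=
  HMod.lin_even (V := HMod.tensor V W) (W := HMod.tensor W V) (s.X V W).hom

theorem isEven_flipX (V W : HMod k H) : IsEven (flipX s V W) := fun _ _ hz => flipX_mem V W hz

theorem linX_map {V W V' W' : HMod k H} (f : V ⟶ V') (g : W ⟶ W')
    (z : V.carrier ⊗[k] W.carrier) :
    linX s V' W' (TensorProduct.map (HMod.lin f) (HMod.lin g) z) =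
      TensorProduct.map (HMod.lin g) (HMod.lin f) (linX s V W z) :=
  LinearMap.congr_fun (congrArg HMod.lin (s.X_naturality f g)) z

theorem flipX_map {V W V' W' : HMod k H} (f : V ⟶ V') (g : W ⟶ W')
    (z : V.carrier ⊗[k] W.carrier) :
    flipX s V' W' (TensorProduct.map (HMod.lin f) (HMod.lin g) z) =
      TensorProduct.map (HMod.lin f) (HMod.lin g) (flipX s V W z) := by
  rw [flipX_apply, linX_map, superFlip_map (HMod.lin_even g) (HMod.lin_even f), flipX_apply]

theorem linX_linX (V W : HMod k H) (z : V.carrier ⊗[k] W.carrier) :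
    linX s W V (linX s V W z) = z :=
  LinearMap.congr_fun (congrArg HMod.lin (s.X_symm V W)) z

theorem linX_cactus (V W U : HMod k H) (t : (V.carrier ⊗[k] W.carrier) ⊗[k] U.carrier) :
    (linX s V W).lTensor U.carrier (linX s (HMod.tensor V W) U t) =
      TensorProduct.assoc k _ _ _ ((linX s W U).rTensor V.carrier
        (linX s V (HMod.tensor W U) (TensorProduct.assoc k _ _ _ t))) :=
  LinearMap.congr_fun (congrArg HMod.lin (s.X_cactus V W U)) t

/-- The cactus relation with the flips absorbed: the operators correcting `(·|·)_p` on a triple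
tensor product agree for both bracketings. -/
theorem flipX_flipX (V W U : HMod k H) (t : (V.carrier ⊗[k] W.carrier) ⊗[k] U.carrier) :
    TensorProduct.assoc k _ _ _
      ((flipX s V W).rTensor U.carrier (flipX s (HMod.tensor V W) U t)) =
      (flipX s W U).lTensor V.carrier
        (flipX s V (HMod.tensor W U) (TensorProduct.assoc k _ _ _ t)) := by
  have h1 := superFlip_map (k := k) (f := LinearMap.id) (fun _ _ h => h)
    (isEven_linX (s := s) V W) (linX s (HMod.tensor V W) U t)
  have h2 := superFlip_map (k := k) (g := LinearMap.id) (isEven_linX (s := s) W U)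
    (fun _ _ h => h) (linX s V (HMod.tensor W U) (TensorProduct.assoc k _ _ _ t))
  have e1 : ∀ y, (flipX s V W).rTensor U.carrier y = (superFlip k W.carrier V.carrier).rTensor
      U.carrier ((linX s V W).rTensor U.carrier y) := fun y => by
    rw [← LinearMap.comp_apply, ← LinearMap.rTensor_comp]; rfl
  have e2 : ∀ y, (flipX s W U).lTensor V.carrier y = (superFlip k U.carrier W.carrier).lTensor
      V.carrier ((linX s W U).lTensor V.carrier y) := fun y => by
    rw [← LinearMap.comp_apply, ← LinearMap.lTensor_comp]; rfl
  refine (congrArg (TensorProduct.assoc k _ _ _) (e1 _)).trans (Eq.trans ?_ (e2 _).symm)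
  refine (congrArg (fun y => TensorProduct.assoc k _ _ _
    ((superFlip k W.carrier V.carrier).rTensor U.carrier y)) h1.symm).trans ?_
  refine Eq.trans ?_ (congrArg ((superFlip k U.carrier W.carrier).lTensor V.carrier) h2)
  refine (congrArg (fun y => TensorProduct.assoc k _ _ _
    ((superFlip k W.carrier V.carrier).rTensor U.carrier (superFlip k _ _ y)))
    (linX_cactus V W U t)).trans ?_
  exact superFlip_assoc _

/-- Evenness of the maps gives the identity for `(·|·)_p`; naturality of `τ X` transfers it to the
tensor product form. -/
theorem adjoint_tensorHom {V W V' W' : SesqMod D s} (f : V ⟶ W) (g : V' ⟶ W') :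
    adjoint (f ⊗ₘ g) = adjoint f ⊗ₘ adjoint g := by
  rw [adjoint_eq_iff]
  intro z y
  refine (pForm_map (lin_even g) (lin_even (adjoint f)) (form_adjoint f) (form_adjoint g) z
    (flipX s W.toHMod W'.toHMod y)).trans ?_
  exact congrArg (pForm V.form V'.form z)
    (flipX_map (s := s) (V := W.toHMod) (V' := V.toHMod) (W := W'.toHMod) (W' := V'.toHMod)
      (adjoint f) (adjoint g) y).symm

theorem adjoint_associator (V W U : SesqMod D s) :
    adjoint (α_ V W U).hom = (α_ V W U).inv := by
  rw [adjoint_eq_iff]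
  intro (z : (V.carrier ⊗[k] W.carrier) ⊗[k] U.carrier)
    (y : V.carrier ⊗[k] (W.carrier ⊗[k] U.carrier))
  obtain ⟨y, rfl⟩ := (TensorProduct.assoc k V.carrier W.carrier U.carrier).surjective y
  have h1 := pForm_compl₂_left (pForm V.form W.form) U.form
    (isEven_flipX (s := s) V.toHMod W.toHMod) z
    (flipX s (HMod.tensor V.toHMod W.toHMod) U.toHMod y)
  have h2 := pForm_compl₂_right V.form (pForm W.form U.form) (flipX s W.toHMod U.toHMod)
    (TensorProduct.assoc k V.carrier W.carrier U.carrier z)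
    (flipX s V.toHMod (HMod.tensor W.toHMod U.toHMod)
      (TensorProduct.assoc k V.carrier W.carrier U.carrier y))
  rw [← flipX_flipX, pForm_assoc, ← h1] at h2
  refine h2.trans ?_
  exact congrArg (tensorForm (tensor V W) U z)
    ((TensorProduct.assoc k V.carrier W.carrier U.carrier).symm_apply_apply y).symm

/-- Since `X` sends `1 ⊗ v` to `v ⊗ 1`, the right-hand side is the tensor product form of `z` with
`1 ⊗ v`: this is unitarity of the left unitor. -/
theorem form_lid {V : Type*} [AddCommGroup V] [Module k V] [SuperSpace k V]
    (B : V →ₗ⋆[k] V →ₗ[k] k) (z : k ⊗[k] V) (v : V) :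
    B (TensorProduct.lid k V z) v = pForm (unitForm k) B z (superFlip k V k (v ⊗ₜ (1 : k))) := by
  refine homog_tensor_induction (by simp) (fun a b ha hb => by
    simp only [map_add, LinearMap.add_apply, ha, hb]) ?_ z
  intro i j c hc w hw
  refine homog_induction k (fun a b ha hb => by
    simp only [map_add, add_tmul, ha, hb]) ?_ v
  intro l v hv
  rw [superFlip_tmul hv (mem_gr_field (1 : k)), map_smul, pForm_tmul _ _ _ _ hw (mem_gr_field 1),
    unitForm_apply]
  simp [LinearMap.map_smulₛₗ, starRingEnd_apply]

theorem form_rid {V : Type*} [AddCommGroup V] [Module k V] [SuperSpace k V]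
    (B : V →ₗ⋆[k] V →ₗ[k] k) (z : V ⊗[k] k) (v : V) :
    B (TensorProduct.rid k V z) v = pForm B (unitForm k) z (superFlip k k V ((1 : k) ⊗ₜ v)) := by
  refine homog_tensor_induction (by simp) (fun a b ha hb => by
    simp only [map_add, LinearMap.add_apply, ha, hb]) ?_ z
  intro i j w hw c hc
  refine homog_induction k (fun a b ha hb => by
    simp only [map_add, tmul_add, ha, hb]) ?_ v
  intro l v hv
  rw [superFlip_tmul (mem_gr_field (1 : k)) hv, map_smul, pForm_tmul _ _ _ _ (mem_gr_field c) hv,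
    unitForm_apply]
  simp [LinearMap.map_smulₛₗ, starRingEnd_apply, mul_comm]

theorem linX_one_tmul (V : HMod k H) (v : V.carrier) :
    linX s (HMod.unit k H) V ((1 : k) ⊗ₜ[k] v) = v ⊗ₜ[k] (1 : k) :=
  (LinearMap.congr_fun (congrArg HMod.lin (s.X_tensorUnit_left V)) ((1 : k) ⊗ₜ[k] v)).trans
    (congrArg (TensorProduct.rid k V.carrier).symm (one_smul k v))

theorem linX_tmul_one (V : HMod k H) (v : V.carrier) :
    linX s V (HMod.unit k H) (v ⊗ₜ[k] (1 : k)) = (1 : k) ⊗ₜ[k] v :=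
  (LinearMap.congr_fun (congrArg HMod.lin (s.X_tensorUnit_right V)) (v ⊗ₜ[k] (1 : k))).trans
    (congrArg (TensorProduct.lid k V.carrier).symm (one_smul k v))

theorem adjoint_leftUnitor (V : SesqMod D s) : adjoint (λ_ V).hom = (λ_ V).inv := by
  rw [adjoint_eq_iff]
  intro (z : k ⊗[k] V.carrier) v
  exact (form_lid V.form z v).trans (congrArg (fun y => pForm (unitForm k) V.form z
    (superFlip k V.carrier k y)) (linX_one_tmul (s := s) V.toHMod v).symm)

theorem adjoint_rightUnitor (V : SesqMod D s) : adjoint (ρ_ V).hom = (ρ_ V).inv := by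
  rw [adjoint_eq_iff]
  intro (z : V.carrier ⊗[k] k) v
  exact (form_rid V.form z v).trans (congrArg (fun y => pForm V.form (unitForm k) z
    (superFlip k k V.carrier y)) (linX_tmul_one (s := s) V.toHMod v).symm)

theorem linX_braid_inv (V W : HMod k H) (z : W.carrier ⊗[k] V.carrier) :
    linX s V W (act₂ V.act W.act ℛ.Rinv (superFlip k W.carrier V.carrier z)) =
      act₂ W.act V.act ℛ.Rinv (superFlip k V.carrier W.carrier (linX s W V z)) :=
  (LinearMap.congr_fun (congrArg HMod.lin (s.X_comp_braid_inv V W)) z).symm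

/-- The flip is an isometry for `(·|·)_p`, and `R` moves to the second variable as `(† ⊗ †) R =
τ(R⁻¹)`, without a sign because it is even. Together they give the inverse braiding, which commutes
with `X`. -/
theorem adjoint_braid (V W : SesqMod D s) : adjoint (braid V W).hom = (braid V W).inv := by
  rw [adjoint_eq_iff]
  intro (z : V.carrier ⊗[k] W.carrier) (y : W.carrier ⊗[k] V.carrier)
  change pForm W.form V.form (superFlip k V.carrier W.carrier (act₂ V.act W.act ℛ.R z))
    (superFlip k V.carrier W.carrier (linX s W.toHMod V.toHMod y)) =
    pForm V.form W.form z (superFlip k W.carrier V.carrier (linX s V.toHMod W.toHMod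
      (act₂ V.act W.act ℛ.Rinv (superFlip k W.carrier V.carrier y))))
  rw [pForm_superFlip V.form_even W.form_even, linX_braid_inv, superFlip_act₂ W.act_graded
    V.act_graded, superFlip_superFlip, ← D.dag_R]
  refine homog_induction k (V := V.carrier ⊗[k] W.carrier) (fun a b ha hb => by
    simp only [map_add, LinearMap.add_apply, ha, hb]) ?_ z
  intro j z hz
  have h := D.pForm_act₂ V.act_graded W.act_graded V.form_compatible W.form_compatible
    ℛ.R_even hz (linX s W.toHMod V.toHMod y)
  rwa [koszulSign_zero_left, one_mul] at h

/-- The conjugation given by adjoints. -/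
def conjugation : Conjugation k (SesqMod D s) where
  dag := adjoint
  dag_bijective := adjoint_bijective
  dag_linear := adjoint_smul_add
  dag_tensor := adjoint_tensorHom
  dag_comp := adjoint_comp
  dag_associator := adjoint_associator
  dag_leftUnitor := adjoint_leftUnitor
  dag_rightUnitor := adjoint_rightUnitor

/-- The braiding of the category of sesquilinear modules. -/
@[reducible]
def braidedCategory : BraidedCategory (SesqMod D s) where
  braiding := braid
  braiding_naturality_right V _ _ f := ℛ.braidedCategory.braiding_naturality_right V.toHMod f
  braiding_naturality_left f W := ℛ.braidedCategory.braiding_naturality_left f W.toHMod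
  hexagon_forward V W U := ℛ.braidedCategory.hexagon_forward V.toHMod W.toHMod U.toHMod
  hexagon_reverse V W U := ℛ.braidedCategory.hexagon_reverse V.toHMod W.toHMod U.toHMod

instance monoidalPreadditive : MonoidalPreadditive (SesqMod D s) where
  whiskerLeft_zero := fun {V _ _} =>
    hom_ext (TensorProduct.map_zero_right (LinearMap.id : V.carrier →ₗ[k] V.carrier))
  zero_whiskerRight := fun {V _ _} =>
    hom_ext (TensorProduct.map_zero_left (LinearMap.id : V.carrier →ₗ[k] V.carrier))
  whiskerLeft_add := fun {V _ _} f g => hom_ext (TensorProduct.map_add_right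
    (LinearMap.id : V.carrier →ₗ[k] V.carrier) (lin f) (lin g))
  add_whiskerRight := fun {V _ _} f g => hom_ext (TensorProduct.map_add_left
    (lin f) (lin g) (LinearMap.id : V.carrier →ₗ[k] V.carrier))

theorem isTensorCategoryOver : IsTensorCategoryOver k (SesqMod D s) where
  preadditive := monoidalPreadditive
  linear :=
    { whiskerLeft_smul := fun V _ _ r f => hom_ext (TensorProduct.map_smul_right r
        (LinearMap.id : V.carrier →ₗ[k] V.carrier) (lin f))
      smul_whiskerRight := fun r _ _ f V => hom_ext (TensorProduct.map_smul_left r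
        (lin f) (LinearMap.id : V.carrier →ₗ[k] V.carrier)) }
  bijective := by
    refine ⟨fun a b h => ?_, fun f => ⟨show k from lin f (1 : k), ?_⟩⟩
    · have h' : a • (1 : k) = b • (1 : k) := LinearMap.congr_fun (congrArg lin h) (1 : k)
      simpa using h'
    · refine hom_ext (LinearMap.ext fun (c : k) => ?_)
      let F : k →ₗ[k] k := lin f
      have h : F 1 • c = F c := by
        rw [smul_eq_mul, mul_comm, ← smul_eq_mul, ← map_smul, smul_eq_mul, mul_one]
      exact h

end SesqMod

end SuperHopf

end

namespace SuperHopf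

/-! ### Duality in a monoidal category with a conjugation -/

section Conjugation

variable {k : Type*} [Field k] [StarRing k] {C : Type*} [Category* C] [MonoidalCategory C]
  [Preadditive C] [Linear k C]

/-- The inverse of the adjunction bijection involves only the evaluation, so equal evaluations give
equal bijections; the coevaluation is the image of a unitor. -/
theorem coevaluation_eq_of_evaluation_eq {X Y : C} (p q : ExactPairing X Y)
    (h : p.evaluation' = q.evaluation') : p.coevaluation' = q.coevaluation' := by
  have e (r : ExactPairing X Y) :
      @tensorRightHomEquiv C _ _ (𝟙_ C) X Y X r (λ_ X).hom = r.coevaluation' := by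
    have : ((𝟙_ C) ◁ r.coevaluation') ≫ (α_ (𝟙_ C) X Y).inv ≫ (λ_ X).hom ▷ Y =
        (λ_ _).hom ≫ r.coevaluation' := by
      rw [leftUnitor_whiskerRight, Iso.inv_hom_id_assoc, leftUnitor_naturality]
    change (ρ_ _).inv ≫ (𝟙_ C) ◁ r.coevaluation' ≫ (α_ _ _ _).inv ≫ (λ_ X).hom ▷ Y = _
    rw [this, unitors_equal, Iso.inv_hom_id_assoc]
  have e' : @tensorRightHomEquiv C _ _ (𝟙_ C) X Y X p =
      @tensorRightHomEquiv C _ _ (𝟙_ C) X Y X q := by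
    rw [← Equiv.symm_bijective.injective.eq_iff]
    refine Equiv.ext fun f => ?_
    change f ▷ _ ≫ (α_ _ _ _).hom ≫ _ ◁ p.evaluation' ≫ (ρ_ _).hom =
      f ▷ _ ≫ (α_ _ _ _).hom ≫ _ ◁ q.evaluation' ≫ (ρ_ _).hom
    rw [h]
  rw [← e p, ← e q, e']

/-- A morphism into a dual is determined by its contraction with the evaluation; transposes and
comparison maps are identified in this way. -/
theorem whiskerLeft_evaluation_injective {X Y Z : C} (p : ExactPairing X Y) {f g : Z ⟶ X}
    (h : Y ◁ f ≫ p.evaluation' = Y ◁ g ≫ p.evaluation') : f = g := by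
  let : HasLeftDual Y := ⟨X⟩
  have e (f : Z ⟶ X) : tensorLeftHomEquiv Z X Y (𝟙_ C) (Y ◁ f ≫ ε_ X Y) = f ≫ (ρ_ X).inv :=
    tensorLeftHomEquiv_whiskerLeft_comp_evaluation (Z := Y) f
  exact (cancel_mono (ρ_ X).inv).1
    ((e f).symm.trans ((congrArg (tensorLeftHomEquiv Z X Y (𝟙_ C)) h).trans (e g)))

namespace Conjugation

variable (c : Conjugation k C)

theorem dag_id (V : C) : c.dag (𝟙 V) = 𝟙 V := by
  obtain ⟨f, hf⟩ := (c.dag_bijective V V).2 (𝟙 V)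
  have h := c.dag_comp (𝟙 V) f
  rwa [Category.id_comp, hf, Category.id_comp, eq_comm] at h

theorem dag_iso_inv {V W : C} (e : V ≅ W) (h : c.dag e.hom = e.inv) : c.dag e.inv = e.hom := by
  have h1 : c.dag e.inv ≫ c.dag e.hom = 𝟙 V := by rw [← c.dag_comp, e.hom_inv_id, c.dag_id]
  rwa [h, e.comp_inv_eq_id] at h1

theorem dag_whiskerLeft (V : C) {W U : C} (f : W ⟶ U) : c.dag (V ◁ f) = V ◁ c.dag f := by
  rw [← id_tensorHom, c.dag_tensor, c.dag_id, id_tensorHom]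

theorem dag_whiskerRight {W U : C} (f : W ⟶ U) (V : C) : c.dag (f ▷ V) = c.dag f ▷ V := by
  rw [← tensorHom_id, c.dag_tensor, c.dag_id, tensorHom_id]

theorem dag_associator_inv (V W U : C) : c.dag (α_ V W U).inv = (α_ V W U).hom :=
  c.dag_iso_inv _ (c.dag_associator V W U)

theorem dag_leftUnitor_inv (V : C) : c.dag (λ_ V).inv = (λ_ V).hom :=
  c.dag_iso_inv _ (c.dag_leftUnitor V)

theorem dag_rightUnitor_inv (V : C) : c.dag (ρ_ V).inv = (ρ_ V).hom :=
  c.dag_iso_inv _ (c.dag_rightUnitor V)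

/-- The conjugate of an exact pairing. -/
@[reducible]
def dagPairing {X Y : C} (p : ExactPairing X Y) : ExactPairing Y X where
  coevaluation' := c.dag p.evaluation'
  evaluation' := c.dag p.coevaluation'
  coevaluation_evaluation' := by
    have h := congrArg c.dag p.evaluation_coevaluation'
    simpa only [c.dag_comp, c.dag_whiskerLeft, c.dag_whiskerRight, c.dag_associator,
      c.dag_leftUnitor, c.dag_rightUnitor_inv, Category.assoc] using h
  evaluation_coevaluation' := by
    have h := congrArg c.dag p.coevaluation_evaluation'
    simpa only [c.dag_comp, c.dag_whiskerLeft, c.dag_whiskerRight, c.dag_associator_inv,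
      c.dag_rightUnitor, c.dag_leftUnitor_inv, Category.assoc] using h

theorem leftAdjointMate_dag {V W V' W' : C} (p : ExactPairing V V') (q : ExactPairing W W')
    (f : V ⟶ W) :
    @leftAdjointMate C _ _ W V (@HasLeftDual.mk C _ _ W W' (c.dagPairing q))
        (@HasLeftDual.mk C _ _ V V' (c.dagPairing p)) (c.dag f) =
      c.dag (@rightAdjointMate C _ _ V W (@HasRightDual.mk C _ _ V V' p)
        (@HasRightDual.mk C _ _ W W' q) f) := by
  have h := congrArg c.dag (@coevaluation_comp_rightAdjointMate C _ _ V W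
    (@HasRightDual.mk C _ _ V V' p) (@HasRightDual.mk C _ _ W W' q) f)
  rw [c.dag_comp, c.dag_comp, c.dag_whiskerLeft, c.dag_whiskerRight] at h
  have h2 := @leftAdjointMate_comp_evaluation C _ _ W V
    (@HasLeftDual.mk C _ _ W W' (c.dagPairing q)) (@HasLeftDual.mk C _ _ V V' (c.dagPairing p))
    (c.dag f)
  refine whiskerLeft_evaluation_injective (c.dagPairing q) (h2.trans h.symm)

theorem dag_tensor_coevaluation {X₁ X₂ Y₁ Y₂ : C} (p₁ : ExactPairing X₁ Y₁)
    (p₂ : ExactPairing X₂ Y₂) :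
    c.dag (@ExactPairing.tensor C _ _ X₁ X₂ Y₁ Y₂ p₁ p₂).coevaluation' =
      (@ExactPairing.tensor C _ _ Y₂ Y₁ X₂ X₁ (c.dagPairing p₂)
        (c.dagPairing p₁)).evaluation' := by
  rw [show (@ExactPairing.tensor C _ _ X₁ X₂ Y₁ Y₂ p₁ p₂).coevaluation' =
    p₁.coevaluation' ⊗≫ (X₁ ◁ p₂.coevaluation') ▷ Y₁ ⊗≫ 𝟙 _ from rfl,
    show (@ExactPairing.tensor C _ _ Y₂ Y₁ X₂ X₁ (c.dagPairing p₂)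
        (c.dagPairing p₁)).evaluation' = 𝟙 _ ⊗≫ X₁ ◁ (c.dag p₂.coevaluation' ▷ Y₁) ⊗≫
          c.dag p₁.coevaluation' from rfl]
  simp [monoidalComp, c.dag_comp, c.dag_whiskerLeft, c.dag_whiskerRight, c.dag_associator,
    c.dag_associator_inv, c.dag_leftUnitor_inv]

/-- Conjugating the equation that defines the comparison map for one duality gives the defining
equation of its adjoint for the conjugate duality, with source and target exchanged. Unitarity
replaces the adjoint by the inverse, so the two comparison maps agree. -/
theorem rightDualIso_tensor_eq_leftDualIso_tensor {X₁ X₂ Y₁ Y₂ Y : C} (p₁ : ExactPairing X₁ Y₁)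
    (p₂ : ExactPairing X₂ Y₂) (p : ExactPairing (X₁ ⊗ X₂) Y)
    (h : c.dag (rightDualIso (@ExactPairing.tensor C _ _ X₁ X₂ Y₁ Y₂ p₁ p₂) p).hom =
      (rightDualIso (@ExactPairing.tensor C _ _ X₁ X₂ Y₁ Y₂ p₁ p₂) p).inv) :
    (rightDualIso (@ExactPairing.tensor C _ _ X₁ X₂ Y₁ Y₂ p₁ p₂) p).hom =
      (leftDualIso (@ExactPairing.tensor C _ _ Y₂ Y₁ X₂ X₁ (c.dagPairing p₂) (c.dagPairing p₁))
        (c.dagPairing p)).hom := by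
  let q := @ExactPairing.tensor C _ _ X₁ X₂ Y₁ Y₂ p₁ p₂
  let q' := @ExactPairing.tensor C _ _ Y₂ Y₁ X₂ X₁ (c.dagPairing p₂) (c.dagPairing p₁)
  have h1 := congrArg c.dag (@coevaluation_comp_rightAdjointMate C _ _ (X₁ ⊗ X₂) (X₁ ⊗ X₂)
    (@HasRightDual.mk C _ _ _ Y p) (@HasRightDual.mk C _ _ _ (Y₂ ⊗ Y₁) q) (𝟙 _))
  have h2 := @leftAdjointMate_comp_evaluation C _ _ (X₁ ⊗ X₂) (X₁ ⊗ X₂)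
    (@HasLeftDual.mk C _ _ _ Y (c.dagPairing p)) (@HasLeftDual.mk C _ _ _ (Y₂ ⊗ Y₁) q') (𝟙 _)
  rw [c.dag_comp, c.dag_comp, c.dag_whiskerLeft, id_whiskerRight, c.dag_id, Category.id_comp] at h1
  rw [id_whiskerRight, Category.id_comp] at h2
  have h3 : (X₁ ⊗ X₂) ◁ (rightDualIso q p).inv ≫ q'.evaluation' = (c.dagPairing p).evaluation' := by
    rw [← h, ← dag_tensor_coevaluation]
    exact h1
  refine whiskerLeft_evaluation_injective (c.dagPairing p) (Eq.trans ?_ h2.symm)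
  rw [← h3, ← MonoidalCategory.whiskerLeft_comp_assoc, Iso.hom_inv_id,
    MonoidalCategory.whiskerLeft_id, Category.id_comp]
  rfl

end Conjugation

end Conjugation

end SuperHopf

noncomputable section

namespace SuperHopf

/-! ### The right duality as the conjugate of the left one -/

section Pairings

variable {k : Type*} [Field k] [StarRing k]
variable {V W : Type*} [AddCommGroup V] [Module k V] [AddCommGroup W] [Module k W]
  [SuperSpace k V] [SuperSpace k W]

theorem exists_flat_of_mem [FiniteDimensional k V] {B : V →ₗ⋆[k] V →ₗ[k] k} (hB : B.Nondegenerate)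
    (eB : EvenForm B) {i : ZMod 2} {φ : Module.Dual k V} (hφ : φ ∈ gr k i) :
    ∃ v ∈ gr k (V := V) i, B v = φ := by
  obtain ⟨v, rfl⟩ := (flat_bijective hB.1).2 φ
  exact ⟨v, mem_of_flat_mem hB eB hφ, rfl⟩

theorem pForm_dualForm_tmul [FiniteDimensional k V] {B : V →ₗ⋆[k] V →ₗ[k] k}
    (hB : B.Nondegenerate) (z : V ⊗[k] Module.Dual k V) {i j : ZMod 2} {v w : V}
    (hv : v ∈ gr k i) (hw : w ∈ gr k j) :
    pForm B (dualForm B hB) z (v ⊗ₜ (B w : Module.Dual k V)) =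
      koszulSign k j i * B (tensorDualHom k V z w) v := by
  refine homog_tensor_induction (by simp) (fun a b ha hb => by
    simp only [map_add, LinearMap.add_apply, ha, hb, mul_add]) ?_ z
  intro p q u hu φ hφ
  rw [pForm_tmul _ _ _ _ hφ hv, dualForm_apply, tensorDualHom_tmul, LinearMap.map_smulₛₗ,
    LinearMap.smul_apply, smul_eq_mul, starRingEnd_apply]
  by_cases h : φ w = 0
  · simp [h]
  · rw [eq_of_dual_apply_ne_zero hw hφ h]
    ring

/-- A tensor in `V ⊗ V*` is an operator; pairing with it amounts to evaluating after the adjoint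
operator. For the coevaluation the operator is the identity, and the pairing is plain evaluation
after the flip. -/
theorem pForm_dualForm_eq [FiniteDimensional k V] {B : V →ₗ⋆[k] V →ₗ[k] k}
    (hB : B.Nondegenerate) (eB : EvenForm B) {a : V ⊗[k] Module.Dual k V} {T : Module.End k V}
    (hT : ∀ w v, B (tensorDualHom k V a w) v = B w (T v)) (z : V ⊗[k] Module.Dual k V) :
    pForm B (dualForm B hB) a z = contractLeft k V (T.lTensor (Module.Dual k V)
      (superFlip k V (Module.Dual k V) z)) := by
  refine homog_tensor_induction (by simp) (fun a b ha hb => by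
    simp only [map_add, ha, hb]) ?_ z
  intro i j v hv φ hφ
  obtain ⟨w, hw, rfl⟩ := exists_flat_of_mem hB eB hφ
  rw [pForm_dualForm_tmul hB _ hv hw, superFlip_tmul hv hφ, hT, map_smul, map_smul,
    LinearMap.lTensor_tmul, contractLeft_apply, koszulSign_comm, smul_eq_mul]

theorem pForm_coevaluation [FiniteDimensional k V] {B : V →ₗ⋆[k] V →ₗ[k] k}
    (hB : B.Nondegenerate) (eB : EvenForm B) (c : k) (z : Module.Dual k V ⊗[k] V) :
    pForm B (dualForm B hB) (coevaluation k V c) (superFlip k (Module.Dual k V) V z) =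
      star c * contractLeft k V z := by
  have h := pForm_dualForm_eq hB eB (a := coevaluation k V 1) (T := LinearMap.id)
    (fun w v => by rw [tensorDualHom_coevaluation]; rfl) (superFlip k (Module.Dual k V) V z)
  rw [superFlip_superFlip, LinearMap.lTensor_id, LinearMap.id_apply] at h
  rw [coevaluation_apply_eq_smul, LinearMap.map_smulₛₗ, LinearMap.smul_apply, h,
    starRingEnd_apply, smul_eq_mul]

theorem superFlip_rTensor {T : Module.End k V} (hT : IsEven T) (z : V ⊗[k] W) :
    superFlip k V W (T.rTensor W z) = T.lTensor W (superFlip k V W z) :=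
  superFlip_map hT (g := LinearMap.id) (fun _ _ h => h) z

theorem pForm_lTensor_superFlip_coevaluation [FiniteDimensional k V] {B : V →ₗ⋆[k] V →ₗ[k] k}
    (hB : B.Nondegenerate) (eB : EvenForm B) {T T' : Module.End k V} (eT' : IsEven T')
    (hT : ∀ w v, B (T' w) v = B w (T v)) (c : k) (z : V ⊗[k] Module.Dual k V) :
    pForm (dualForm B hB) B (T'.lTensor (Module.Dual k V) (superFlip k V (Module.Dual k V)
        (coevaluation k V c))) (superFlip k V (Module.Dual k V) z) =
      star c * contractLeft k V (T.lTensor (Module.Dual k V)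
        (superFlip k V (Module.Dual k V) z)) := by
  rw [← superFlip_rTensor eT', pForm_superFlip eB (dualForm_even hB eB),
    coevaluation_apply_eq_smul, map_smul, LinearMap.map_smulₛₗ, LinearMap.smul_apply,
    pForm_dualForm_eq hB eB (T := T), starRingEnd_apply, smul_eq_mul]
  intro w v
  rw [tensorDualHom_rTensor, tensorDualHom_coevaluation, mul_one, hT]

/-- Half of a zigzag read in `End V`: it composes `T` with the operator of `y`. Hence the zigzag
identity makes that operator the inverse of `T`, which determines `y`. -/
theorem rTensor_contractLeft_superFlip {T : Module.End k V} (hT : IsEven T)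
    {y : Module.Dual k V ⊗[k] V} (hy : y ∈ gr k (V := Module.Dual k V ⊗[k] V) 0) (v : V) :
    TensorProduct.lid k V ((contractLeft k V ∘ₗ T.lTensor (Module.Dual k V) ∘ₗ
        superFlip k V (Module.Dual k V)).rTensor V
          ((TensorProduct.assoc k V (Module.Dual k V) V).symm (v ⊗ₜ y))) =
      tensorDualHom k V (superFlip k (Module.Dual k V) V y) (T v) := by
  refine homog_induction k (fun a b ha hb => by
    simp only [map_add, add_tmul, ha, hb]) ?_ v
  intro p v hv
  refine even_tensor_induction (by simp) (fun a b ha hb => by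
    simp only [map_add, tmul_add, ha, hb, LinearMap.add_apply]) ?_ y hy
  intro i φ hφ w hw
  rw [assoc_symm_tmul, LinearMap.rTensor_tmul, superFlip_tmul hφ hw, lid_tmul,
    LinearMap.comp_apply, LinearMap.comp_apply, superFlip_tmul hv hφ, map_smul, map_smul,
    map_smul, LinearMap.smul_apply, LinearMap.lTensor_tmul, contractLeft_apply,
    tensorDualHom_tmul, smul_smul, smul_eq_mul]
  by_cases h : φ (T v) = 0
  · simp [h]
  · rw [eq_of_dual_apply_ne_zero (hT p v hv) hφ h]

theorem eq_lTensor_superFlip_coevaluation [FiniteDimensional k V] {T T' : Module.End k V}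
    (eT : IsEven T) (eT' : IsEven T') (hT : ∀ v, T (T' v) = v) {y : Module.Dual k V ⊗[k] V}
    (hy : y ∈ gr k (V := Module.Dual k V ⊗[k] V) 0)
    (h : ∀ v, (contractLeft k V ∘ₗ T.lTensor (Module.Dual k V) ∘ₗ
        superFlip k V (Module.Dual k V)).rTensor V
          ((TensorProduct.assoc k V (Module.Dual k V) V).symm (v ⊗ₜ y)) = (1 : k) ⊗ₜ v) :
    y = T'.lTensor (Module.Dual k V) (superFlip k V (Module.Dual k V) (coevaluation k V 1)) := by
  rw [← superFlip_rTensor eT', ← superFlip_superFlip y]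
  congr 1
  apply tensorDualHom_injective
  rw [tensorDualHom_rTensor, tensorDualHom_coevaluation, mul_one]
  refine LinearMap.ext fun v => ?_
  have h2 := rTensor_contractLeft_superFlip eT hy (T' v)
  rw [h, lid_tmul, one_smul, hT] at h2
  exact h2.symm

end Pairings

theorem RibbonStructure.pivot_even {k H : Type*} [Field k] [Ring H] [Algebra k H] [Coalgebra k H]
    [SuperSpace k H] [HopfSuperalgebra k H] (ℛ : RibbonStructure k H) :
    ℛ.pivot ∈ gr k (V := H) 0 := by
  have h1 : ℛ.drinfeld ∈ gr k (V := H) 0 := by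
    refine even_tensor_induction (p := fun x => LinearMap.mul' k H
      ((antipode k H).rTensor H (superFlip k H H x)) ∈ gr k (V := H) 0) (by simp)
      (fun a b ha hb => by simp only [map_add]; exact Submodule.add_mem _ ha hb) ?_ ℛ.R ℛ.R_even
    intro i a ha b hb
    rw [superFlip_tmul ha hb, map_smul, map_smul]
    refine Submodule.smul_mem _ _ ?_
    have h := mul_mem_gr (HopfSuperalgebra.antipode_mem i b hb) ha
    rwa [CharTwo.add_self_eq_zero] at h
  have h2 : ((ℛ.θ⁻¹ : Hˣ) : H) ∈ gr k (V := H) 0 := by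
    obtain ⟨a, b, ha, hb, h⟩ := Submodule.codisjoint_iff_exists_add_eq.1
      (SuperSpace.isCompl (k := k) (V := H)).codisjoint ((ℛ.θ⁻¹ : Hˣ) : H)
    -- `b` is the odd part of `θ⁻¹`. The product `θ b` is odd, yet equals the even element `1 - θ
    -- a`; so it is zero, and `b = 0` as `θ` is a unit.
    have e : (ℛ.θ : H) * b = 1 - (ℛ.θ : H) * a := by
      rw [eq_sub_iff_add_eq', ← mul_add, h, Units.mul_inv]
    have hb' : (ℛ.θ : H) * b = 0 := by
      refine eq_zero_of_mem_gr_of_mem_gr_add_one (k := k) (i := 0) ?_ (mul_mem_gr ℛ.θ_even hb)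
      rw [e]
      exact Submodule.sub_mem _ one_mem_gr (mul_mem_gr ℛ.θ_even ha)
    rw [Units.mul_right_eq_zero] at hb'
    rw [← h, hb', add_zero]
    exact ha
  exact mul_mem_gr h1 h2

namespace SesqMod

variable {k : Type u} {H : Type w} [Field k] [StarRing k] [Ring H] [Algebra k H] [Coalgebra k H]
  [SuperSpace k H] [HopfSuperalgebra k H] {ℛ : RibbonStructure k H} {D : Dagger ℛ}
  {s : ℛ.HalfTwist}

/-- The left duality. -/
@[reducible]
def leftPairing (V : SesqMod D s) : ExactPairing V (dual V) where
  coevaluation' := V.toHMod.coev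
  evaluation' := V.toHMod.ev
  coevaluation_evaluation' := hom_ext (contractLeft_assoc_coevaluation k V.carrier)
  evaluation_coevaluation' := hom_ext (contractLeft_assoc_coevaluation' k V.carrier)

/-- The right duality. -/
@[reducible]
def rightPairing (V : SesqMod D s) : ExactPairing (dual V) V :=
  conjugation.dagPairing (leftPairing V)

/-- Pairing with the coevaluation through `τ X` is evaluation after `X`, so the adjoint of the
coevaluation is `ev ∘ X`, where the pivot has already been found. -/
theorem lin_rightPairing_evaluation (V : SesqMod D s) :
    lin (rightPairing V).evaluation' = V.toHMod.rightEv ℛ := by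
  let G := (s.X V.toHMod (HMod.dual V.toHMod)).hom ≫ V.toHMod.ev
  let F : V ⊗ dual V ⟶ 𝟙_ (SesqMod D s) := G
  have h : adjoint (leftPairing V).coevaluation' = F := by
    rw [adjoint_eq_iff]
    intro c z
    exact pForm_coevaluation V.form_nondegenerate V.form_even c
      (linX s V.toHMod (HMod.dual V.toHMod) z)
  exact (congrArg lin h).trans (HMod.lin_X_comp_ev s V.toHMod)

theorem inverse_pivot (D : Dagger ℛ) : Ring.inverse ℛ.pivot = D.dag ℛ.pivot :=
  Ring.inverse_unit ⟨ℛ.pivot, D.dag ℛ.pivot, D.pivot_mul_dag, D.dag_pivot_mul⟩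

theorem isEven_act {V : HMod k H} {x : H} (hx : x ∈ gr k (V := H) 0) : IsEven (V.act x) := by
  intro i v hv
  have h := V.act_graded 0 i x hx v hv
  rwa [zero_add] at h

theorem act_inverse_pivot_even (D : Dagger ℛ) (V : HMod k H) :
    IsEven (V.act (Ring.inverse ℛ.pivot)) := by
  rw [inverse_pivot D]
  exact isEven_act (D.dag_mem 0 _ ℛ.pivot_even)

theorem act_pivot_inverse (D : Dagger ℛ) (V : HMod k H) (v : V.carrier) :
    V.act ℛ.pivot (V.act (Ring.inverse ℛ.pivot) v) = v := by
  rw [inverse_pivot D, ← Module.End.mul_apply, ← map_mul, D.pivot_mul_dag, map_one,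
    Module.End.one_apply]

theorem act_inverse_pivot (D : Dagger ℛ) (V : HMod k H) (v : V.carrier) :
    V.act (Ring.inverse ℛ.pivot) (V.act ℛ.pivot v) = v := by
  rw [inverse_pivot D, ← Module.End.mul_apply, ← map_mul, D.dag_pivot_mul, map_one,
    Module.End.one_apply]

/-- This is `g† = g⁻¹`: the adjoint of the action of `g⁻¹` is that of `g`. -/
theorem form_act_inverse_pivot (V : SesqMod D s) (w v : V.carrier) :
    V.form (V.act (Ring.inverse ℛ.pivot) w) v = V.form w (V.act ℛ.pivot v) := by
  obtain ⟨w, rfl⟩ : ∃ u, V.act ℛ.pivot u = w := ⟨_, act_pivot_inverse D V.toHMod w⟩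
  rw [act_inverse_pivot D]
  refine homog_induction k (fun a b ha hb => by
    simp only [map_add, LinearMap.add_apply, ha, hb]) ?_ w
  intro i w hw
  rw [V.form_compatible 0 i _ ℛ.pivot_even w hw, ← inverse_pivot D, act_inverse_pivot D,
    koszulSign_zero_left, one_mul]

theorem lin_rightPairing_coevaluation (V : SesqMod D s) :
    lin (rightPairing V).coevaluation' = V.toHMod.rightCoev ℛ := by
  have h1 : (1 : k) ∈ gr k (V := k) 0 := mem_gr_field 1
  have hz := congrArg lin (rightPairing V).coevaluation_evaluation'
  have h := eq_lTensor_superFlip_coevaluation (isEven_act ℛ.pivot_even)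
    (act_inverse_pivot_even D V.toHMod) (act_pivot_inverse D V.toHMod)
    (y := lin (rightPairing V).coevaluation' (1 : k))
    (lin_even (rightPairing V).coevaluation' 0 (1 : k) h1) (fun v => by
      have e := LinearMap.congr_fun hz (v ⊗ₜ[k] (1 : k))
      have e2 : (HMod.rightEv ℛ V.toHMod).rTensor V.carrier
          ((TensorProduct.assoc k V.carrier (Module.Dual k V.carrier) V.carrier).symm
            (v ⊗ₜ[k] (show Module.Dual k V.carrier ⊗[k] V.carrier from
              lin (rightPairing V).coevaluation' (1 : k)))) =
          (TensorProduct.lid k V.carrier).symm ((1 : k) • v) := by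
        rw [← lin_rightPairing_evaluation]
        exact e
      rw [one_smul] at e2
      exact e2)
  refine LinearMap.ext fun (c : k) => ?_
  let F : k →ₗ[k] Module.Dual k V.carrier ⊗[k] V.carrier := lin (rightPairing V).coevaluation'
  have hc : ∀ G : k →ₗ[k] Module.Dual k V.carrier ⊗[k] V.carrier, G c = c • G 1 := fun G => by
    rw [← map_smul, smul_eq_mul, mul_one]
  exact (hc F).trans ((congrArg (c • ·) h).trans (hc (V.toHMod.rightCoev ℛ)).symm)

/-- The adjoint of `g⁻¹` is `g`, so pairing with the right coevaluation is the right evaluation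
after `X`. That is `ev ∘ X ∘ X`, which is `ev` because `X` is an involution. -/
theorem adjoint_rightPairing_coevaluation (V : SesqMod D s) :
    adjoint (rightPairing V).coevaluation' = (leftPairing V).evaluation' := by
  rw [adjoint_eq_iff, lin_rightPairing_coevaluation]
  intro (c : k) (z : Module.Dual k V.carrier ⊗[k] V.carrier)
  have h1 := pForm_lTensor_superFlip_coevaluation V.form_nondegenerate V.form_even
    (act_inverse_pivot_even D V.toHMod) (form_act_inverse_pivot V) c
    (linX s (HMod.dual V.toHMod) V.toHMod z)
  refine h1.trans ?_
  have h2 := LinearMap.congr_fun (HMod.lin_X_comp_ev (ℛ := ℛ) s V.toHMod)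
    (linX s (HMod.dual V.toHMod) V.toHMod z)
  refine (congrArg (star c * ·) h2.symm).trans ?_
  exact congrArg (fun y => star c * contractLeft k V.carrier y)
    (linX_linX (s := s) (HMod.dual V.toHMod) V.toHMod z)

theorem adjoint_rightPairing_evaluation (V : SesqMod D s) :
    adjoint (rightPairing V).evaluation' = (leftPairing V).coevaluation' :=
  coevaluation_eq_of_evaluation_eq (conjugation.dagPairing (rightPairing V)) (leftPairing V)
    (adjoint_rightPairing_coevaluation V)

end SesqMod

end SuperHopf

end

noncomputable section

namespace SuperHopf

/-! ### `X` on duals as the transpose of `X` -/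

section DualTensor

variable {k : Type*} [Field k]
variable {V W : Type*} [AddCommGroup V] [Module k V] [AddCommGroup W] [Module k W]
  [SuperSpace k V] [SuperSpace k W]

variable (k V W) in
/-- The map `W* ⊗ V* → (V ⊗ W)*`. -/
def dualTensorDual : Module.Dual k W ⊗[k] Module.Dual k V →ₗ[k] Module.Dual k (V ⊗[k] W) :=
  dualDistrib k V W ∘ₗ (TensorProduct.comm k (Module.Dual k W) (Module.Dual k V)).toLinearMap

@[simp]
theorem dualTensorDual_tmul (ψ : Module.Dual k W) (φ : Module.Dual k V) (v : V) (w : W) :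
    dualTensorDual k V W (ψ ⊗ₜ φ) (v ⊗ₜ w) = φ v * ψ w := rfl

/-- Elements act on duals through the antipode, so an even `x` acts as the transpose of `(S ⊗ S) x`.
For `R` this is `R` itself, whence the braiding of duals is the transpose of the braiding. -/
theorem superFlip_dualTensorDual_act₂ {H : Type*} [Ring H] [Algebra k H] [Coalgebra k H]
    [SuperSpace k H] [HopfSuperalgebra k H] {ρ : H →ₐ[k] Module.End k V}
    {ρ' : H →ₐ[k] Module.End k W} (hρ : IsGradedAct ρ) (hρ' : IsGradedAct ρ') {x : H ⊗[k] H}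
    (hx : x ∈ gr k (V := H ⊗[k] H) 0) (z : Module.Dual k V ⊗[k] Module.Dual k W) (y : V ⊗[k] W) :
    dualTensorDual k V W (superFlip k (Module.Dual k V) (Module.Dual k W)
      (act₂ (dualAct ρ hρ) (dualAct ρ' hρ') x z)) y =
    dualTensorDual k W V z (superFlip k V W (act₂ ρ ρ'
      (TensorProduct.map (antipode k H) (antipode k H) x) y)) := by
  refine even_tensor_induction (by simp) (fun a b ha hb => by
    simp only [map_add, LinearMap.add_apply, ha, hb]) ?_ x hx
  intro i a ha b hb
  refine homog_tensor_induction (by simp) (fun a b ha hb => by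
    simp only [map_add, LinearMap.add_apply, ha, hb]) ?_ z
  intro p q φ hφ ψ hψ
  refine homog_tensor_induction (by simp) (fun a b ha hb => by
    simp only [map_add, ha, hb]) ?_ y
  intro r t v hv w hw
  have hSb : antipode k H b ∈ gr k i := HopfSuperalgebra.antipode_mem i b hb
  have hSa : antipode k H a ∈ gr k i := HopfSuperalgebra.antipode_mem i a ha
  rw [act₂_tmul _ _ _ _ hb hφ, map_smul, superFlip_tmul (dualAct_graded hρ i p a ha φ hφ)
    (dualAct_graded hρ' i q b hb ψ hψ), TensorProduct.map_tmul, act₂_tmul _ _ _ _ hSb hv,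
    map_smul (superFlip k V W), superFlip_tmul (hρ i r _ hSa v hv) (hρ' i t _ hSb w hw)]
  simp only [map_smul, LinearMap.smul_apply, dualTensorDual_tmul, smul_eq_mul]
  have e : dualAct ρ hρ a φ v = koszulSign k i p * φ (ρ (antipode k H a) v) :=
    dualActLin_apply ρ ha hφ v
  have e' : dualAct ρ' hρ' b ψ w = koszulSign k i q * ψ (ρ' (antipode k H b) w) :=
    dualActLin_apply ρ' hb hψ w
  rw [e, e']
  by_cases h : φ (ρ (antipode k H a) v) = 0
  · simp [h]
  by_cases h' : ψ (ρ' (antipode k H b) w) = 0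
  · simp [h']
  obtain rfl := eq_of_dual_apply_ne_zero (hρ i r _ hSa v hv) hφ h
  obtain rfl := eq_of_dual_apply_ne_zero (hρ' i t _ hSb w hw) hψ h'
  have key : koszulSign k i (i + r) * koszulSign k (i + (i + r)) (i + (i + t)) *
      koszulSign k i (i + r) * koszulSign k i (i + t) =
      koszulSign k i r * koszulSign k (i + r) (i + t) := by
    simp only [koszulSign_eq_paritySign, paritySign_mul]
    congr 1
    clear * -
    revert i r t
    decide
  linear_combination (φ (ρ (antipode k H a) v) * ψ (ρ' (antipode k H b) w)) * key

end DualTensor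

namespace HMod

variable {k : Type u} {H : Type w} [Field k] [Ring H] [Algebra k H] [Coalgebra k H]
  [SuperSpace k H] [HopfSuperalgebra k H] {ℛ : RibbonStructure k H}

theorem dualMap_comp {V W U : HMod k H} (f : V ⟶ W) (g : W ⟶ U) :
    dualMap (f ≫ g) = dualMap g ≫ dualMap f := rfl

theorem braid_comp_dualTensor {V W : HMod k H} (e : dual W ⊗ dual V ⟶ dual (V ⊗ W))
    (e' : dual V ⊗ dual W ⟶ dual (W ⊗ V)) (he : lin e = dualTensorDual k V.carrier W.carrier)
    (he' : lin e' = dualTensorDual k W.carrier V.carrier) :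
    (ℛ.braid (dual V) (dual W)).hom ≫ e = e' ≫ dualMap (ℛ.braid V W).hom := by
  refine hom_ext (LinearMap.ext fun (z : Module.Dual k V.carrier ⊗[k] Module.Dual k W.carrier) =>
    LinearMap.ext fun (y : V.carrier ⊗[k] W.carrier) => ?_)
  have h := superFlip_dualTensorDual_act₂ V.act_graded W.act_graded ℛ.R_even z y
  rw [ℛ.map_antipode_R] at h
  refine (LinearMap.congr_fun (LinearMap.congr_fun he _) y).trans (h.trans ?_)
  exact (LinearMap.congr_fun (LinearMap.congr_fun he' z) _).symm

theorem tensorHom_dualMap_comp_dualTensor {V W V' W' : HMod k H} (f : V ⟶ V') (g : W ⟶ W')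
    (e : dual V ⊗ dual W ⟶ dual (W ⊗ V)) (e' : dual V' ⊗ dual W' ⟶ dual (W' ⊗ V'))
    (he : lin e = dualTensorDual k W.carrier V.carrier)
    (he' : lin e' = dualTensorDual k W'.carrier V'.carrier) :
    (dualMap f ⊗ₘ dualMap g) ≫ e = e' ≫ dualMap (g ⊗ₘ f) := by
  refine hom_ext (TensorProduct.ext' fun (φ : Module.Dual k V'.carrier)
    (ψ : Module.Dual k W'.carrier) => TensorProduct.ext' fun w v => ?_)
  exact (LinearMap.congr_fun (LinearMap.congr_fun he _) (w ⊗ₜ v)).trans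
    (LinearMap.congr_fun (LinearMap.congr_fun he' (φ ⊗ₜ ψ))
      (TensorProduct.map (lin g) (lin f) (w ⊗ₜ v))).symm

/-- Braiding and half twists of duals are transposes of the originals, but transposing reverses
composition; naturality lets the half twists change sides so that `X` keeps its shape. -/
theorem X_comp_dualTensor (s : ℛ.HalfTwist) {V W : HMod k H}
    (e : dual W ⊗ dual V ⟶ dual (V ⊗ W)) (e' : dual V ⊗ dual W ⟶ dual (W ⊗ V))
    (he : lin e = dualTensorDual k V.carrier W.carrier)
    (he' : lin e' = dualTensorDual k W.carrier V.carrier) :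
    (s.X (dual V) (dual W)).hom ≫ e = e' ≫ dualMap (s.X V W).hom := by
  let := ℛ.braidedCategory
  have h1 : (s.X (dual V) (dual W)).hom = (tw s.iso (dual V) ⊗ₘ tw s.iso (dual W)) ≫
      (ℛ.braid (dual V) (dual W)).hom ≫ twInv s.iso (dual W ⊗ dual V) := rfl
  have h2 : (s.X V W).hom = (tw s.iso V ⊗ₘ tw s.iso W) ≫ (ℛ.braid V W).hom ≫
      twInv s.iso (W ⊗ V) := rfl
  have h3 : (s.X V W).hom = twInv s.iso (V ⊗ W) ≫ (ℛ.braid V W).hom ≫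
      (tw s.iso W ⊗ₘ tw s.iso V) := by
    rw [h2, ← ℛ.braid_naturality, ← twInv_naturality, Category.assoc]
  have h4 : ∀ U : HMod k H, twInv s.iso (dual U) = dualMap (twInv s.iso U) := by
    intro U
    have h5 : dualMap (twInv s.iso U) ≫ tw s.iso (dual U) = 𝟙 _ := by
      have : tw s.iso (dual U) = dualMap (tw s.iso U) := s.dual U
      rw [this, ← dualMap_comp, tw_twInv]
      rfl
    rw [← Category.id_comp (twInv s.iso (dual U)), ← h5, Category.assoc, tw_twInv,
      Category.comp_id]
  have h6 : ∀ U : HMod k H, tw s.iso (dual U) = dualMap (tw s.iso U) := s.dual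
  rw [h1, h3, Category.assoc, Category.assoc, ← twInv_naturality, h4, reassoc_of%
    braid_comp_dualTensor e e' he he', h6, h6, reassoc_of% tensorHom_dualMap_comp_dualTensor
    (tw s.iso V) (tw s.iso W) e' e' he' he', dualMap_comp, dualMap_comp, Category.assoc]

end HMod

end SuperHopf

end

noncomputable section

namespace SuperHopf

/-! ### Unitarity of `W* ⊗ V* ≅ (V ⊗ W)*` and the pivotal structure -/

section DualTensorForm

variable {k : Type*} [Field k] [StarRing k]
variable {V W : Type*} [AddCommGroup V] [Module k V] [AddCommGroup W] [Module k W]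
  [SuperSpace k V] [SuperSpace k W]

/-- For even forms the flip sign and the sign of `(·|·)_p` cancel wherever the value is non-zero,
which matches the unsigned identification of `V* ⊗ W*` with `(W ⊗ V)*`. -/
theorem pForm_superFlip_apply {B : V →ₗ⋆[k] V →ₗ[k] k} {C : W →ₗ⋆[k] W →ₗ[k] k}
    (eB : EvenForm B) (eC : EvenForm C) (z : V ⊗[k] W) (y : W ⊗[k] V) :
    pForm B C z (superFlip k W V y) = dualTensorDual k W V (TensorProduct.map B C z) y := by
  refine homog_tensor_induction (by simp) (fun a b ha hb => by
    simp only [map_add, LinearMap.add_apply, ha, hb]) ?_ z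
  intro i j v hv w hw
  refine homog_tensor_induction (by simp) (fun a b ha hb => by simp only [map_add, ha, hb]) ?_ y
  intro p q w' hw' v' hv'
  rw [superFlip_tmul hw' hv', map_smul, pForm_tmul _ _ _ _ hw hv', TensorProduct.map_tmul]
  change koszulSign k p q * (koszulSign k j q * (B v v' * C w w')) = C w w' * B v v'
  by_cases h : j = p
  · rw [h, ← mul_assoc, koszulSign_mul_self, one_mul, mul_comm]
  · simp [eC j p h w hw w' hw']

theorem pForm_dualForm_superFlip [FiniteDimensional k V] [FiniteDimensional k W]
    {B : V →ₗ⋆[k] V →ₗ[k] k} {C : W →ₗ⋆[k] W →ₗ[k] k} (hB : B.Nondegenerate)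
    (hC : C.Nondegenerate) (eB : EvenForm B) (eC : EvenForm C)
    (x : Module.Dual k W ⊗[k] Module.Dual k V) (z : V ⊗[k] W) :
    pForm (dualForm C hC) (dualForm B hB) x (superFlip k (Module.Dual k V) (Module.Dual k W)
      (TensorProduct.map B C z)) = star (dualTensorDual k V W x z) := by
  refine homog_tensor_induction (by simp) (fun a b ha hb => by
    simp only [map_add, LinearMap.add_apply, ha, hb, star_add]) ?_ x
  intro i j ψ hψ φ hφ
  refine homog_tensor_induction (by simp) (fun a b ha hb => by
    simp only [map_add, ha, hb, star_add]) ?_ z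
  intro p q v hv w hw
  have hBv : (B v : Module.Dual k V) ∈ gr k p := flat_mem eB hv
  have hCw : (C w : Module.Dual k W) ∈ gr k q := flat_mem eC hw
  rw [TensorProduct.map_tmul, superFlip_tmul hBv hCw, map_smul, pForm_tmul _ _ _ _ hφ hCw,
    dualForm_apply, dualForm_apply, dualTensorDual_tmul, star_mul, smul_eq_mul]
  by_cases h : φ v = 0
  · simp [h]
  · rw [eq_of_dual_apply_ne_zero hv hφ h, ← mul_assoc, koszulSign_mul_self, one_mul]

theorem exists_map_flat_eq [FiniteDimensional k V] [FiniteDimensional k W]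
    {B : V →ₗ⋆[k] V →ₗ[k] k} {C : W →ₗ⋆[k] W →ₗ[k] k} (hB : B.Nondegenerate)
    (hC : C.Nondegenerate) (y : Module.Dual k V ⊗[k] Module.Dual k W) :
    ∃ z : V ⊗[k] W, TensorProduct.map B C z = y := by
  induction y with
  | zero => exact ⟨0, map_zero _⟩
  | add a b ha hb =>
    obtain ⟨z, rfl⟩ := ha
    obtain ⟨z', rfl⟩ := hb
    exact ⟨z + z', map_add _ _ _⟩
  | tmul φ ψ =>
    obtain ⟨v, rfl⟩ := (flat_bijective hB.1).2 φ
    obtain ⟨w, rfl⟩ := (flat_bijective hC.1).2 ψ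
    exact ⟨v ⊗ₜ w, TensorProduct.map_tmul _ _ _ _⟩

end DualTensorForm

namespace SesqMod

variable {k : Type u} {H : Type w} [Field k] [StarRing k] [Ring H] [Algebra k H] [Coalgebra k H]
  [SuperSpace k H] [HopfSuperalgebra k H] {ℛ : RibbonStructure k H} {D : Dagger ℛ}
  {s : ℛ.HalfTwist}

/-- The transpose of a morphism for the left dualities. -/
abbrev transpose {V W : SesqMod D s} (f : V ⟶ W) : dual W ⟶ dual V :=
  @rightAdjointMate _ _ _ V W (@HasRightDual.mk _ _ _ V (dual V) (leftPairing V))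
    (@HasRightDual.mk _ _ _ W (dual W) (leftPairing W)) f

theorem lin_transpose {V W : SesqMod D s} (f : V ⟶ W) (φ : Module.Dual k W.carrier) :
    lin (transpose f) φ = φ ∘ₗ lin f := by
  have h := congrArg lin (@rightAdjointMate_comp_evaluation _ _ _ V W
    (@HasRightDual.mk _ _ _ V (dual V) (leftPairing V))
    (@HasRightDual.mk _ _ _ W (dual W) (leftPairing W)) f)
  exact LinearMap.ext fun v => LinearMap.congr_fun h (φ ⊗ₜ[k] v)

/-- Every functional on `V` is `(v | ·)`, which the transpose of `f†` sends to `(f v | ·)`; the dual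
form against it is the conjugate of the value at `f v`. -/
theorem adjoint_transpose {V W : SesqMod D s} (f : V ⟶ W) :
    adjoint (transpose f) = transpose (adjoint f) := by
  rw [adjoint_eq_iff]
  intro (φ : Module.Dual k W.carrier) (ψ : Module.Dual k V.carrier)
  obtain ⟨v, rfl⟩ := (flat_bijective V.form_nondegenerate.1).2 ψ
  have e : (V.form v : Module.Dual k V.carrier) ∘ₗ lin (adjoint f) = W.form (lin f v) :=
    LinearMap.ext fun w => (form_adjoint f v w).symm
  rw [lin_transpose, lin_transpose, e]
  exact (dualForm_apply V.form V.form_nondegenerate _ v).trans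
    (dualForm_apply W.form W.form_nondegenerate φ _).symm

/-- The isomorphism `W* ⊗ V* ≅ (V ⊗ W)*`. -/
abbrev dualTensorIso (V W : SesqMod D s) : dual W ⊗ dual V ≅ dual (V ⊗ W) :=
  rightDualIso (@ExactPairing.tensor _ _ _ V W (dual V) (dual W) (leftPairing V) (leftPairing W))
    (leftPairing (V ⊗ W))

theorem lin_dualTensorIso (V W : SesqMod D s) :
    lin (dualTensorIso V W).hom = dualTensorDual k V.carrier W.carrier := by
  have h := congrArg lin (@rightAdjointMate_comp_evaluation _ _ _ (V ⊗ W) (V ⊗ W)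
    (@HasRightDual.mk _ _ _ _ (dual (V ⊗ W)) (leftPairing (V ⊗ W)))
    (@HasRightDual.mk _ _ _ _ (dual W ⊗ dual V)
      (@ExactPairing.tensor _ _ _ V W (dual V) (dual W) (leftPairing V) (leftPairing W))) (𝟙 _))
  have e : (@ExactPairing.tensor _ _ _ V W (dual V) (dual W) (leftPairing V)
      (leftPairing W)).evaluation' = (α_ _ _ _).hom ≫ dual W ◁ (α_ _ _ _).inv ≫
        dual W ◁ ((leftPairing V).evaluation' ▷ W) ≫ dual W ◁ (λ_ W).hom ≫
          (leftPairing W).evaluation' := by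
    rw [show (@ExactPairing.tensor _ _ _ V W (dual V) (dual W) (leftPairing V)
      (leftPairing W)).evaluation' = 𝟙 _ ⊗≫ dual W ◁ ((leftPairing V).evaluation' ▷ W) ⊗≫
        (leftPairing W).evaluation' from rfl]
    simp [monoidalComp]
  refine TensorProduct.ext' fun (ψ : Module.Dual k W.carrier) (φ : Module.Dual k V.carrier) =>
    TensorProduct.ext' fun v w => ?_
  rw [MonoidalCategory.whiskerLeft_id, Category.id_comp] at h
  have h2 := LinearMap.congr_fun (h.trans (congrArg lin e)) ((ψ ⊗ₜ[k] φ) ⊗ₜ[k] (v ⊗ₜ[k] w))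
  exact Eq.trans h2 (map_smul ψ (φ v) w)

/-- The vector `z` is chosen to represent `X y` through the two forms. Since `X` is an involution
and its own transpose on duals, `z` represents the image of `y` for the form of `V ⊗ W`. Both sides
are then the conjugate of the image of `x` evaluated at `z`. -/
theorem form_dualTensorIso (V W : SesqMod D s) (x y : Module.Dual k W.carrier ⊗[k]
    Module.Dual k V.carrier) :
    (dual (V ⊗ W)).form (lin (dualTensorIso V W).hom x) (lin (dualTensorIso V W).hom y) =
      (dual W ⊗ dual V).form x y := by
  obtain ⟨z, hz⟩ := exists_map_flat_eq V.form_nondegenerate W.form_nondegenerate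
    (linX s (HMod.dual W.toHMod) (HMod.dual V.toHMod) y)
  have hy : lin (dualTensorIso V W).hom y = tensorForm V W z := by
    refine LinearMap.ext fun u => ?_
    have h1 := HMod.X_comp_dualTensor s (V := V.toHMod) (W := W.toHMod) (dualTensorIso V W).hom
      (dualTensorIso W V).hom (lin_dualTensorIso V W) (lin_dualTensorIso W V)
    have h2 := LinearMap.congr_fun (LinearMap.congr_fun (congrArg HMod.lin h1)
      (linX s (HMod.dual W.toHMod) (HMod.dual V.toHMod) y)) u
    have h3 := pForm_superFlip_apply V.form_even W.form_even z (linX s V.toHMod W.toHMod u)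
    rw [hz, ← lin_dualTensorIso] at h3
    refine Eq.trans ?_ (h2.trans h3.symm)
    exact LinearMap.congr_fun (congrArg (lin (dualTensorIso V W).hom)
      (linX_linX (s := s) (HMod.dual W.toHMod) (HMod.dual V.toHMod) y).symm) u
  have h4 := pForm_dualForm_superFlip V.form_nondegenerate W.form_nondegenerate V.form_even
    W.form_even x z
  rw [hz, ← lin_dualTensorIso] at h4
  rw [hy]
  exact (dualForm_apply (tensorForm V W) (tensorForm_nondegenerate V W) _ z).trans h4.symm

theorem adjoint_dualTensorIso (V W : SesqMod D s) :
    adjoint (dualTensorIso V W).hom = (dualTensorIso V W).inv := by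
  rw [adjoint_eq_iff]
  intro x y
  refine Eq.trans ?_ (form_dualTensorIso V W x (lin (dualTensorIso V W).inv y))
  exact congrArg ((dual (V ⊗ W)).form (lin (dualTensorIso V W).hom x))
    (LinearMap.congr_fun (congrArg lin (dualTensorIso V W).inv_hom_id) y).symm

/-- The sesquilinear pivotal structure of the category of sesquilinear modules. -/
def sesquilinearPivotalStructure :
    SesquilinearPivotalStructure k (SesqMod D s) SesqMod.dual where
  toConjugation := conjugation
  left := leftPairing
  right := rightPairing
  transpose {V W} f := by
    -- Every morphism is an adjoint. The right-dual transpose of `f†` is the adjoint of the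
    -- left-dual transpose of `f`, and hence the left-dual transpose of `f†`.
    obtain ⟨f, rfl⟩ := (adjoint_bijective W V).2 f
    exact (adjoint_transpose f).symm.trans
      (conjugation.leftAdjointMate_dag (leftPairing W) (leftPairing V) f).symm
  dual_tensor V W := conjugation.rightDualIso_tensor_eq_leftDualIso_tensor (leftPairing V)
    (leftPairing W) (leftPairing (V ⊗ W)) (adjoint_dualTensorIso V W)
  dag_left_coev _ := rfl
  dag_left_ev _ := rfl
  dag_right_coev := adjoint_rightPairing_coevaluation
  dag_right_ev := adjoint_rightPairing_evaluation

end SesqMod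

end SuperHopf

end

theorem theoremT {k : Type u} {H : Type w} [Field k] [StarRing k] [Ring H] [Algebra k H]
    [Coalgebra k H] [SuperSpace k H] [HopfSuperalgebra k H] (ℛ : RibbonStructure k H)
    (D : Dagger ℛ) (s : ℛ.HalfTwist) :
    IsTensorCategoryOver k (SesqMod D s) ∧
    ∃ P : SesquilinearPivotalStructure k (SesqMod D s) SesqMod.dual,
      (∀ V : SesqMod D s,
        SesqMod.lin (P.left V).coevaluation' = V.toHMod.leftCoev ∧
        SesqMod.lin (P.left V).evaluation' = V.toHMod.leftEv ∧
        SesqMod.lin (P.right V).coevaluation' = V.toHMod.rightCoev ℛ ∧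
        SesqMod.lin (P.right V).evaluation' = V.toHMod.rightEv ℛ) ∧
      (∀ (V W : SesqMod D s) (f : V ⟶ W) (h : W ⟶ V), P.dag f = h ↔
        ∀ v w, W.form (SesqMod.lin f v) w = V.form v (SesqMod.lin h w)) ∧
      (∃ B : BraidedCategory (SesqMod D s), ∀ V W : SesqMod D s,
        B.braiding V W = SesqMod.braid V W) ∧
      ∀ V W : SesqMod D s, P.dag (SesqMod.braid V W).hom = (SesqMod.braid V W).inv :=
  ⟨SesqMod.isTensorCategoryOver, SesqMod.sesquilinearPivotalStructure,
    fun V => ⟨rfl, rfl, SesqMod.lin_rightPairing_coevaluation V,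
      SesqMod.lin_rightPairing_evaluation V⟩,
    fun _ _ _ _ => SesqMod.adjoint_eq_iff, ⟨SesqMod.braidedCategory, fun _ _ => rfl⟩,
    SesqMod.adjoint_braid⟩
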